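/- Let $N\ge 2$, $p>1$, with $p<\frac{N+2}{N-2}$ if $N\ge 3$, and let $a_\infty,b_\infty>0$. Assume (H1) $a\in L^{N/2}(\mathbb R^N)$, $a\ge 0$, $a\ne 0$, and $a(x)\to 0$ as $|x|\to\infty$; (H2) $b\in L^{\infty}(\mathbb R^N)$, $b\ge 0$, $b\ne 0$, and $b(x)\to 0$ as $|x|\to\infty$ (inequalities and limits being understood up to null sets). For $\lambda\ge 0$ and $u\in H^1(\mathbb R^N)$ with $\int_{\mathbb R^N} (a_\infty+\lambda a)u^2<\infty$ (no restriction if $N\ge3$ or $\lambda=0$) let $$I_\lambda(u)=\frac12\int_{\mathbb R^N}\big(|\nabla u|^2+(a_\infty+\lambda a(x))u^2\big)\,dx-\frac1{p+1}\int_{\mathbb R^N}(b_\infty+b(x))|u|^{p+1}\,dx,$$ and let $I_\infty(u)=\frac12\int_{\mathbb R^N}(|\nabla u|^2+a_\infty u^2)\,dx-\frac1{p+1}\int_{\mathbb R^N} b_\infty|u|^{p+1}\,dx$ on $H^1(\mathbb R^N)$. Write $I'(u)[v]$ for the directional derivative of a functional $I$ at $u$ along $v$. Let $\mathcal N_\lambda$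 (resp. $\mathcal N_\infty$) be the set of all $u\neq 0$ in the domain of $I_\lambda$ (resp. $I_\infty$) with $I_\lambda'(u)[u]=0$ (resp. $I_\infty'(u)[u]=0$), and put $$m_\lambda=\inf_{\mathcal N_\lambda} I_\lambda,\qquad m_\infty=\inf_{\mathcal N_\infty} I_\infty .$$ A ground state solution for $\lambda$ is a nontrivial critical point $u$ of $I_\lambda$ (that is, a nontrivial solution $u \in H^1(\mathbb R^N)$ of $-\Delta u+(a_\infty+\lambda a)u=(b_\infty+b)|u|^{p-1}u$ in $\mathbb R^N$) with $I_\lambda(u)=m_\lambda$. Then: 1. If $\bar\lambda\ge 0$ is such that $m_{\bar\lambda}=m_\infty$, then for every $\lambda>\bar\lambda$ one has $m_\lambda=m_\infty$, and $m_\lambda$ is not achieved, i.e. there is no $u\in\mathcal N_\lambda$ with $I_\lambda(u)=m_\lambda$. 2. Consequently, the set of all $\lambda\ge 0$ for which there is no ground state solution is either empty or a half-line, i.e. equal to $[\lambda^*,\infty)$ or $(\lambda^*,\infty)$ for some $\lambda^*\ge 0$. -/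

import Mathlib

open MeasureTheory Filter Topology Set
open scoped ENNReal ContDiff

noncomputable section

/-- The Euclidean space `ℝ^N`. -/
abbrev RN (N : ℕ) : Type := EuclideanSpace ℝ (Fin N)

/-- `g` is the weak gradient of `u` on `ℝ^N`: for every test function `φ ∈ C_c^∞(ℝ^N)` and every
coordinate `i`, `∫ u ∂_i φ = - ∫ g_i φ`. -/
def IsWeakGradient {N : ℕ} (u : RN N → ℝ) (g : RN N → RN N) : Prop :=
  ∀ φ : RN N → ℝ, ContDiff ℝ ∞ φ → HasCompactSupport φ → ∀ i : Fin N,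
    ∫ x, u x * fderiv ℝ φ x (EuclideanSpace.single i 1) = - ∫ x, g x i * φ x

theorem memLp_two_of_test {N : ℕ} {φ : RN N → ℝ} (h : Continuous φ) (hc : HasCompactSupport φ) :
    MemLp φ 2 volume :=
  h.memLp_of_hasCompactSupport hc

theorem memLp_two_fderiv_of_test {N : ℕ} {φ : RN N → ℝ} (h : ContDiff ℝ ∞ φ)
    (hc : HasCompactSupport φ) (e : RN N) :
    MemLp (fun x => fderiv ℝ φ x e) 2 volume := by
  refine Continuous.memLp_of_hasCompactSupport ?_ ?_
  · exact (h.continuous_fderiv (by simp)).clm_apply continuous_const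
  · exact hc.fderiv_apply (𝕜 := ℝ) e

theorem memLp_two_coord {N : ℕ} (g : Lp (RN N) 2 (volume : Measure (RN N))) (i : Fin N) :
    MemLp (fun x => g x i) 2 volume :=
  (EuclideanSpace.proj (𝕜 := ℝ) i : RN N →L[ℝ] ℝ).comp_memLp' (Lp.memLp g)

/-- The Sobolev space `H¹(ℝ^N)`, as the space of pairs `(u, ∇u) ∈ L²(ℝ^N) × L²(ℝ^N; ℝ^N)` where
`∇u` is the weak gradient of `u`. -/
def SobolevH1 (N : ℕ) : Submodule ℝ
    (WithLp 2 (Lp ℝ 2 (volume : Measure (RN N)) × Lp (RN N) 2 (volume : Measure (RN N)))) where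
  carrier := {w | IsWeakGradient (N := N) (fun x => w.fst x) (fun x => w.snd x)}
  zero_mem' := by
    intro φ _ _ i
    have h1 : ∫ x, ((0 : Lp ℝ 2 (volume : Measure (RN N))) x)
        * fderiv ℝ φ x (EuclideanSpace.single i 1) = 0 := by
      refine integral_eq_zero_of_ae ?_
      filter_upwards [Lp.coeFn_zero ℝ 2 (volume : Measure (RN N))] with x hx
      rw [hx]
      simp
    have h2 : ∫ x, ((0 : Lp (RN N) 2 (volume : Measure (RN N))) x) i * φ x = 0 := by
      refine integral_eq_zero_of_ae ?_
      filter_upwards [Lp.coeFn_zero (RN N) 2 (volume : Measure (RN N))] with x hx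
      rw [hx]
      simp
    simp only [WithLp.zero_fst, WithLp.zero_snd]
    rw [h1, h2, neg_zero]
  add_mem' := by
    intro v w hv hw φ hφ hc i
    have hv' := hv φ hφ hc i
    have hw' := hw φ hφ hc i
    have hd := memLp_two_fderiv_of_test hφ hc (EuclideanSpace.single i 1)
    have hf := memLp_two_of_test hφ.continuous hc
    have h1 : ∫ x, (v + w).fst x * fderiv ℝ φ x (EuclideanSpace.single i 1)
        = (∫ x, v.fst x * fderiv ℝ φ x (EuclideanSpace.single i 1))
          + ∫ x, w.fst x * fderiv ℝ φ x (EuclideanSpace.single i 1) := by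
      refine Eq.trans (integral_congr_ae ?_)
        (integral_add ((Lp.memLp v.fst).integrable_mul hd) ((Lp.memLp w.fst).integrable_mul hd))
      filter_upwards [Lp.coeFn_add v.fst w.fst] with x hx
      simp only [WithLp.add_fst]
      rw [hx, Pi.add_apply, add_mul]
    have h2 : ∫ x, (v + w).snd x i * φ x
        = (∫ x, v.snd x i * φ x) + ∫ x, w.snd x i * φ x := by
      refine Eq.trans (integral_congr_ae ?_)
        (integral_add ((memLp_two_coord v.snd i).integrable_mul hf)
          ((memLp_two_coord w.snd i).integrable_mul hf))
      filter_upwards [Lp.coeFn_add v.snd w.snd] with x hx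
      simp only [WithLp.add_snd]
      rw [hx, Pi.add_apply, PiLp.add_apply, add_mul]
    rw [h1, h2, hv', hw']
    ring
  smul_mem' := by
    intro c w hw φ hφ hc i
    have hw' := hw φ hφ hc i
    have h1 : ∫ x, (c • w).fst x * fderiv ℝ φ x (EuclideanSpace.single i 1)
        = c * ∫ x, w.fst x * fderiv ℝ φ x (EuclideanSpace.single i 1) := by
      rw [← integral_const_mul]
      refine integral_congr_ae ?_
      filter_upwards [Lp.coeFn_smul c w.fst] with x hx
      simp [hx, mul_assoc]
    have h2 : ∫ x, (c • w).snd x i * φ x = c * ∫ x, w.snd x i * φ x := by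
      rw [← integral_const_mul]
      refine integral_congr_ae ?_
      filter_upwards [Lp.coeFn_smul c w.snd] with x hx
      simp [hx, mul_assoc]
    rw [h1, h2, hw']
    ring

/-- A representative of `u ∈ H¹(ℝ^N)`. -/
def sobVal {N : ℕ} (u : SobolevH1 N) : RN N → ℝ := fun x => u.1.fst x

/-- A representative of the weak gradient `∇u` of `u ∈ H¹(ℝ^N)`. -/
def sobGrad {N : ℕ} (u : SobolevH1 N) : RN N → RN N := fun x => u.1.snd x

/-! The equation `-Δu + V u = K |u|^(p-1) u` in `ℝ^N`, with general coefficients `V`, `K`. -/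

/-- `u ∈ H¹(ℝ^N)` has finite potential energy, `∫ |V| u² < ∞`. -/
def FinitePotential {N : ℕ} (V : RN N → ℝ) (u : SobolevH1 N) : Prop :=
  Integrable (fun x => V x * sobVal u x ^ 2) volume

/-- The functional `I(u) = (1/2) ∫ (|∇u|² + V u²) - (1/(p+1)) ∫ K |u|^(p+1)`. -/
def energy {N : ℕ} (V K : RN N → ℝ) (p : ℝ) (u : SobolevH1 N) : ℝ :=
  1 / 2 * (∫ x, (‖sobGrad u x‖ ^ 2 + V x * sobVal u x ^ 2))
    - 1 / (p + 1) * ∫ x, K x * |sobVal u x| ^ (p + 1)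

/-- The first variation `I'(u)[v] = ∫ (∇u · ∇v + V u v) - ∫ K |u|^(p-1) u v`. -/
def energyDeriv {N : ℕ} (V K : RN N → ℝ) (p : ℝ) (u v : SobolevH1 N) : ℝ :=
  (∫ x, (inner ℝ (sobGrad u x) (sobGrad v x) + V x * sobVal u x * sobVal v x))
    - ∫ x, K x * |sobVal u x| ^ (p - 1) * sobVal u x * sobVal v x

/-- The Nehari manifold `{u ∈ H¹(ℝ^N) \ {0} : I'(u)[u] = 0}`. -/
def nehari {N : ℕ} (V K : RN N → ℝ) (p : ℝ) : Set (SobolevH1 N) :=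
  {u | u ≠ 0 ∧ FinitePotential V u ∧ energyDeriv V K p u u = 0}

/-- The infimum of the functional `I` on its Nehari manifold. -/
def nehariLevel {N : ℕ} (V K : RN N → ℝ) (p : ℝ) : ℝ :=
  sInf (energy V K p '' nehari V K p)

/-- The infimum of `I` on the Nehari manifold is achieved. -/
def LevelAchieved {N : ℕ} (V K : RN N → ℝ) (p : ℝ) : Prop :=
  ∃ u ∈ nehari V K p, energy V K p u = nehariLevel V K p

/-- `u` is a solution of `-Δu + V u = K |u|^(p-1) u`, `u ∈ H¹(ℝ^N)`, that is, a critical point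
of the functional `I`. -/
def IsSolution {N : ℕ} (V K : RN N → ℝ) (p : ℝ) (u : SobolevH1 N) : Prop :=
  FinitePotential V u ∧ ∀ v : SobolevH1 N, FinitePotential V v → energyDeriv V K p u v = 0

/-- `u` is a ground state solution: a nontrivial solution at the level given by the infimum of
the functional on the Nehari manifold. -/
def IsGroundState {N : ℕ} (V K : RN N → ℝ) (p : ℝ) (u : SobolevH1 N) : Prop :=
  u ≠ 0 ∧ IsSolution V K p u ∧ energy V K p u = nehariLevel V K p

/-- `α_λ(x) = a_∞ + λ a(x)`. -/
def potential {N : ℕ} (ainf : ℝ) (a : RN N → ℝ) (l : ℝ) : RN N → ℝ := fun x => ainf + l * a x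

/-- `β(x) = b_∞ + b(x)`. -/
def weight {N : ℕ} (binf : ℝ) (b : RN N → ℝ) : RN N → ℝ := fun x => binf + b x

/-- `m_λ`. -/
def mLevel {N : ℕ} (ainf binf p : ℝ) (a b : RN N → ℝ) (l : ℝ) : ℝ :=
  nehariLevel (potential ainf a l) (weight binf b) p

/-- `m_∞`, the level of the limit problem `-Δu + a_∞ u = b_∞ |u|^(p-1) u` in `ℝ^N`. -/
def mInfty (N : ℕ) (ainf binf p : ℝ) : ℝ :=
  nehariLevel (N := N) (fun _ => ainf) (fun _ => binf) p

/-- The set of the `λ ≥ 0` for which there is no ground state solution. -/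
def noGroundStateSet {N : ℕ} (ainf binf p : ℝ) (a b : RN N → ℝ) : Set ℝ :=
  {l | 0 ≤ l ∧ ¬ ∃ u : SobolevH1 N, IsGroundState (potential ainf a l) (weight binf b) p u}

/-- `f(x) → 0` as `|x| → ∞`, up to a null set of points `x`. -/
def VanishesAtInfinity {N : ℕ} (f : RN N → ℝ) : Prop :=
  Tendsto f (cocompact (RN N) ⊓ ae volume) (𝓝 0)

end

/-!
The limit problem `-Δu + a_∞ u = b_∞ |u|^(p-1) u` is invariant under translations, and this decides
both which levels `m_λ` are possible and which of them are achieved. On the Nehari manifold the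
energy is the multiple `1/2 - 1/(p+1)` of the quadratic form `Q_λ(u) = ∫ |∇u|² + (a_∞ + λ a) u²`,
so the inequality `μ^(p-1) P(u)² ≤ Q_λ(u)^(p+1)` with `P(u) = ∫ (b_∞ + b) |u|^(p+1)` and
`μ = m_λ / (1/2 - 1/(p+1))` expresses the level without reference to the manifold
(`Admissible.level_rpow_mul_le`).

* `m_λ ≤ m_∞` (`nehari_nonempty_and_level_le`): a competitor for `m_∞`, translated far away, does
  not feel `a`, while `b ≥ 0` only helps. The translation is found by averaging, without any
  embedding into `L^(2N/(N-2))`.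
* `m_λ` is nondecreasing in `λ` (`nehariLevel_mono`), since `a ≥ 0`. Hence `m_λ = m_∞` for all
  `λ > λ̄` once `m_λ̄ = m_∞`.
* If moreover `m_λ` were achieved at `u`, then `∫ a u² = 0` and `u` would minimize the problem for
  `λ̄` as well, and so would `|u|` (`exists_sobAbs`). Minimizers are solutions
  (`Admissible.isSolution_of_energy_eq`), so `|u|` satisfies `-Δ|u| + a_∞ |u| ≥ 0` weakly and is
  positive almost everywhere by the strong maximum principle (`IsSupersolution.pos`). Then `a = 0`,
  which is excluded (`ae_eq_of_level_eq_of_achieved`).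
* If `m_λ < m_∞`, then there is a ground state (`exists_minimizer_of_lt`): a minimizing sequence has
  a weak limit `u`, the form and the superquadratic term split along the sequence into the
  contributions of `u` and of the remainder (Brezis–Lieb), and for the remainder the inequality of
  the limit problem holds in place of that for `λ`; as `m_λ < m_∞` and `p > 1`, splitting the mass
  is strictly too expensive, so nothing is lost.

Consequently a `λ̄` without ground state has `m_λ̄ = m_∞`, and no larger `λ` has one: the set of such
parameters is closed upwards.

The analytic input is proved directly for pairs `(u, ∇u)`. The bound
`‖u(· + y) - u‖₂ ≤ |y| ‖∇u‖₂` yields the subcritical embeddings (by comparing a value of `u` with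
those on a ball) and local compactness (Kolmogorov–Riesz). The maximum principle is obtained from a
monotone family of weighted averages around a Lebesgue point, as in the proof of the mean value
inequality.
-/

noncomputable section

/-! ### The Hilbert space `H¹(ℝ^N)` -/

section SobolevBasics

variable {N : ℕ}

theorem sobVal_memLp (u : SobolevH1 N) : MemLp (sobVal u) 2 volume := Lp.memLp _

theorem sobGrad_memLp (u : SobolevH1 N) : MemLp (sobGrad u) 2 volume := Lp.memLp _

theorem stronglyMeasurable_sobVal (u : SobolevH1 N) : StronglyMeasurable (sobVal u) :=
  Lp.stronglyMeasurable _

theorem measurable_sobVal (u : SobolevH1 N) : Measurable (sobVal u) :=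
  (stronglyMeasurable_sobVal u).measurable

theorem isWeakGradient_sob (u : SobolevH1 N) : IsWeakGradient (sobVal u) (sobGrad u) := u.2

theorem integrable_sobVal_sq (u : SobolevH1 N) : Integrable (fun x => sobVal u x ^ 2) :=
  (sobVal_memLp u).integrable_sq

theorem integrable_norm_sobGrad_sq (u : SobolevH1 N) :
    Integrable (fun x => ‖sobGrad u x‖ ^ 2) :=
  (memLp_two_iff_integrable_sq_norm (sobGrad_memLp u).1).1 (sobGrad_memLp u)

theorem integrable_sobVal_mul (u v : SobolevH1 N) :
    Integrable (fun x => sobVal u x * sobVal v x) :=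
  (sobVal_memLp u).integrable_mul (sobVal_memLp v)

theorem integrable_inner_sobGrad (u v : SobolevH1 N) :
    Integrable (fun x => inner ℝ (sobGrad u x) (sobGrad v x)) :=
  L2.integrable_inner (𝕜 := ℝ) u.1.snd v.1.snd

theorem IsWeakGradient.congr_ae {f f' : RN N → ℝ} {g g' : RN N → RN N}
    (h : IsWeakGradient f g) (hf : f =ᵐ[volume] f') (hg : g =ᵐ[volume] g') :
    IsWeakGradient f' g' := by
  intro φ hφ hc i
  have h1 := h φ hφ hc i
  have e1 : ∫ x, f x * fderiv ℝ φ x (EuclideanSpace.single i 1)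
      = ∫ x, f' x * fderiv ℝ φ x (EuclideanSpace.single i 1) :=
    integral_congr_ae (by filter_upwards [hf] with x hx; rw [hx])
  have e2 : ∫ x, g x i * φ x = ∫ x, g' x i * φ x :=
    integral_congr_ae (by filter_upwards [hg] with x hx; rw [hx])
  rw [← e1, ← e2, h1]

/-- The element of `H¹(ℝ^N)` with the given square integrable value and weak gradient. -/
def sobOfFun (f : RN N → ℝ) (g : RN N → RN N) (hf : MemLp f 2 volume)
    (hg : MemLp g 2 volume) (h : IsWeakGradient f g) : SobolevH1 N :=
  ⟨WithLp.toLp 2 (hf.toLp f, hg.toLp g),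
    h.congr_ae (f' := fun x => hf.toLp f x) (g' := fun x => hg.toLp g x)
      hf.coeFn_toLp.symm hg.coeFn_toLp.symm⟩

theorem sobVal_ofFun {f : RN N → ℝ} {g : RN N → RN N} (hf : MemLp f 2 volume)
    (hg : MemLp g 2 volume) (h : IsWeakGradient f g) :
    sobVal (sobOfFun f g hf hg h) =ᵐ[volume] f := hf.coeFn_toLp

theorem sobGrad_ofFun {f : RN N → ℝ} {g : RN N → RN N} (hf : MemLp f 2 volume)
    (hg : MemLp g 2 volume) (h : IsWeakGradient f g) :
    sobGrad (sobOfFun f g hf hg h) =ᵐ[volume] g := hg.coeFn_toLp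

theorem sobVal_add (u v : SobolevH1 N) :
    sobVal (u + v) =ᵐ[volume] fun x => sobVal u x + sobVal v x := by
  have := Lp.coeFn_add u.1.fst v.1.fst
  filter_upwards [this] with x hx using hx

theorem sobGrad_add (u v : SobolevH1 N) :
    sobGrad (u + v) =ᵐ[volume] fun x => sobGrad u x + sobGrad v x := by
  have := Lp.coeFn_add u.1.snd v.1.snd
  filter_upwards [this] with x hx using hx

theorem sobVal_smul (c : ℝ) (u : SobolevH1 N) :
    sobVal (c • u) =ᵐ[volume] fun x => c * sobVal u x := by
  have := Lp.coeFn_smul c u.1.fst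
  filter_upwards [this] with x hx using hx

theorem sobGrad_smul (c : ℝ) (u : SobolevH1 N) :
    sobGrad (c • u) =ᵐ[volume] fun x => c • sobGrad u x := by
  have := Lp.coeFn_smul c u.1.snd
  filter_upwards [this] with x hx using hx

theorem sobolev_inner (u v : SobolevH1 N) :
    inner ℝ u v = (∫ x, sobVal u x * sobVal v x)
      + ∫ x, inner ℝ (sobGrad u x) (sobGrad v x) := by
  rw [Submodule.coe_inner, WithLp.prod_inner_apply, L2.inner_def, L2.inner_def]
  congr 1
  refine integral_congr_ae (Eventually.of_forall fun x => ?_)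
  simp [sobVal, mul_comm]

theorem sobolev_norm_sq (u : SobolevH1 N) :
    ‖u‖ ^ 2 = (∫ x, sobVal u x ^ 2) + ∫ x, ‖sobGrad u x‖ ^ 2 := by
  rw [← real_inner_self_eq_norm_sq, sobolev_inner]
  simp [sq]

theorem integral_sobVal_sq_le (u : SobolevH1 N) : ∫ x, sobVal u x ^ 2 ≤ ‖u‖ ^ 2 := by
  rw [sobolev_norm_sq]
  have : 0 ≤ ∫ x, ‖sobGrad u x‖ ^ 2 := integral_nonneg fun x => by positivity
  linarith

theorem integral_norm_sobGrad_sq_le (u : SobolevH1 N) :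
    ∫ x, ‖sobGrad u x‖ ^ 2 ≤ ‖u‖ ^ 2 := by
  rw [sobolev_norm_sq]
  have : 0 ≤ ∫ x, sobVal u x ^ 2 := integral_nonneg fun x => by positivity
  linarith

theorem sobGrad_ae_zero {u : SobolevH1 N} (h : sobVal u =ᵐ[volume] 0) :
    sobGrad u =ᵐ[volume] 0 := by
  have hi : ∀ i : Fin N, ∀ᵐ x, sobGrad u x i = 0 := by
    intro i
    have hm : MemLp (fun x => sobGrad u x i) 2 volume := memLp_two_coord u.1.snd i
    refine ae_eq_zero_of_integral_contDiff_smul_eq_zero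
      (hm.locallyIntegrable (by norm_num)) ?_
    intro φ hφ hc
    have h1 := isWeakGradient_sob u φ hφ hc i
    have h2 : ∫ x, sobVal u x * fderiv ℝ φ x (EuclideanSpace.single i 1) = 0 :=
      integral_eq_zero_of_ae (by filter_upwards [h] with x hx; simp [hx])
    rw [h2] at h1
    simp only [smul_eq_mul]
    simp_rw [mul_comm (φ _)]
    linarith
  filter_upwards [ae_all_iff.2 hi] with x hx
  ext i
  simpa using hx i

theorem sobVal_ae_zero_iff {u : SobolevH1 N} : sobVal u =ᵐ[volume] 0 ↔ u = 0 := by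
  constructor
  · intro h
    have hg := sobGrad_ae_zero h
    have : ‖u‖ ^ 2 = 0 := by
      rw [sobolev_norm_sq]
      rw [integral_eq_zero_of_ae, integral_eq_zero_of_ae, add_zero]
      · filter_upwards [hg] with x hx; simp [hx]
      · filter_upwards [h] with x hx; simp [hx]
    simpa using this
  · rintro rfl
    exact Lp.coeFn_zero ℝ 2 (volume : Measure (RN N))

/-! ### Test functions and translates -/

theorem isWeakGradient_of_contDiff {φ : RN N → ℝ} (h : ContDiff ℝ ∞ φ) :
    IsWeakGradient φ (fun x => (InnerProductSpace.toDual ℝ (RN N)).symm (fderiv ℝ φ x)) := by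
  intro ψ hψ hc i
  have hdφ : Continuous (fun x => fderiv ℝ φ x (EuclideanSpace.single i 1)) :=
    (h.continuous_fderiv (by simp)).clm_apply continuous_const
  have hdψ : Continuous (fun x => fderiv ℝ ψ x (EuclideanSpace.single i 1)) :=
    (hψ.continuous_fderiv (by simp)).clm_apply continuous_const
  have hc' : HasCompactSupport (fun x => fderiv ℝ ψ x (EuclideanSpace.single i 1)) :=
    hc.fderiv_apply (𝕜 := ℝ) _
  rw [integral_mul_fderiv_eq_neg_fderiv_mul_of_integrable]
  · congr 1
    refine integral_congr_ae (Eventually.of_forall fun x => ?_)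
    simp only
    congr 1
    have := InnerProductSpace.toDual_symm_apply (𝕜 := ℝ) (E := RN N)
      (x := EuclideanSpace.single i 1) (y := fderiv ℝ φ x)
    rw [← this, EuclideanSpace.inner_single_right]
    simp
  · exact (hdφ.mul hψ.continuous).integrable_of_hasCompactSupport hc.mul_left
  · exact (h.continuous.mul hdψ).integrable_of_hasCompactSupport hc'.mul_left
  · exact (h.continuous.mul hψ.continuous).integrable_of_hasCompactSupport hc.mul_left
  · exact fun x _ => h.differentiable (by simp) x
  · exact fun x _ => hψ.differentiable (by simp) x

theorem memLp_gradient_of_test {φ : RN N → ℝ} (h : ContDiff ℝ ∞ φ) (hc : HasCompactSupport φ) :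
    MemLp (fun x => (InnerProductSpace.toDual ℝ (RN N)).symm (fderiv ℝ φ x)) 2 volume := by
  refine Continuous.memLp_of_hasCompactSupport ?_ ?_
  · exact (LinearIsometryEquiv.continuous _).comp (h.continuous_fderiv (by simp))
  · exact (hc.fderiv (𝕜 := ℝ)).comp_left (map_zero _)

/-- A test function, as an element of `H¹(ℝ^N)`. -/
def sobOfTest (φ : RN N → ℝ) (h : ContDiff ℝ ∞ φ) (hc : HasCompactSupport φ) :
    SobolevH1 N :=
  sobOfFun φ _ (memLp_two_of_test h.continuous hc) (memLp_gradient_of_test h hc)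
    (isWeakGradient_of_contDiff h)

theorem memLp_comp_add {E : Type*} [NormedAddCommGroup E] {q : ℝ≥0∞} {f : RN N → E}
    (hf : MemLp f q volume) (z : RN N) : MemLp (fun x => f (x + z)) q volume :=
  hf.comp_measurePreserving (measurePreserving_add_right volume z)

theorem HasCompactSupport.comp_add {φ : RN N → ℝ} (hc : HasCompactSupport φ) (z : RN N) :
    HasCompactSupport (fun x => φ (x + z)) :=
  hc.comp_homeomorph (Homeomorph.addRight z)

theorem fderiv_comp_add {φ : RN N → ℝ} (x z : RN N) :
    fderiv ℝ (fun y => φ (y + z)) x = fderiv ℝ φ (x + z) :=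
  fderiv_comp_add_right z

theorem IsWeakGradient.translate {f : RN N → ℝ} {g : RN N → RN N} (h : IsWeakGradient f g)
    (z : RN N) : IsWeakGradient (fun x => f (x + z)) (fun x => g (x + z)) := by
  intro φ hφ hc i
  have h1 := h (fun x => φ (x + -z)) (hφ.comp (contDiff_id.add contDiff_const))
    (HasCompactSupport.comp_add hc (-z)) i
  rw [← integral_add_right_eq_self _ z, ← integral_add_right_eq_self (fun x => g x i * _) z] at h1
  simpa [fderiv_comp_add] using h1

/-- The translate `x ↦ u (x + z)` of `u ∈ H¹(ℝ^N)`. -/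
def sobTranslate (u : SobolevH1 N) (z : RN N) : SobolevH1 N :=
  sobOfFun (fun x => sobVal u (x + z)) (fun x => sobGrad u (x + z))
    (memLp_comp_add (sobVal_memLp u) z) (memLp_comp_add (sobGrad_memLp u) z)
    ((isWeakGradient_sob u).translate z)

theorem sobVal_translate (u : SobolevH1 N) (z : RN N) :
    sobVal (sobTranslate u z) =ᵐ[volume] fun x => sobVal u (x + z) := sobVal_ofFun _ _ _

theorem sobGrad_translate (u : SobolevH1 N) (z : RN N) :
    sobGrad (sobTranslate u z) =ᵐ[volume] fun x => sobGrad u (x + z) := sobGrad_ofFun _ _ _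

end SobolevBasics

/-! ### Translation estimate -/

section Translation

variable {N : ℕ}

/-- The weak gradient, tested in an arbitrary direction. -/
theorem integral_sobVal_mul_fderiv (u : SobolevH1 N) {φ : RN N → ℝ} (hφ : ContDiff ℝ ∞ φ)
    (hc : HasCompactSupport φ) (z : RN N) :
    ∫ x, sobVal u x * fderiv ℝ φ x z = - ∫ x, inner ℝ z (sobGrad u x) * φ x := by
  have hz : z = ∑ i, z i • EuclideanSpace.single i (1 : ℝ) := by
    ext j
    simp [Finset.sum_apply, Pi.single_apply]
  have e1 : ∀ x, sobVal u x * fderiv ℝ φ x z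
      = ∑ i, z i * (sobVal u x * fderiv ℝ φ x (EuclideanSpace.single i 1)) := by
    intro x
    conv_lhs => rw [hz]
    simp only [map_sum, map_smul, smul_eq_mul, Finset.mul_sum]
    exact Finset.sum_congr rfl fun i _ => by ring
  have e2 : ∀ x, inner ℝ z (sobGrad u x) * φ x = ∑ i, z i * (sobGrad u x i * φ x) := by
    intro x
    simp only [PiLp.inner_apply, Finset.sum_mul]
    exact Finset.sum_congr rfl fun i _ => by simp; ring
  simp_rw [e1, e2]
  rw [integral_finsetSum, integral_finsetSum, ← Finset.sum_neg_distrib]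
  · refine Finset.sum_congr rfl fun i _ => ?_
    rw [integral_const_mul, integral_const_mul, isWeakGradient_sob u φ hφ hc i]
    ring
  · intro i _
    exact ((memLp_two_coord u.1.snd i).integrable_mul
      (memLp_two_of_test hφ.continuous hc)).const_mul _
  · intro i _
    exact ((sobVal_memLp u).integrable_mul (memLp_two_fderiv_of_test hφ hc _)).const_mul _

theorem abs_integral_mul_le_sqrt {f g : RN N → ℝ} (hf : MemLp f 2 volume)
    (hg : MemLp g 2 volume) :
    |∫ x, f x * g x| ≤ √(∫ x, f x ^ 2) * √(∫ x, g x ^ 2) := by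
  have key : ∀ (f : RN N → ℝ) (hf : MemLp f 2 volume), ‖hf.toLp f‖ = √(∫ x, f x ^ 2) := by
    intro f hf
    rw [eq_comm, Real.sqrt_eq_iff_mul_self_eq (integral_nonneg fun x => by positivity)
      (norm_nonneg _), ← sq, ← real_inner_self_eq_norm_sq, L2.inner_def]
    refine integral_congr_ae ?_
    filter_upwards [hf.coeFn_toLp] with x hx
    rw [hx]
    simp [sq]
  have h := abs_real_inner_le_norm (hf.toLp f) (hg.toLp g)
  rw [key, key, L2.inner_def] at h
  convert h using 2
  refine integral_congr_ae ?_
  filter_upwards [hf.coeFn_toLp, hg.coeFn_toLp] with x hx hy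
  rw [hx, hy]
  simp [mul_comm]

theorem memLp_inner_sobGrad (u : SobolevH1 N) (z : RN N) :
    MemLp (fun x => inner ℝ z (sobGrad u x)) 2 volume :=
  (innerSL ℝ z).comp_memLp' (sobGrad_memLp u)

/-- Differentiation of `s ↦ ∫ f φ(· - s z)` for a test function `φ`. -/
theorem hasDerivAt_integral_mul_translate {f : RN N → ℝ} (hf : LocallyIntegrable f volume)
    {φ : RN N → ℝ} (hφ : ContDiff ℝ ∞ φ) (hc : HasCompactSupport φ) (z : RN N) (s₀ : ℝ) :
    HasDerivAt (fun s : ℝ => ∫ x, f x * φ (x + -(s • z)))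
      (∫ x, f x * fderiv ℝ φ (x + -(s₀ • z)) (-z)) s₀ := by
  have hdc : Continuous (fun x => fderiv ℝ φ x) := hφ.continuous_fderiv (by simp)
  obtain ⟨C, hC⟩ := (hc.fderiv (𝕜 := ℝ)).exists_bound_of_continuous hdc
  obtain ⟨R, hR⟩ := (hc.isCompact.isBounded).subset_closedBall (0 : RN N)
  -- For `|s - s₀| < 1` all the translates of `φ` are supported in this ball.
  set R' := R + (|s₀| + 1) * ‖z‖ with hR'
  have hder : ∀ x s, HasDerivAt (fun s : ℝ => f x * φ (x + -(s • z)))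
      (f x * fderiv ℝ φ (x + -(s • z)) (-z)) s := by
    intro x s
    refine HasDerivAt.const_mul _ ?_
    have h1 : HasDerivAt (fun s : ℝ => x + -(s • z)) (-z) s := by
      simpa using (((hasDerivAt_id s).smul_const z).neg).const_add x
    exact ((hφ.differentiable (by simp)) _).hasFDerivAt.comp_hasDerivAt s h1
  have main := hasDerivAt_integral_of_dominated_loc_of_deriv_le (μ := (volume : Measure (RN N)))
    (F := fun s x => f x * φ (x + -(s • z)))
    (F' := fun s x => f x * fderiv ℝ φ (x + -(s • z)) (-z)) (x₀ := s₀)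
    (bound := (Metric.closedBall (0 : RN N) R').indicator fun x => |f x| * (C * ‖z‖))
    (s := Metric.ball s₀ 1) (Metric.ball_mem_nhds _ one_pos) ?_ ?_ ?_ ?_ ?_ ?_
  · exact main.2
  · exact Eventually.of_forall fun s => hf.aestronglyMeasurable.mul
      (hφ.continuous.comp (continuous_id.add continuous_const)).aestronglyMeasurable
  · simp only [mul_comm (f _)]
    exact hf.integrable_smul_left_of_hasCompactSupport
      (hφ.continuous.comp (continuous_id.add continuous_const)) (HasCompactSupport.comp_add hc _)
  · exact hf.aestronglyMeasurable.mul
      ((hdc.clm_apply continuous_const).comp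
        (continuous_id.add continuous_const)).aestronglyMeasurable
  · refine Eventually.of_forall fun x s hs => ?_
    by_cases hx : x ∈ Metric.closedBall (0 : RN N) R'
    · rw [indicator_of_mem hx, norm_mul, Real.norm_eq_abs]
      gcongr
      calc ‖fderiv ℝ φ (x + -(s • z)) (-z)‖ ≤ ‖fderiv ℝ φ (x + -(s • z))‖ * ‖-z‖ :=
            ContinuousLinearMap.le_opNorm _ _
        _ ≤ C * ‖z‖ := by
            rw [norm_neg]
            gcongr
            exact hC _
    · rw [indicator_of_notMem hx]
      have h0 : fderiv ℝ φ (x + -(s • z)) = 0 := by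
        by_contra hne
        apply hx
        have hm : x + -(s • z) ∈ tsupport φ :=
          (support_fderiv_subset ℝ) (Function.mem_support.2 hne)
        have h3 := hR hm
        rw [mem_closedBall_zero_iff] at h3 ⊢
        have hs' : |s| ≤ |s₀| + 1 := by
          have h5 : |s - s₀| < 1 := by simpa [Real.dist_eq] using hs
          have h6 : |s| ≤ |s - s₀| + |s₀| := by
            simpa using abs_add_le (s - s₀) s₀
          linarith
        calc ‖x‖ = ‖(x + -(s • z)) + s • z‖ := by congr 1; abel
          _ ≤ ‖x + -(s • z)‖ + ‖s • z‖ := norm_add_le _ _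
          _ ≤ R + (|s₀| + 1) * ‖z‖ := by
            rw [norm_smul, Real.norm_eq_abs]
            gcongr
      simp [h0]
  · refine (integrable_indicator_iff measurableSet_closedBall).2 ?_
    exact ((hf.integrableOn_isCompact (isCompact_closedBall _ _)).abs).mul_const _
  · exact Eventually.of_forall fun x s _ => hder x s

theorem hasDerivAt_integral_sobVal_mul_translate (u : SobolevH1 N) {φ : RN N → ℝ}
    (hφ : ContDiff ℝ ∞ φ) (hc : HasCompactSupport φ) (z : RN N) (s₀ : ℝ) :
    HasDerivAt (fun s : ℝ => ∫ x, sobVal u x * φ (x + -(s • z)))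
      (∫ x, inner ℝ z (sobGrad u x) * φ (x + -(s₀ • z))) s₀ := by
  refine (hasDerivAt_integral_mul_translate ((sobVal_memLp u).locallyIntegrable (by norm_num))
    hφ hc z s₀).congr_deriv ?_
  have h2 := integral_sobVal_mul_fderiv u (φ := fun x => φ (x + -(s₀ • z)))
    (hφ.comp (contDiff_id.add contDiff_const)) (HasCompactSupport.comp_add hc _) z
  rw [← neg_eq_iff_eq_neg, ← integral_neg] at h2
  rw [← h2]
  simp [fderiv_comp_add]

/-- The weak form of the translation estimate: the mean value inequality for
`s ↦ ∫ u φ(· - s z)`. -/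
theorem abs_integral_sub_translate_mul_le (u : SobolevH1 N) {φ : RN N → ℝ}
    (hφ : ContDiff ℝ ∞ φ) (hc : HasCompactSupport φ) (z : RN N) :
    |∫ x, (sobVal u (x + z) - sobVal u x) * φ x|
      ≤ √(∫ x, (inner ℝ z (sobGrad u x)) ^ 2) * √(∫ x, φ x ^ 2) := by
  have hφ2 : ∀ y, MemLp (fun x => φ (x + y)) 2 volume := fun y =>
    memLp_comp_add (memLp_two_of_test hφ.continuous hc) y
  have hφ0 : MemLp φ 2 volume := memLp_two_of_test hφ.continuous hc
  have hmv := (convex_univ (𝕜 := ℝ) (E := ℝ)).norm_image_sub_le_of_norm_hasDerivWithin_le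
    (f := fun s : ℝ => ∫ x, sobVal u x * φ (x + -(s • z)))
    (C := √(∫ x, (inner ℝ z (sobGrad u x)) ^ 2) * √(∫ x, φ x ^ 2)) (x := 0) (y := 1)
    (fun s _ => (hasDerivAt_integral_sobVal_mul_translate u hφ hc z s).hasDerivWithinAt)
    (fun s _ => ?_) (mem_univ _) (mem_univ _)
  · have e : ∫ x, (sobVal u (x + z) - sobVal u x) * φ x
        = (∫ x, sobVal u x * φ (x + -z)) - ∫ x, sobVal u x * φ x := by
      rw [← integral_add_right_eq_self (fun x => sobVal u x * φ (x + -z)) z, ← integral_sub]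
      · refine integral_congr_ae (Eventually.of_forall fun x => ?_)
        simp [sub_mul]
      · simp only [add_neg_cancel_right]
        exact (memLp_comp_add (sobVal_memLp u) z).integrable_mul hφ0
      · exact (sobVal_memLp u).integrable_mul hφ0
    rw [e]
    simpa using hmv
  · have h := abs_integral_mul_le_sqrt (memLp_inner_sobGrad u z) (hφ2 (-(s • z)))
    rwa [integral_add_right_eq_self (fun x => φ x ^ 2)] at h

/-- Translating `u ∈ H¹` by `z` costs at most `‖z · ∇u‖` in `L²`. This follows from its weak form,
as test functions are dense in `L²`. -/
theorem integral_sub_translate_sq_le (u : SobolevH1 N) (z : RN N) :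
    ∫ x, (sobVal u (x + z) - sobVal u x) ^ 2 ≤ ∫ x, (inner ℝ z (sobGrad u x)) ^ 2 := by
  have hf : MemLp (fun x => sobVal u (x + z) - sobVal u x) 2 volume :=
    (memLp_comp_add (sobVal_memLp u) z).sub (sobVal_memLp u)
  set f := hf.toLp _ with hfdef
  set C := √(∫ x, (inner ℝ z (sobGrad u x)) ^ 2) with hC
  have key : ∀ g : Lp ℝ 2 (volume : Measure (RN N)), |inner ℝ f g| ≤ C * ‖g‖ := by
    intro g
    have hcl : IsClosed {g : Lp ℝ 2 (volume : Measure (RN N)) | |inner ℝ f g| ≤ C * ‖g‖} :=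
      isClosed_le ((continuous_const.inner continuous_id).abs)
        (continuous_const.mul continuous_norm)
    refine hcl.closure_subset_iff.2 ?_ ((Lp.dense_hasCompactSupport_contDiff
      (F := ℝ) (μ := (volume : Measure (RN N))) (p := 2) (by norm_num)) g)
    rintro g ⟨φ, hgφ, hc, hφ⟩
    have h := abs_integral_sub_translate_mul_le u hφ hc z
    have e1 : inner ℝ f g = ∫ x, (sobVal u (x + z) - sobVal u x) * φ x := by
      rw [L2.inner_def]
      refine integral_congr_ae ?_
      filter_upwards [hf.coeFn_toLp, hgφ] with x hx hy
      rw [hfdef, hx, hy]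
      simp [mul_comm]
    have e2 : ‖g‖ = √(∫ x, φ x ^ 2) := by
      rw [eq_comm, Real.sqrt_eq_iff_mul_self_eq (integral_nonneg fun x => by positivity)
        (norm_nonneg _), ← sq, ← real_inner_self_eq_norm_sq, L2.inner_def]
      refine integral_congr_ae ?_
      filter_upwards [hgφ] with x hx
      rw [hx]
      simp [sq]
    change |inner ℝ f g| ≤ C * ‖g‖
    rw [e1, e2]
    exact h
  have h1 := key f
  rw [real_inner_self_eq_norm_sq, abs_of_nonneg (by positivity), sq] at h1
  have h2 : ‖f‖ ≤ C := by
    by_contra hlt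
    push Not at hlt
    have : 0 < ‖f‖ := lt_of_le_of_lt (Real.sqrt_nonneg _) hlt
    nlinarith
  have h3 : ‖f‖ ^ 2 = ∫ x, (sobVal u (x + z) - sobVal u x) ^ 2 := by
    rw [← real_inner_self_eq_norm_sq, L2.inner_def]
    refine integral_congr_ae ?_
    filter_upwards [hf.coeFn_toLp] with x hx
    rw [hfdef, hx]
    simp [sq]
  rw [← h3, ← Real.sq_sqrt (integral_nonneg fun x => by positivity :
    0 ≤ ∫ x, (inner ℝ z (sobGrad u x)) ^ 2)]
  exact pow_le_pow_left₀ (norm_nonneg _) h2 2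

theorem integral_sub_translate_sq_le_norm (u : SobolevH1 N) (z : RN N) :
    ∫ x, (sobVal u (x + z) - sobVal u x) ^ 2 ≤ ‖z‖ ^ 2 * ∫ x, ‖sobGrad u x‖ ^ 2 := by
  refine (integral_sub_translate_sq_le u z).trans ?_
  rw [← integral_const_mul]
  refine integral_mono (memLp_inner_sobGrad u z).integrable_sq
    ((integrable_norm_sobGrad_sq u).const_mul _) fun x => ?_
  simp only
  rw [← mul_pow, ← sq_abs]
  exact pow_le_pow_left₀ (abs_nonneg _) (abs_real_inner_le_norm _ _) 2

/-- The translation estimate, averaged over a ball of translations. -/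
theorem lintegral_ball_sub_translate_sq_le (u : SobolevH1 N) (h : ℝ) :
    ∫⁻ x, ∫⁻ z in Metric.ball (0 : RN N) h,
        ENNReal.ofReal ((sobVal u (x + z) - sobVal u x) ^ 2)
      ≤ volume (Metric.ball (0 : RN N) h) * ENNReal.ofReal (h ^ 2 * ‖u‖ ^ 2) := by
  have hm : Measurable (Function.uncurry fun (x z : RN N) =>
      ENNReal.ofReal ((sobVal u (x + z) - sobVal u x) ^ 2)) := by
    have hu := measurable_sobVal u
    unfold Function.uncurry
    fun_prop
  rw [lintegral_lintegral_swap hm.aemeasurable, mul_comm, ← setLIntegral_const]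
  refine setLIntegral_mono' measurableSet_ball fun z hz => ?_
  rw [← ofReal_integral_eq_lintegral_ofReal]
  · refine ENNReal.ofReal_le_ofReal ((integral_sub_translate_sq_le_norm u z).trans ?_)
    have hz' : ‖z‖ ≤ h := (mem_ball_zero_iff.1 hz).le
    gcongr
    exact integral_norm_sobGrad_sq_le u
  · exact ((memLp_comp_add (sobVal_memLp u) z).sub (sobVal_memLp u)).integrable_sq
  · exact Eventually.of_forall fun x => sq_nonneg _

end Translation

/-! ### Subcritical Sobolev embedding -/

section Embedding

variable {N : ℕ}

/-- `∫ |u|^r` is bounded on the unit ball of `H¹(ℝ^N)`. -/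
def SobolevBound (N : ℕ) (r : ℝ) : Prop :=
  ∃ C : ℝ, 0 < C ∧ ∀ u : SobolevH1 N, ‖u‖ ≤ 1 →
    ∫⁻ x, ENNReal.ofReal (|sobVal u x| ^ r) ≤ ENNReal.ofReal C

theorem lintegral_sobVal_sq_le (u : SobolevH1 N) :
    ∫⁻ x, ENNReal.ofReal (sobVal u x ^ 2) ≤ ENNReal.ofReal (‖u‖ ^ 2) := by
  rw [← ofReal_integral_eq_lintegral_ofReal (integrable_sobVal_sq u)
    (Eventually.of_forall fun x => sq_nonneg _)]
  exact ENNReal.ofReal_le_ofReal (integral_sobVal_sq_le u)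

theorem sobolevBound_two : SobolevBound N 2 := by
  refine ⟨1, one_pos, fun u hu => ?_⟩
  simp only [Real.rpow_two, sq_abs]
  refine (lintegral_sobVal_sq_le u).trans (ENNReal.ofReal_le_ofReal ?_)
  exact pow_le_one₀ (norm_nonneg _) hu

/-- If `|u(x)| > s` and `∫ |u|^r` is small compared with `s^r |B_h|`, then `|u(x+z)| ≤ s/2` for at
least half of the `z ∈ B_h`. -/
theorem ofReal_mul_volume_ball_le_lintegral (u : SobolevH1 N) {r C s h : ℝ}
    (hs : 0 < s) (hr : 0 < r)
    (hC : ∫⁻ x, ENNReal.ofReal (|sobVal u x| ^ r) ≤ ENNReal.ofReal C)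
    (hB : 2 * ENNReal.ofReal (C * (2 / s) ^ r) ≤ volume (Metric.ball (0 : RN N) h))
    {x : RN N} (hx : s < |sobVal u x|) :
    ENNReal.ofReal (s ^ 2 / 8) * volume (Metric.ball (0 : RN N) h)
      ≤ ∫⁻ z in Metric.ball (0 : RN N) h,
        ENNReal.ofReal ((sobVal u (x + z) - sobVal u x) ^ 2) := by
  have hu := measurable_sobVal u
  set B := Metric.ball (0 : RN N) h with hBdef
  set A : Set (RN N) := {z | s / 2 < |sobVal u (x + z)|} with hA
  have hAm : MeasurableSet A := measurableSet_lt measurable_const (by fun_prop)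
  have hAvol : volume A ≤ ENNReal.ofReal (C * (2 / s) ^ r) := by
    have h1 : ENNReal.ofReal ((s / 2) ^ r) * volume A ≤ ENNReal.ofReal C := by
      refine le_trans ?_ hC
      have e : ∫⁻ x, ENNReal.ofReal (|sobVal u x| ^ r)
          = ∫⁻ z, ENNReal.ofReal (|sobVal u (x + z)| ^ r) :=
        (lintegral_add_left_eq_self (fun y => ENNReal.ofReal (|sobVal u y| ^ r)) x).symm
      rw [e, ← setLIntegral_const]
      refine (setLIntegral_mono' hAm fun z hz => ?_).trans (setLIntegral_le_lintegral _ _)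
      exact ENNReal.ofReal_le_ofReal
        (Real.rpow_le_rpow (by positivity) (le_of_lt hz) hr.le)
    have h2 : ENNReal.ofReal ((2 / s) ^ r) * ENNReal.ofReal ((s / 2) ^ r) = 1 := by
      rw [← ENNReal.ofReal_mul (by positivity), ← Real.mul_rpow (by positivity) (by positivity)]
      have : 2 / s * (s / 2) = 1 := by field_simp
      simp [this]
    calc volume A = ENNReal.ofReal ((2 / s) ^ r) *
          (ENNReal.ofReal ((s / 2) ^ r) * volume A) := by rw [← mul_assoc, h2, one_mul]
      _ ≤ ENNReal.ofReal ((2 / s) ^ r) * ENNReal.ofReal C := by gcongr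
      _ = ENNReal.ofReal (C * (2 / s) ^ r) := by
          rw [mul_comm, ← ENNReal.ofReal_mul' (by positivity)]
  have hfin : volume B ≠ ⊤ := measure_ball_lt_top.ne
  have hhalf : volume B / 2 ≤ volume (B \ A) := by
    have h1 : volume A ≤ volume B / 2 := by
      rw [ENNReal.le_div_iff_mul_le (by simp) (by simp), mul_comm]
      exact le_trans (by gcongr) hB
    have h2 : volume B ≤ volume B / 2 + volume (B \ A) :=
      calc volume B ≤ volume (A ∪ (B \ A)) := measure_mono (by
            intro z hz; by_cases h : z ∈ A
            · exact Or.inl h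
            · exact Or.inr ⟨hz, h⟩)
        _ ≤ volume A + volume (B \ A) := measure_union_le _ _
        _ ≤ _ := by gcongr
    have h3 : volume B / 2 ≠ ⊤ := ENNReal.div_ne_top hfin (by simp)
    rw [← ENNReal.add_halves (volume B)] at h2
    simpa using (ENNReal.add_le_add_iff_left h3).1 (by simpa using h2)
  have hBA : MeasurableSet (B \ A) := measurableSet_ball.diff hAm
  calc ENNReal.ofReal (s ^ 2 / 8) * volume B
      = ENNReal.ofReal (s ^ 2 / 4) * (volume B / 2) := by
        have : s ^ 2 / 8 = s ^ 2 / 4 * (1 / 2) := by ring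
        rw [this, ENNReal.ofReal_mul (by positivity), mul_assoc]
        congr 1
        rw [mul_comm, div_eq_mul_inv]
        congr 1
        rw [one_mul, ENNReal.ofReal_inv_of_pos (by norm_num)]
        simp
    _ ≤ ENNReal.ofReal (s ^ 2 / 4) * volume (B \ A) := by gcongr
    _ = ∫⁻ z in B \ A, ENNReal.ofReal (s ^ 2 / 4) := (setLIntegral_const _ _).symm
    _ ≤ ∫⁻ z in B \ A, ENNReal.ofReal ((sobVal u (x + z) - sobVal u x) ^ 2) := by
        refine setLIntegral_mono' hBA fun z hz => ENNReal.ofReal_le_ofReal ?_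
        have hz' : |sobVal u (x + z)| ≤ s / 2 := not_lt.1 hz.2
        have h1 : s / 2 ≤ |sobVal u (x + z) - sobVal u x| := by
          have := abs_sub_abs_le_abs_sub (sobVal u x) (sobVal u (x + z))
          rw [abs_sub_comm] at this
          linarith
        rw [← sq_abs (_ - _)]
        nlinarith
    _ ≤ _ := lintegral_mono_set sdiff_subset

/-- A bound on `∫ |u|^r` improves to a weak bound with exponent `2 + 2r/N`. -/
theorem SobolevBound.volume_lt_le {r : ℝ} (hN : 0 < N) (hr : 0 < r) (hb : SobolevBound N r) :
    ∃ C : ℝ, 0 < C ∧ ∀ u : SobolevH1 N, ‖u‖ ≤ 1 → ∀ s : ℝ, 0 < s →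
      volume {x | s < |sobVal u x|} ≤ ENNReal.ofReal (C * s ^ (-(2 + 2 * r / N))) := by
  obtain ⟨C, hC0, hC⟩ := hb
  have : Nonempty (Fin N) := ⟨⟨0, hN⟩⟩
  have hNR : (0 : ℝ) < N := by exact_mod_cast hN
  set v := (volume (Metric.ball (0 : RN N) 1)).toReal with hv
  have hv0 : 0 < v := ENNReal.toReal_pos (Metric.measure_ball_pos _ _ one_pos).ne'
    measure_ball_lt_top.ne
  refine ⟨8 * (2 * (C * 2 ^ r) / v) ^ (2 / (N : ℝ)), by positivity, fun u hu s hs => ?_⟩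
  -- The radius is chosen so that `|B_h| = 2 C (2/s)^r`.
  set h : ℝ := (2 * (C * (2 / s) ^ r) / v) ^ (1 / (N : ℝ)) with hh
  have hh0 : 0 < h := by positivity
  have hhN : h ^ N = 2 * (C * (2 / s) ^ r) / v := by
    rw [hh, ← Real.rpow_natCast, ← Real.rpow_mul (by positivity)]
    rw [one_div_mul_cancel hNR.ne', Real.rpow_one]
  have hvol : volume (Metric.ball (0 : RN N) h) = 2 * ENNReal.ofReal (C * (2 / s) ^ r) := by
    rw [Measure.addHaar_ball_of_pos _ _ hh0, finrank_euclideanSpace_fin, hhN,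
      ← ENNReal.ofReal_toReal (measure_ball_lt_top (μ := volume) (x := (0 : RN N)) (r := 1)).ne,
      ← hv, ← ENNReal.ofReal_mul (by positivity), div_mul_cancel₀ _ hv0.ne',
      ENNReal.ofReal_mul (by norm_num)]
    simp
  have hu' := measurable_sobVal u
  have hS : MeasurableSet {x | s < |sobVal u x|} :=
    measurableSet_lt measurable_const (by fun_prop)
  have hB0 : volume (Metric.ball (0 : RN N) h) ≠ 0 := (Metric.measure_ball_pos _ _ hh0).ne'
  have hBt : volume (Metric.ball (0 : RN N) h) ≠ ⊤ := measure_ball_lt_top.ne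
  have h1 : ENNReal.ofReal (s ^ 2 / 8) * volume (Metric.ball (0 : RN N) h)
      * volume {x | s < |sobVal u x|}
      ≤ volume (Metric.ball (0 : RN N) h) * ENNReal.ofReal (h ^ 2 * ‖u‖ ^ 2) := by
    refine le_trans ?_ (lintegral_ball_sub_translate_sq_le u h)
    rw [← setLIntegral_const]
    refine (setLIntegral_mono' hS fun x hx => ?_).trans (setLIntegral_le_lintegral _ _)
    exact ofReal_mul_volume_ball_le_lintegral u hs hr (hC u hu) hvol.ge hx
  have h2 : ENNReal.ofReal (s ^ 2 / 8) * volume {x | s < |sobVal u x|}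
      ≤ ENNReal.ofReal (h ^ 2) := by
    rw [mul_right_comm, mul_comm, ENNReal.mul_le_mul_iff_right hB0 hBt] at h1
    refine h1.trans (ENNReal.ofReal_le_ofReal ?_)
    exact mul_le_of_le_one_right (by positivity) (pow_le_one₀ (norm_nonneg _) hu)
  have h3 : (2 * (C * 2 ^ r) / v) ^ (2 / (N : ℝ)) * s ^ (-(2 * r / N)) = h ^ 2 := by
    rw [hh, ← Real.rpow_natCast, ← Real.rpow_mul (by positivity), Real.div_rpow (by norm_num) hs.le]
    have : 2 * (C * (2 ^ r / s ^ r)) / v = 2 * (C * 2 ^ r) / v * s ^ (-r) := by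
      rw [Real.rpow_neg hs.le]; ring
    rw [this, Real.mul_rpow (by positivity) (by positivity), ← Real.rpow_mul hs.le]
    congr 2 <;> (push_cast; ring)
  calc volume {x | s < |sobVal u x|}
      = ENNReal.ofReal (8 / s ^ 2) *
        (ENNReal.ofReal (s ^ 2 / 8) * volume {x | s < |sobVal u x|}) := by
        rw [← mul_assoc, ← ENNReal.ofReal_mul (by positivity)]
        have : 8 / s ^ 2 * (s ^ 2 / 8) = 1 := by field_simp
        simp [this]
    _ ≤ ENNReal.ofReal (8 / s ^ 2) * ENNReal.ofReal (h ^ 2) := by gcongr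
    _ = _ := by
        have e2 : s ^ (-2 : ℝ) = (s ^ 2)⁻¹ := by rw [Real.rpow_neg hs.le, Real.rpow_two]
        rw [← ENNReal.ofReal_mul (by positivity), ← h3, neg_add, Real.rpow_add hs, e2]
        congr 1
        field_simp

/-- The weak bound with exponent `2 + 2r/N` and the bound in `L²` give all the exponents between, by
the layer cake formula. -/
theorem SobolevBound.improve {r q : ℝ} (hN : 0 < N) (hr : 0 < r) (hb : SobolevBound N r)
    (hq : 2 < q) (hq' : q < 2 + 2 * r / N) : SobolevBound N q := by
  obtain ⟨C, hC0, hC⟩ := hb.volume_lt_le hN hr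
  set e := 2 + 2 * r / (N : ℝ) with he
  have i1 : IntegrableOn (fun t : ℝ => t ^ (q - 3)) (Ioc 0 1) := by
    have := intervalIntegral.intervalIntegrable_rpow' (a := 0) (b := 1) (r := q - 3) (by linarith)
    rwa [intervalIntegrable_iff_integrableOn_Ioc_of_le zero_le_one] at this
  have i2 : IntegrableOn (fun t : ℝ => C * t ^ (q - 1 - e)) (Ioi 1) :=
    (integrableOn_Ioi_rpow_of_lt (by linarith) one_pos).const_mul C
  have f1 := i1.lintegral_lt_top
  have f2 := i2.lintegral_lt_top
  set M : ℝ≥0∞ := ENNReal.ofReal q * ((∫⁻ t in Ioc (0:ℝ) 1, ENNReal.ofReal (t ^ (q - 3))) +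
    ∫⁻ t in Ioi (1:ℝ), ENNReal.ofReal (C * t ^ (q - 1 - e))) with hM
  have hMt : M ≠ ⊤ :=
    ENNReal.mul_ne_top ENNReal.ofReal_ne_top (ENNReal.add_ne_top.2 ⟨f1.ne, f2.ne⟩)
  refine ⟨M.toReal + 1, by positivity, fun u hu => ?_⟩
  refine le_trans ?_ (ENNReal.ofReal_le_ofReal (le_add_of_nonneg_right zero_le_one))
  rw [ENNReal.ofReal_toReal hMt]
  have hu' := measurable_sobVal u
  rw [lintegral_rpow_eq_lintegral_meas_lt_mul volume
    (Eventually.of_forall fun x => abs_nonneg (sobVal u x)) (by fun_prop) (by linarith : 0 < q), hM]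
  gcongr
  rw [← Ioc_union_Ioi_eq_Ioi (zero_le_one' ℝ), lintegral_union measurableSet_Ioi
    (Set.Ioc_disjoint_Ioi le_rfl)]
  gcongr ?_ + ?_
  · -- Levels `t ≤ 1`: Chebyshev's inequality in `L²`.
    refine setLIntegral_mono' measurableSet_Ioc fun t ht => ?_
    have h1 : volume {a | t < |sobVal u a|} ≤ ENNReal.ofReal (t ^ (-2 : ℝ)) := by
      have h2 : ENNReal.ofReal (t ^ 2) * volume {a | t < |sobVal u a|} ≤ 1 := by
        rw [← setLIntegral_const]
        refine (setLIntegral_mono' (measurableSet_lt measurable_const (by fun_prop))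
          fun x hx => ?_).trans ((setLIntegral_le_lintegral _
            fun x => ENNReal.ofReal (sobVal u x ^ 2)).trans ?_)
        · refine ENNReal.ofReal_le_ofReal ?_
          rw [← sq_abs (sobVal u x)]
          exact pow_le_pow_left₀ ht.1.le (le_of_lt hx) 2
        · refine (lintegral_sobVal_sq_le u).trans ?_
          rw [← ENNReal.ofReal_one]
          exact ENNReal.ofReal_le_ofReal (pow_le_one₀ (norm_nonneg _) hu)
      calc volume {a | t < |sobVal u a|} = ENNReal.ofReal (t ^ (-2 : ℝ)) *
            (ENNReal.ofReal (t ^ 2) * volume {a | t < |sobVal u a|}) := by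
            rw [← mul_assoc, ← ENNReal.ofReal_mul (Real.rpow_nonneg ht.1.le _),
              ← Real.rpow_two, ← Real.rpow_add ht.1]
            simp
        _ ≤ ENNReal.ofReal (t ^ (-2 : ℝ)) * 1 := by gcongr
        _ = _ := mul_one _
    calc _ ≤ ENNReal.ofReal (t ^ (-2 : ℝ)) * ENNReal.ofReal (t ^ (q - 1)) := by gcongr
      _ = _ := by
        rw [← ENNReal.ofReal_mul (Real.rpow_nonneg ht.1.le _), ← Real.rpow_add ht.1]
        congr 2; ring
  · -- Levels `t > 1`: the weak bound.
    refine setLIntegral_mono' measurableSet_Ioi fun t ht => ?_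
    have ht0 : (0 : ℝ) < t := lt_trans one_pos ht
    calc _ ≤ ENNReal.ofReal (C * t ^ (-e)) * ENNReal.ofReal (t ^ (q - 1)) := by
          gcongr
          exact hC u hu t ht0
      _ = _ := by
        rw [← ENNReal.ofReal_mul (by positivity), mul_assoc, ← Real.rpow_add ht0]
        congr 3; ring

/-- Subcritical Sobolev bound: the exponents `q < 2 + 2q/N` are those below the critical one. It is
reached from `q = 2` in finitely many steps of a fixed length. -/
theorem sobolevBound_of_lt {q : ℝ} (hN : 2 ≤ N) (hq : 2 < q) (hq' : q < 2 + 2 * q / N) :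
    SobolevBound N q := by
  have hNR : (2 : ℝ) ≤ N := by exact_mod_cast hN
  set η := (2 + 2 * q / N - q) / 2 with hη
  have hη0 : 0 < η := by linarith
  have key : ∀ k : ℕ, SobolevBound N (min (2 + k * η) q) := by
    intro k
    induction k with
    | zero => simpa [hq.le] using (sobolevBound_two (N := N))
    | succ k ih =>
      have hr2 : 2 ≤ min (2 + k * η) q := le_min (by nlinarith [k.cast_nonneg (α := ℝ)]) hq.le
      have hrq : min (2 + k * η) q ≤ q := min_le_right _ _
      have hstep : min (2 + (k + 1 : ℕ) * η) q ≤ min (2 + k * η) q + η := by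
        rw [← min_add_add_right]
        refine min_le_min ?_ (by linarith)
        push_cast
        linarith
      refine ih.improve (by omega) (by linarith) ?_ ?_
      · refine lt_min ?_ hq
        have : (0 : ℝ) < (k + 1 : ℕ) := by positivity
        nlinarith
      · refine lt_of_le_of_lt hstep ?_
        set r := min (2 + k * η) q
        have h1 : 2 * q / N - 2 * r / N ≤ q - r := by
          rw [← sub_div, div_le_iff₀ (by linarith)]
          nlinarith
        linarith
  obtain ⟨k, hk⟩ := exists_nat_gt ((q - 2) / η)
  have := key k
  rwa [min_eq_right] at this
  rw [div_lt_iff₀ hη0] at hk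
  linarith

end Embedding

section EmbeddingConsequences

variable {N : ℕ}

theorem SobolevBound.lintegral_le {r : ℝ} (hr : 0 < r) (hb : SobolevBound N r) :
    ∃ C : ℝ, 0 < C ∧ ∀ u : SobolevH1 N,
      ∫⁻ x, ENNReal.ofReal (|sobVal u x| ^ r) ≤ ENNReal.ofReal (C * ‖u‖ ^ r) := by
  obtain ⟨C, hC0, hC⟩ := hb
  refine ⟨C, hC0, fun u => ?_⟩
  by_cases hu : u = 0
  · have : ∫⁻ x, ENNReal.ofReal (|sobVal u x| ^ r) = 0 := by
      rw [lintegral_eq_zero_iff' ((measurable_sobVal u).abs.pow_const r).ennreal_ofReal.aemeasurable]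
      filter_upwards [sobVal_ae_zero_iff.2 hu] with x hx
      simp [hx, Real.zero_rpow hr.ne']
    rw [this]
    exact zero_le
  have hn : 0 < ‖u‖ := norm_pos_iff.2 hu
  have h1 := hC (‖u‖⁻¹ • u) (by rw [norm_smul, norm_inv, norm_norm, inv_mul_cancel₀ hn.ne'])
  have h2 : ∫⁻ x, ENNReal.ofReal (|sobVal u x| ^ r) = ENNReal.ofReal (‖u‖ ^ r) *
      ∫⁻ x, ENNReal.ofReal (|sobVal (‖u‖⁻¹ • u) x| ^ r) := by
    rw [← lintegral_const_mul' _ _ ENNReal.ofReal_ne_top]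
    refine lintegral_congr_ae ?_
    filter_upwards [sobVal_smul ‖u‖⁻¹ u] with x hx
    rw [hx, ← ENNReal.ofReal_mul (by positivity), abs_mul, abs_of_pos (inv_pos.2 hn),
      ← Real.mul_rpow (by positivity) (by positivity)]
    congr 2
    field_simp
  rw [h2, mul_comm C, ENNReal.ofReal_mul (by positivity)]
  gcongr

theorem SobolevBound.integrable_rpow {r : ℝ} (hr : 0 < r) (hb : SobolevBound N r)
    (u : SobolevH1 N) : Integrable (fun x => |sobVal u x| ^ r) := by
  obtain ⟨C, hC0, hC⟩ := hb.lintegral_le hr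
  refine ⟨((measurable_sobVal u).abs.pow_const r).aestronglyMeasurable, ?_⟩
  rw [hasFiniteIntegral_iff_ofReal (Eventually.of_forall fun x => by positivity)]
  exact lt_of_le_of_lt (hC u) ENNReal.ofReal_lt_top

theorem SobolevBound.integral_le {r : ℝ} (hr : 0 < r) (hb : SobolevBound N r) :
    ∃ C : ℝ, 0 < C ∧ ∀ u : SobolevH1 N, ∫ x, |sobVal u x| ^ r ≤ C * ‖u‖ ^ r := by
  obtain ⟨C, hC0, hC⟩ := hb.lintegral_le hr
  refine ⟨C, hC0, fun u => ?_⟩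
  have h := hC u
  rw [← ofReal_integral_eq_lintegral_ofReal (hb.integrable_rpow hr u)
    (Eventually.of_forall fun x => by positivity)] at h
  exact (ENNReal.ofReal_le_ofReal_iff (by positivity)).1 h

/-! ### Weak compactness -/

/-- A bounded sequence in a separable Hilbert space has a weakly convergent subsequence. -/
theorem exists_subseq_tendsto_inner {H : Type*} [NormedAddCommGroup H] [InnerProductSpace ℝ H]
    [CompleteSpace H] [TopologicalSpace.SeparableSpace H] (w : ℕ → H) (M : ℝ)
    (hw : ∀ n, ‖w n‖ ≤ M) :
    ∃ (v : H) (σ : ℕ → ℕ), StrictMono σ ∧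
      ∀ y : H, Tendsto (fun n => inner ℝ (w (σ n)) y) atTop (𝓝 (inner ℝ v y)) := by
  have hc := WeakDual.isSeqCompact_closedBall ℝ H (0 : StrongDual ℝ H) M
  have hmem : ∀ n, StrongDual.toWeakDual (InnerProductSpace.toDual ℝ H (w n)) ∈
      WeakDual.toStrongDual ⁻¹' Metric.closedBall (0 : StrongDual ℝ H) M := by
    intro n
    simpa using hw n
  obtain ⟨f, -, σ, hσ, hf⟩ := hc hmem
  refine ⟨(InnerProductSpace.toDual ℝ H).symm (WeakDual.toStrongDual f), σ, hσ, fun y => ?_⟩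
  have h1 := (WeakDual.eval_continuous y).continuousAt.tendsto.comp hf
  rw [InnerProductSpace.toDual_symm_apply]
  exact h1

/-- `H¹` is weakly closed in `L² × L²`: it is the orthogonal complement of the pairs
`(∂_i φ, φ e_i)`. -/
theorem sobolev_isSeqClosed_weak {w : ℕ → SobolevH1 N}
    {v : WithLp 2 (Lp ℝ 2 (volume : Measure (RN N)) × Lp (RN N) 2 (volume : Measure (RN N)))}
    (h : ∀ y, Tendsto (fun n => inner ℝ (w n).1 y) atTop (𝓝 (inner ℝ v y))) :
    v ∈ SobolevH1 N := by
  intro φ hφ hc i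
  have hd := memLp_two_fderiv_of_test hφ hc (EuclideanSpace.single i 1)
  have hf := memLp_two_of_test hφ.continuous hc
  have hg : MemLp (fun x => φ x • (EuclideanSpace.single i (1 : ℝ) : RN N)) 2 volume :=
    (ContinuousLinearMap.toSpanSingleton ℝ (EuclideanSpace.single i (1 : ℝ) : RN N)).comp_memLp' hf
  have hinner : ∀ w : WithLp 2 (Lp ℝ 2 (volume : Measure (RN N)) ×
      Lp (RN N) 2 (volume : Measure (RN N))), inner ℝ w (WithLp.toLp 2 (hd.toLp _, hg.toLp _))
      = (∫ x, w.fst x * fderiv ℝ φ x (EuclideanSpace.single i 1)) + ∫ x, w.snd x i * φ x := by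
    intro w
    rw [WithLp.prod_inner_apply, L2.inner_def, L2.inner_def]
    congr 1
    · refine integral_congr_ae ?_
      filter_upwards [hd.coeFn_toLp] with x hx
      simp only [hx]
      simp [mul_comm]
    · refine integral_congr_ae ?_
      filter_upwards [hg.coeFn_toLp] with x hx
      simp only [hx]
      rw [inner_smul_right, EuclideanSpace.inner_single_right]
      simp [mul_comm]
  have h1 := h (WithLp.toLp 2 (hd.toLp _, hg.toLp _))
  have h0 : ∀ n, inner ℝ (w n).1 (WithLp.toLp 2 (hd.toLp _, hg.toLp _)) = 0 := by
    intro n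
    rw [hinner, (w n).2 φ hφ hc i]
    ring
  simp_rw [h0] at h1
  have h2 := tendsto_nhds_unique h1 tendsto_const_nhds
  rw [hinner] at h2
  linarith

theorem sobolev_exists_weak_subseq (w : ℕ → SobolevH1 N) (M : ℝ) (hw : ∀ n, ‖w n‖ ≤ M) :
    ∃ (v : SobolevH1 N) (σ : ℕ → ℕ), StrictMono σ ∧
      ∀ y : WithLp 2 (Lp ℝ 2 (volume : Measure (RN N)) × Lp (RN N) 2 (volume : Measure (RN N))),
        Tendsto (fun n => inner ℝ (w (σ n)).1 y) atTop (𝓝 (inner ℝ v.1 y)) := by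
  have : TopologicalSpace.SeparableSpace (WithLp 2 (Lp ℝ 2 (volume : Measure (RN N)) ×
      Lp (RN N) 2 (volume : Measure (RN N)))) := by
    have : Fact ((2 : ℝ≥0∞) ≠ ⊤) := ⟨by norm_num⟩
    have h1 : SecondCountableTopology (Lp ℝ 2 (volume : Measure (RN N))) := inferInstance
    have h2 : SecondCountableTopology (Lp (RN N) 2 (volume : Measure (RN N))) := inferInstance
    have h3 : TopologicalSpace.SeparableSpace
      (Lp ℝ 2 (volume : Measure (RN N)) × Lp (RN N) 2 (volume : Measure (RN N))) := inferInstance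
    exact (WithLp.prodContinuousLinearEquiv 2 ℝ (Lp ℝ 2 (volume : Measure (RN N)))
      (Lp (RN N) 2 (volume : Measure (RN N)))).symm.surjective.denseRange.separableSpace
      (WithLp.prodContinuousLinearEquiv 2 ℝ (Lp ℝ 2 (volume : Measure (RN N)))
      (Lp (RN N) 2 (volume : Measure (RN N)))).symm.continuous
  obtain ⟨v, σ, hσ, h⟩ := exists_subseq_tendsto_inner (fun n => (w n).1) M hw
  exact ⟨⟨v, sobolev_isSeqClosed_weak h⟩, σ, hσ, h⟩

end EmbeddingConsequences

/-! ### The absolute value -/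

section AbsoluteValue

variable {N : ℕ}

/-- The difference quotients of `f` in the coordinate directions, with step `h`. -/
def diffQuot (f : RN N → ℝ) (h : ℝ) (x : RN N) : RN N :=
  ∑ i, ((f (x + h • EuclideanSpace.single i (1 : ℝ)) - f x) / h) • EuclideanSpace.single i (1 : ℝ)

theorem diffQuot_apply (f : RN N → ℝ) (h : ℝ) (x : RN N) (i : Fin N) :
    diffQuot f h x i = (f (x + h • EuclideanSpace.single i (1 : ℝ)) - f x) / h := by
  simp [diffQuot, Finset.sum_apply, Pi.single_apply]

theorem memLp_diffQuot {f : RN N → ℝ} (hf : MemLp f 2 volume) (h : ℝ) :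
    MemLp (diffQuot f h) 2 volume := by
  unfold diffQuot
  refine memLp_finsetSum _ fun i _ => ?_
  have h1 : MemLp (fun x => (f (x + h • EuclideanSpace.single i (1 : ℝ)) - f x) * h⁻¹) 2 volume :=
    ((memLp_comp_add hf _).sub hf).mul_const _
  exact (ContinuousLinearMap.toSpanSingleton ℝ
    (EuclideanSpace.single i (1 : ℝ) : RN N)).comp_memLp' h1

/-- The absolute value does not increase difference quotients. -/
theorem integral_diffQuot_abs_le (u : SobolevH1 N) {h : ℝ} (hh : 0 < h) :
    ∫ x, ‖diffQuot (fun y => |sobVal u y|) h x‖ ^ 2 ≤ ∫ x, ‖sobGrad u x‖ ^ 2 := by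
  have habs : MemLp (fun y => |sobVal u y|) 2 volume := (sobVal_memLp u).abs
  have hcoord : ∀ i : Fin N, Integrable (fun x => (sobGrad u x i) ^ 2) := fun i =>
    (memLp_two_coord u.1.snd i).integrable_sq
  have hint : ∀ (f : RN N → ℝ), MemLp f 2 volume → ∀ i : Fin N, Integrable
      (fun x => (f (x + h • EuclideanSpace.single i (1 : ℝ)) - f x) ^ 2) := fun f hf i =>
    ((memLp_comp_add hf _).sub hf).integrable_sq
  simp_rw [EuclideanSpace.real_norm_sq_eq, diffQuot_apply, div_pow]
  rw [integral_finsetSum _ fun i _ => (hint _ habs i).div_const _,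
    integral_finsetSum _ fun i _ => hcoord i]
  refine Finset.sum_le_sum fun i _ => ?_
  rw [integral_div, div_le_iff₀ (by positivity)]
  calc ∫ x, (|sobVal u (x + h • EuclideanSpace.single i (1 : ℝ))| - |sobVal u x|) ^ 2
      ≤ ∫ x, (sobVal u (x + h • EuclideanSpace.single i (1 : ℝ)) - sobVal u x) ^ 2 := by
        refine integral_mono (hint _ habs i) (hint _ (sobVal_memLp u) i) fun x => ?_
        exact sq_le_sq.2 (abs_abs_sub_abs_le_abs_sub _ _)
    _ ≤ ∫ x, (inner ℝ (h • EuclideanSpace.single i (1 : ℝ)) (sobGrad u x)) ^ 2 :=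
        integral_sub_translate_sq_le u _
    _ = (∫ x, sobGrad u x i ^ 2) * h ^ 2 := by
        rw [← integral_mul_const]
        refine integral_congr_ae (Eventually.of_forall fun x => ?_)
        simp [inner_smul_left, EuclideanSpace.inner_single_left, mul_pow, mul_comm]

theorem norm_toLp_sq {E : Type*} [NormedAddCommGroup E] [InnerProductSpace ℝ E]
    {f : RN N → E} (hf : MemLp f 2 volume) : ‖hf.toLp f‖ ^ 2 = ∫ x, ‖f x‖ ^ 2 := by
  rw [← real_inner_self_eq_norm_sq, L2.inner_def]
  refine integral_congr_ae ?_
  filter_upwards [hf.coeFn_toLp] with x hx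
  rw [hx, real_inner_self_eq_norm_sq]

/-- `|u|` belongs to `H¹` and `‖∇|u|‖ ≤ ‖∇u‖`: a weak limit of difference quotients of `|u|` is
a weak gradient. -/
theorem exists_sobAbs (u : SobolevH1 N) :
    ∃ w : SobolevH1 N, sobVal w =ᵐ[volume] (fun x => |sobVal u x|) ∧
      ∫ x, ‖sobGrad w x‖ ^ 2 ≤ ∫ x, ‖sobGrad u x‖ ^ 2 := by
  have habs : MemLp (fun y => |sobVal u y|) 2 volume := (sobVal_memLp u).abs
  set G := ∫ x, ‖sobGrad u x‖ ^ 2 with hG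
  have hG0 : 0 ≤ G := integral_nonneg fun x => by positivity
  set h : ℕ → ℝ := fun n => 1 / ((n : ℝ) + 1) with hh
  have hpos : ∀ n, 0 < h n := fun n => by positivity
  have hlim : Tendsto h atTop (𝓝[≠] 0) :=
    tendsto_nhdsWithin_iff.2 ⟨tendsto_one_div_add_atTop_nhds_zero_nat,
      Eventually.of_forall fun n => (hpos n).ne'⟩
  set D : ℕ → Lp (RN N) 2 (volume : Measure (RN N)) := fun n =>
    (memLp_diffQuot habs (h n)).toLp _ with hD
  have hDn : ∀ n, ‖D n‖ ≤ √G := fun n => by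
    refine Real.le_sqrt_of_sq_le ?_
    rw [hD]
    simp only
    rw [norm_toLp_sq]
    exact integral_diffQuot_abs_le u (hpos n)
  have : Fact ((2 : ℝ≥0∞) ≠ ⊤) := ⟨by norm_num⟩
  obtain ⟨g, σ, hσ, hg⟩ := exists_subseq_tendsto_inner D (√G) hDn
  have hgn : ‖g‖ ^ 2 ≤ G := by
    have h1 := hg g
    rw [real_inner_self_eq_norm_sq] at h1
    have h2 : ‖g‖ ^ 2 ≤ √G * ‖g‖ := le_of_tendsto h1 (Eventually.of_forall fun n =>
      (real_inner_le_norm _ _).trans (by gcongr; exact hDn _))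
    have h3 : ‖g‖ ≤ √G := by
      by_contra hlt
      push Not at hlt
      have : 0 < ‖g‖ := lt_of_le_of_lt (Real.sqrt_nonneg _) hlt
      nlinarith
    calc ‖g‖ ^ 2 ≤ √G ^ 2 := pow_le_pow_left₀ (norm_nonneg _) h3 2
      _ = G := Real.sq_sqrt hG0
  have hweak : IsWeakGradient (fun x => |sobVal u x|) (fun x => g x) := by
    intro φ hφ hc i
    have hf := memLp_two_of_test hφ.continuous hc
    set e : RN N := EuclideanSpace.single i (1 : ℝ) with he
    have hφe : MemLp (fun x => φ x • e) 2 volume :=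
      (ContinuousLinearMap.toSpanSingleton ℝ e).comp_memLp' hf
    have h1 := hg (hφe.toLp _)
    have e1 : inner ℝ g (hφe.toLp _) = ∫ x, g x i * φ x := by
      rw [L2.inner_def]
      refine integral_congr_ae ?_
      filter_upwards [hφe.coeFn_toLp] with x hx
      rw [hx, inner_smul_right, he, EuclideanSpace.inner_single_right]
      simp [mul_comm]
    have e2 : ∀ n, inner ℝ (D n) (hφe.toLp _)
        = ((∫ x, |sobVal u x| * φ (x + -(h n • e))) - ∫ x, |sobVal u x| * φ x) / h n := by
      intro n
      rw [L2.inner_def, ← integral_add_right_eq_self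
        (fun x => |sobVal u x| * φ (x + -(h n • e))) (h n • e), ← integral_sub, ← integral_div]
      · refine integral_congr_ae ?_
        filter_upwards [hφe.coeFn_toLp, (memLp_diffQuot habs (h n)).coeFn_toLp] with x hx hx'
        rw [hx, hD]
        simp only
        rw [hx', inner_smul_right, he, EuclideanSpace.inner_single_right, diffQuot_apply]
        simp only [add_neg_cancel_right]
        simp
        ring
      · simp only [add_neg_cancel_right]
        exact (memLp_comp_add habs (h n • e)).integrable_mul hf
      · exact habs.integrable_mul hf
    -- Against `φ e_i`, the difference quotients of `|u|` are those of `s ↦ ∫ |u| φ(· - s e_i)`.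
    have hder := hasDerivAt_integral_mul_translate (habs.locallyIntegrable (by norm_num)) hφ hc e 0
    have h2 : Tendsto (fun n => inner ℝ (D n) (hφe.toLp _)) atTop
        (𝓝 (∫ x, |sobVal u x| * fderiv ℝ φ x (-e))) := by
      have h3 := (hasDerivAt_iff_tendsto_slope.1 hder).comp hlim
      simp only [zero_smul, neg_zero, add_zero] at h3
      refine h3.congr fun n => ?_
      rw [e2 n, Function.comp_apply, slope_def_field]
      simp
    have h4 := tendsto_nhds_unique h1 (h2.comp hσ.tendsto_atTop)
    rw [e1] at h4
    rw [h4, ← integral_neg]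
    simp
  refine ⟨sobOfFun _ _ habs (Lp.memLp g) hweak, sobVal_ofFun _ _ _, ?_⟩
  refine le_trans (le_of_eq ?_) hgn
  have h5 := norm_toLp_sq (Lp.memLp g)
  rw [Lp.toLp_coeFn] at h5
  rw [h5]
  refine integral_congr_ae ?_
  filter_upwards [sobGrad_ofFun habs (Lp.memLp g) hweak] with x hx
  rw [hx]

end AbsoluteValue

/-! ### Local compactness -/

section LocalCompactness

variable {N : ℕ}

theorem sq_integral_le_measureReal_mul {α : Type*} [MeasurableSpace α] {μ : Measure α}
    [IsFiniteMeasure μ] {f : α → ℝ} (hf : Integrable f μ) (hf2 : Integrable (fun x => f x ^ 2) μ) :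
    (∫ x, f x ∂μ) ^ 2 ≤ μ.real univ * ∫ x, f x ^ 2 ∂μ := by
  set V := μ.real univ with hV
  set I := ∫ x, f x ∂μ with hI
  have hV0 : 0 ≤ V := measureReal_nonneg
  rcases hV0.eq_or_lt with h0 | h0
  · have : μ = 0 := by
      rw [← Measure.measure_univ_eq_zero, ← measureReal_eq_zero_iff]
      exact h0.symm
    rw [← h0, hI, this]
    simp
  have h1 : 0 ≤ ∫ x, (V * f x - I) ^ 2 ∂μ := integral_nonneg fun x => sq_nonneg _
  have h2 : ∫ x, (V * f x - I) ^ 2 ∂μ = V * (V * (∫ x, f x ^ 2 ∂μ) - I ^ 2) := by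
    have : ∀ x, (V * f x - I) ^ 2 = V ^ 2 * f x ^ 2 - 2 * V * I * f x + I ^ 2 := fun x => by ring
    simp_rw [this]
    have i1 : Integrable (fun x => V ^ 2 * f x ^ 2) μ := hf2.const_mul _
    have i2 : Integrable (fun x => 2 * V * I * f x) μ := hf.const_mul _
    have i12 : Integrable (fun x => V ^ 2 * f x ^ 2 - 2 * V * I * f x) μ := i1.sub i2
    rw [integral_add i12 (integrable_const _), integral_sub i1 i2, integral_const_mul,
      integral_const_mul,
      integral_const, smul_eq_mul, ← hV, ← hI]
    ring
  rw [h2] at h1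
  have := nonneg_of_mul_nonneg_right h1 h0
  linarith

/-- A value of `w` is controlled by the average of `w` over a ball and the mean oscillation. -/
theorem measureReal_ball_sq_mul_sobVal_sq_le (w : SobolevH1 N) (h : ℝ) (x : RN N) :
    volume.real (Metric.ball (0 : RN N) h) ^ 2 * sobVal w x ^ 2
      ≤ 2 * (∫ z in Metric.ball (0 : RN N) h, sobVal w (x + z)) ^ 2
        + 2 * volume.real (Metric.ball (0 : RN N) h) *
          ∫ z in Metric.ball (0 : RN N) h, (sobVal w (x + z) - sobVal w x) ^ 2 := by
  set B := Metric.ball (0 : RN N) h with hB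
  have hfin : IsFiniteMeasure (volume.restrict B) := ⟨by simp [hB, measure_ball_lt_top]⟩
  have hm : MemLp (fun z => sobVal w (x + z)) 2 (volume.restrict B) := by
    simp_rw [add_comm x]
    exact (memLp_comp_add (sobVal_memLp w) x).restrict B
  have hm' : MemLp (fun z => sobVal w (x + z) - sobVal w x) 2 (volume.restrict B) :=
    hm.sub (memLp_const _)
  have h1 := sq_integral_le_measureReal_mul (hm'.integrable (by norm_num)) hm'.integrable_sq
  rw [integral_sub (hm.integrable (by norm_num)) (integrable_const _), integral_const,
    smul_eq_mul, measureReal_restrict_apply_univ] at h1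
  set M := ∫ z in B, sobVal w (x + z)
  set V := volume.real B
  -- With `D = V w(x) - M`, this is `(M + D)² ≤ 2M² + 2D²`.
  nlinarith [sq_nonneg (M + (M - V * sobVal w x))]

/-- Up to an error of order `h² ‖w‖²`, the `L²` norm of `w` on a set `A` is controlled by that of its
averages over balls of radius `h`. -/
theorem setIntegral_ball_sobVal_sq_le (w : SobolevH1 N) (hN : 0 < N) {h : ℝ} (hh : 0 < h)
    {A : Set (RN N)} (hAfin : volume A ≠ ⊤) :
    ∫ x in A, sobVal w x ^ 2
      ≤ 2 / volume.real (Metric.ball (0 : RN N) h) ^ 2 *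
        (∫ x in A, (∫ z in Metric.ball (0 : RN N) h, sobVal w (x + z)) ^ 2)
        + 2 * h ^ 2 * ‖w‖ ^ 2 := by
  set B := Metric.ball (0 : RN N) h with hB
  set V := volume.real B with hV
  have : Nonempty (Fin N) := ⟨⟨0, hN⟩⟩
  have hV0 : 0 < V := ENNReal.toReal_pos (Metric.measure_ball_pos _ _ hh).ne'
    measure_ball_lt_top.ne
  have hVol : volume B = ENNReal.ofReal V := (ENNReal.ofReal_toReal measure_ball_lt_top.ne).symm
  have hw := measurable_sobVal w
  have hfinB : IsFiniteMeasure (volume.restrict B) := ⟨by simp [hB, measure_ball_lt_top]⟩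
  have hfinA : IsFiniteMeasure (volume.restrict A) := ⟨by simpa using hAfin.lt_top⟩
  have hmM : StronglyMeasurable (fun x => ∫ z in B, sobVal w (x + z)) := by
    have : StronglyMeasurable (Function.uncurry fun (x z : RN N) => sobVal w (x + z)) := by
      refine Measurable.stronglyMeasurable ?_
      unfold Function.uncurry
      fun_prop
    exact this.integral_prod_right
  have hMb : ∀ x, (∫ z in B, sobVal w (x + z)) ^ 2 ≤ V * ‖w‖ ^ 2 := by
    intro x
    have hm : MemLp (fun z => sobVal w (x + z)) 2 (volume.restrict B) := by
      simp_rw [add_comm x]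
      exact (memLp_comp_add (sobVal_memLp w) x).restrict B
    refine (sq_integral_le_measureReal_mul (hm.integrable (by norm_num)) hm.integrable_sq).trans ?_
    rw [measureReal_restrict_apply_univ]
    gcongr
    refine le_trans (setIntegral_le_integral (f := fun z => sobVal w (x + z) ^ 2) ?_ ?_) ?_
    · simp_rw [add_comm x]
      exact (memLp_comp_add (sobVal_memLp w) x).integrable_sq
    · exact Eventually.of_forall fun z => sq_nonneg _
    · rw [integral_add_left_eq_self (fun z => sobVal w z ^ 2)]
      exact integral_sobVal_sq_le w
  have hMint : Integrable (fun x => (∫ z in B, sobVal w (x + z)) ^ 2) (volume.restrict A) := by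
    refine Integrable.of_bound (hmM.pow 2).aestronglyMeasurable (V * ‖w‖ ^ 2)
      (Eventually.of_forall fun x => ?_)
    rw [Real.norm_of_nonneg (sq_nonneg _)]
    exact hMb x
  have key : ENNReal.ofReal (V ^ 2 * ∫ x in A, sobVal w x ^ 2)
      ≤ ENNReal.ofReal (2 * ∫ x in A, (∫ z in B, sobVal w (x + z)) ^ 2)
        + ENNReal.ofReal (2 * V * (V * (h ^ 2 * ‖w‖ ^ 2))) := by
    rw [← integral_const_mul, ← integral_const_mul,
      ofReal_integral_eq_lintegral_ofReal ((integrable_sobVal_sq w).restrict.const_mul _)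
        (Eventually.of_forall fun x => by positivity),
      ofReal_integral_eq_lintegral_ofReal (hMint.const_mul _)
        (Eventually.of_forall fun x => by positivity)]
    have h2 : ENNReal.ofReal (2 * V) * ∫⁻ x, ∫⁻ z in B,
        ENNReal.ofReal ((sobVal w (x + z) - sobVal w x) ^ 2)
        ≤ ENNReal.ofReal (2 * V * (V * (h ^ 2 * ‖w‖ ^ 2))) := by
      rw [ENNReal.ofReal_mul (p := 2 * V) (by positivity), ENNReal.ofReal_mul (p := V) hV0.le, ← hVol]
      gcongr
      exact lintegral_ball_sub_translate_sq_le w h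
    refine le_trans ?_ (add_le_add_right h2 _)
    rw [← lintegral_const_mul' _ _ ENNReal.ofReal_ne_top]
    refine le_trans ?_ (add_le_add_right (setLIntegral_le_lintegral A _) _)
    have hmM2 : Measurable (fun x => ENNReal.ofReal (2 * (∫ z in B, sobVal w (x + z)) ^ 2)) :=
      ((hmM.measurable.pow_const 2).const_mul 2).ennreal_ofReal
    rw [← lintegral_add_left hmM2]
    refine lintegral_mono fun x => ?_
    have hm : MemLp (fun z => sobVal w (x + z) - sobVal w x) 2 (volume.restrict B) := by
      simp_rw [add_comm x]
      exact ((memLp_comp_add (sobVal_memLp w) x).restrict B).sub (memLp_const _)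
    rw [← ofReal_integral_eq_lintegral_ofReal hm.integrable_sq
      (Eventually.of_forall fun x => sq_nonneg _), ← ENNReal.ofReal_mul (by positivity),
      ← ENNReal.ofReal_add (by positivity) (mul_nonneg (by positivity)
        (integral_nonneg fun x => sq_nonneg _))]
    exact ENNReal.ofReal_le_ofReal (measureReal_ball_sq_mul_sobVal_sq_le w h x)
  have hI0 : 0 ≤ ∫ x in A, (∫ z in B, sobVal w (x + z)) ^ 2 :=
    integral_nonneg fun x => sq_nonneg _
  rw [← ENNReal.ofReal_add (by positivity) (by positivity),
    ENNReal.ofReal_le_ofReal_iff (by positivity)] at key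
  rw [div_mul_eq_mul_div, ← sub_le_iff_le_add, le_div_iff₀ (by positivity)]
  nlinarith

/-- **Rellich's theorem**: weak convergence to zero in `H¹` gives `L²` convergence on balls. The
averages over balls of a fixed radius converge pointwise and boundedly. -/
theorem tendsto_setIntegral_ball_sobVal_sq (hN : 0 < N) {w : ℕ → SobolevH1 N} {M : ℝ}
    (hM : ∀ n, ‖w n‖ ≤ M)
    (hw : ∀ y : WithLp 2 (Lp ℝ 2 (volume : Measure (RN N)) × Lp (RN N) 2
      (volume : Measure (RN N))), Tendsto (fun n => inner ℝ (w n).1 y) atTop (𝓝 0)) (R : ℝ) :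
    Tendsto (fun n => ∫ x in Metric.ball (0 : RN N) R, sobVal (w n) x ^ 2) atTop (𝓝 0) := by
  have hM0 : 0 ≤ M := (norm_nonneg _).trans (hM 0)
  have havg : ∀ (h : ℝ) (x : RN N), Tendsto
      (fun n => ∫ z in Metric.ball (0 : RN N) h, sobVal (w n) (x + z)) atTop (𝓝 0) := by
    intro h x
    have hS : MeasurableSet (Metric.ball x h) := measurableSet_ball
    have hSf : volume (Metric.ball x h) ≠ ⊤ := measure_ball_lt_top.ne
    refine (hw (WithLp.toLp 2 (indicatorConstLp 2 hS hSf (1 : ℝ), 0))).congr fun n => ?_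
    rw [WithLp.prod_inner_apply]
    simp only [inner_zero_right, add_zero]
    rw [real_inner_comm, L2.inner_indicatorConstLp_one]
    change ∫ y in Metric.ball x h, sobVal (w n) y = _
    rw [← integral_indicator hS, ← integral_indicator measurableSet_ball,
      ← integral_add_left_eq_self _ x]
    refine integral_congr_ae (Eventually.of_forall fun z => ?_)
    simp only [indicator, Metric.mem_ball, dist_eq_norm, add_sub_cancel_left, sub_zero]
  have hfin : ∀ h : ℝ, IsFiniteMeasure (volume.restrict (Metric.ball (0 : RN N) h)) :=
    fun h => ⟨by simp [measure_ball_lt_top]⟩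
  have hlim : ∀ h : ℝ, Tendsto (fun n => ∫ x in Metric.ball (0 : RN N) R,
      (∫ z in Metric.ball (0 : RN N) h, sobVal (w n) (x + z)) ^ 2) atTop (𝓝 0) := by
    intro h
    have := tendsto_integral_of_dominated_convergence
      (μ := volume.restrict (Metric.ball (0 : RN N) R))
      (F := fun n x => (∫ z in Metric.ball (0 : RN N) h, sobVal (w n) (x + z)) ^ 2)
      (f := fun _ => (0 : ℝ))
      (fun _ => volume.real (Metric.ball (0 : RN N) h) * M ^ 2) ?_ (integrable_const _) ?_ ?_
    · simpa using this
    · intro n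
      have hwn := measurable_sobVal (w n)
      have : StronglyMeasurable (Function.uncurry fun (x z : RN N) => sobVal (w n) (x + z)) := by
        refine Measurable.stronglyMeasurable ?_
        unfold Function.uncurry
        fun_prop
      exact (this.integral_prod_right.pow 2).aestronglyMeasurable
    · intro n
      refine Eventually.of_forall fun x => ?_
      rw [Real.norm_of_nonneg (sq_nonneg _)]
      have hm : MemLp (fun z => sobVal (w n) (x + z)) 2 volume := by
        simp_rw [add_comm x]
        exact memLp_comp_add (sobVal_memLp (w n)) x
      have hm' := hm.restrict (Metric.ball (0 : RN N) h)
      refine (sq_integral_le_measureReal_mul (hm'.integrable (by norm_num))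
        hm'.integrable_sq).trans ?_
      rw [measureReal_restrict_apply_univ]
      gcongr
      refine le_trans (setIntegral_le_integral hm.integrable_sq
        (Eventually.of_forall fun z => sq_nonneg _)) ?_
      rw [integral_add_left_eq_self (fun z => sobVal (w n) z ^ 2)]
      exact (integral_sobVal_sq_le _).trans (pow_le_pow_left₀ (norm_nonneg _) (hM n) 2)
    · refine Eventually.of_forall fun x => ?_
      simpa using (havg h x).pow 2
  rw [Metric.tendsto_atTop]
  intro ε hε
  -- The radius is chosen so that the error `2 h² M²` is less than `3ε/4`.
  set h : ℝ := √(ε / (4 * (M ^ 2 + 1))) with hh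
  have hh0 : 0 < h := Real.sqrt_pos.2 (by positivity)
  have hh2 : 2 * h ^ 2 * M ^ 2 < ε / 2 + ε / 4 := by
    rw [hh, Real.sq_sqrt (by positivity)]
    have : 2 * (ε / (4 * (M ^ 2 + 1))) * M ^ 2 = ε / 2 * (M ^ 2 / (M ^ 2 + 1)) := by
      field_simp; ring
    rw [this]
    have h1 : M ^ 2 / (M ^ 2 + 1) ≤ 1 := by
      rw [div_le_one (by positivity)]; linarith
    nlinarith
  have h1 := (hlim h).const_mul (2 / volume.real (Metric.ball (0 : RN N) h) ^ 2)
  rw [mul_zero] at h1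
  obtain ⟨n0, hn0⟩ := eventually_atTop.1 (h1.eventually (gt_mem_nhds (div_pos hε four_pos)))
  refine ⟨n0, fun n hn => ?_⟩
  rw [Real.dist_eq, sub_zero, abs_of_nonneg (integral_nonneg fun x => sq_nonneg _)]
  have h2 := setIntegral_ball_sobVal_sq_le (w n) hN hh0 (A := Metric.ball (0 : RN N) R)
    measure_ball_lt_top.ne
  have h3 := hn0 n hn
  have h4 : 2 * h ^ 2 * ‖w n‖ ^ 2 ≤ 2 * h ^ 2 * M ^ 2 := by
    gcongr
    exact hM n
  linarith

/-- Convergence in `L²` on balls, of a sequence bounded in `H¹`, gives convergence almost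
everywhere along a subsequence. The weight `(1 + ‖x‖)⁻¹` turns it into convergence in `L¹`. -/
theorem exists_subseq_ae_tendsto_zero {w : ℕ → SobolevH1 N} {M : ℝ} (hM : ∀ n, ‖w n‖ ≤ M)
    (hw : ∀ R : ℝ, Tendsto (fun n => ∫ x in Metric.ball (0 : RN N) R, sobVal (w n) x ^ 2)
      atTop (𝓝 0)) :
    ∃ σ : ℕ → ℕ, StrictMono σ ∧
      ∀ᵐ x, Tendsto (fun n => sobVal (w (σ n)) x) atTop (𝓝 0) := by
  set F : ℕ → RN N → ℝ := fun n x => (1 + ‖x‖)⁻¹ * sobVal (w n) x ^ 2 with hF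
  have hle1 : ∀ x : RN N, (1 + ‖x‖)⁻¹ ≤ 1 := fun x =>
    inv_le_one_of_one_le₀ (by linarith [norm_nonneg x])
  have hcont : Continuous fun x : RN N => (1 + ‖x‖)⁻¹ :=
    (continuous_const.add continuous_norm).inv₀ fun x =>
      (add_pos_of_pos_of_nonneg one_pos (norm_nonneg x)).ne'
  have hFint : ∀ n, Integrable (F n) := by
    intro n
    refine (integrable_sobVal_sq (w n)).mono'
      (hcont.aestronglyMeasurable.mul (integrable_sobVal_sq (w n)).1)
      (Eventually.of_forall fun x => ?_)
    rw [hF, Real.norm_of_nonneg (by positivity)]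
    exact mul_le_of_le_one_left (sq_nonneg _) (hle1 x)
  have hlim : Tendsto (fun n => ∫ x, F n x) atTop (𝓝 0) := by
    rw [Metric.tendsto_atTop]
    intro ε hε
    obtain ⟨R, hR⟩ := exists_nat_gt (2 * M ^ 2 / ε)
    obtain ⟨n0, hn0⟩ := eventually_atTop.1 ((hw R).eventually (gt_mem_nhds (half_pos hε)))
    refine ⟨n0, fun n hn => ?_⟩
    rw [Real.dist_eq, sub_zero, abs_of_nonneg (integral_nonneg fun x => by
      rw [hF]; positivity)]
    rw [← integral_add_compl (measurableSet_ball (x := (0 : RN N)) (ε := (R : ℝ))) (hFint n)]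
    have h1 : ∫ x in Metric.ball (0 : RN N) R, F n x
        ≤ ∫ x in Metric.ball (0 : RN N) R, sobVal (w n) x ^ 2 :=
      integral_mono (hFint n).restrict (integrable_sobVal_sq (w n)).restrict fun x =>
        mul_le_of_le_one_left (sq_nonneg _) (hle1 x)
    have h2 : ∫ x in (Metric.ball (0 : RN N) R)ᶜ, F n x ≤ (1 + (R : ℝ))⁻¹ * M ^ 2 := by
      calc ∫ x in (Metric.ball (0 : RN N) R)ᶜ, F n x
          ≤ ∫ x in (Metric.ball (0 : RN N) R)ᶜ, (1 + (R : ℝ))⁻¹ * sobVal (w n) x ^ 2 := by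
            refine setIntegral_mono_on (hFint n).integrableOn
              ((integrable_sobVal_sq (w n)).const_mul _).integrableOn
              measurableSet_ball.compl fun x hx => ?_
            have hx' : (R : ℝ) ≤ ‖x‖ := by simpa using hx
            refine mul_le_mul_of_nonneg_right ?_ (sq_nonneg _)
            exact inv_anti₀ (by positivity) (by linarith)
        _ ≤ (1 + (R : ℝ))⁻¹ * ∫ x, sobVal (w n) x ^ 2 := by
            rw [integral_const_mul]
            refine mul_le_mul_of_nonneg_left (setIntegral_le_integral (integrable_sobVal_sq _)
              (Eventually.of_forall fun x => sq_nonneg _)) (by positivity)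
        _ ≤ _ := by
            gcongr
            exact (integral_sobVal_sq_le _).trans (pow_le_pow_left₀ (norm_nonneg _) (hM n) 2)
    have h3 : (1 + (R : ℝ))⁻¹ * M ^ 2 < ε / 2 := by
      rw [inv_mul_lt_iff₀ (by positivity)]
      rw [div_lt_iff₀ hε] at hR
      nlinarith
    linarith [hn0 n hn]
  have hmeas : TendstoInMeasure volume F atTop (fun _ => 0) := by
    refine tendstoInMeasure_of_tendsto_eLpNorm (p := 1) one_ne_zero
      (fun n => (hFint n).1) aestronglyMeasurable_const ?_
    have : ∀ n, eLpNorm (F n - fun _ => 0) 1 volume = ENNReal.ofReal (∫ x, F n x) := by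
      intro n
      rw [eLpNorm_one_eq_lintegral_enorm, ofReal_integral_eq_lintegral_ofReal (hFint n)
        (Eventually.of_forall fun x => by rw [hF]; positivity)]
      refine lintegral_congr fun x => ?_
      simp only [Pi.sub_apply, sub_zero]
      rw [Real.enorm_of_nonneg]
      rw [hF]
      positivity
    simp_rw [this]
    simpa using ENNReal.tendsto_ofReal hlim
  obtain ⟨σ, hσ, hae⟩ := hmeas.exists_seq_tendsto_ae
  refine ⟨σ, hσ, ?_⟩
  filter_upwards [hae] with x hx
  have h1 := hx.const_mul (1 + ‖x‖)
  have h2 : Tendsto (fun n => sobVal (w (σ n)) x ^ 2) atTop (𝓝 0) := by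
    rw [mul_zero] at h1
    refine h1.congr fun n => ?_
    rw [hF]
    have : (1 + ‖x‖) ≠ 0 := by positivity
    field_simp
  have h3 := (Real.continuous_sqrt.tendsto 0).comp h2
  rw [Real.sqrt_zero] at h3
  refine (tendsto_zero_iff_abs_tendsto_zero _).2 (h3.congr fun n => ?_)
  simp [Real.sqrt_sq_eq_abs]

end LocalCompactness

/-! ### The Brezis–Lieb lemma and vanishing weights -/

section BrezisLieb

/-- The elementary inequality behind the Brezis–Lieb lemma; `|b| ≤ η |a|` and `|b| > η |a|` are
treated separately, for a small `η`. -/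
theorem abs_rpow_add_sub_rpow_le {r : ℝ} (hr : 1 ≤ r) {ε : ℝ} (hε : 0 < ε) :
    ∃ C : ℝ, 0 ≤ C ∧ ∀ a b : ℝ, |(|a + b| ^ r - |a| ^ r)| ≤ ε * |a| ^ r + C * |b| ^ r := by
  have hr0 : 0 < r := by linarith
  have hlim1 : Tendsto (fun η : ℝ => (1 + η) ^ r) (𝓝[>] 0) (𝓝 1) := by
    have : ContinuousAt (fun η : ℝ => (1 + η) ^ r) 0 :=
      (continuousAt_const.add continuousAt_id).rpow_const (Or.inr hr0.le)
    simpa [ContinuousAt] using this.tendsto.mono_left nhdsWithin_le_nhds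
  have hlim2 : Tendsto (fun η : ℝ => (1 - η) ^ r) (𝓝[>] 0) (𝓝 1) := by
    have : ContinuousAt (fun η : ℝ => (1 - η) ^ r) 0 :=
      (continuousAt_const.sub continuousAt_id).rpow_const (Or.inr hr0.le)
    simpa [ContinuousAt] using this.tendsto.mono_left nhdsWithin_le_nhds
  obtain ⟨η, ⟨⟨h1, h2⟩, hη0⟩, hη1⟩ := (((hlim1.eventually (gt_mem_nhds (by linarith : 1 < 1 + ε))).and
    (hlim2.eventually (lt_mem_nhds (by linarith : 1 - ε < 1)))).and
    (self_mem_nhdsWithin)).and (Ioo_mem_nhdsGT one_pos) |>.exists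
  have hη0' : 0 < η := hη0
  refine ⟨(1 + η⁻¹) ^ r + (η⁻¹) ^ r, by positivity, fun a b => ?_⟩
  by_cases hb : |b| ≤ η * |a|
  · have hup : |a + b| ^ r ≤ (1 + η) ^ r * |a| ^ r := by
      rw [← Real.mul_rpow (by positivity) (abs_nonneg _)]
      refine Real.rpow_le_rpow (abs_nonneg _) ?_ hr0.le
      linarith [abs_add_le a b]
    have hlo : (1 - η) ^ r * |a| ^ r ≤ |a + b| ^ r := by
      rw [← Real.mul_rpow (by linarith [hη1.2]) (abs_nonneg _)]
      refine Real.rpow_le_rpow (mul_nonneg (by linarith [hη1.2]) (abs_nonneg _)) ?_ hr0.le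
      have := abs_sub_abs_le_abs_sub a (-b)
      rw [abs_neg, sub_neg_eq_add] at this
      linarith
    have ha : 0 ≤ |a| ^ r := by positivity
    have hC : 0 ≤ ((1 + η⁻¹) ^ r + (η⁻¹) ^ r) * |b| ^ r := by positivity
    rw [abs_le]
    constructor <;> nlinarith
  · push Not at hb
    have ha : |a| ≤ η⁻¹ * |b| := by
      rw [inv_mul_eq_div, le_div_iff₀ hη0', mul_comm]
      exact hb.le
    have h3 : |a| ^ r ≤ (η⁻¹) ^ r * |b| ^ r := by
      rw [← Real.mul_rpow (by positivity) (abs_nonneg _)]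
      exact Real.rpow_le_rpow (abs_nonneg _) ha hr0.le
    have h4 : |a + b| ^ r ≤ (1 + η⁻¹) ^ r * |b| ^ r := by
      rw [← Real.mul_rpow (by positivity) (abs_nonneg _)]
      refine Real.rpow_le_rpow (abs_nonneg _) ?_ hr0.le
      linarith [abs_add_le a b]
    have h5 : 0 ≤ ε * |a| ^ r := by positivity
    have h6 : 0 ≤ |a| ^ r := by positivity
    have h7 : 0 ≤ |a + b| ^ r := by positivity
    rw [abs_le]
    constructor <;> nlinarith

/-- **Brezis–Lieb lemma**, with a bounded weight. -/
theorem tendsto_integral_brezis_lieb {α : Type*} [MeasurableSpace α] {μ : Measure α} {r : ℝ}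
    (hr : 1 ≤ r) {K u : α → ℝ} {w : ℕ → α → ℝ} {k₁ C₀ : ℝ}
    (hK : ∀ᵐ x ∂μ, |K x| ≤ k₁) (hum : Measurable u) (hwm : ∀ n, Measurable (w n))
    (hu : Integrable (fun x => |u x| ^ r) μ)
    (hw : ∀ n, Integrable (fun x => |w n x| ^ r) μ)
    (hC₀ : ∀ n, ∫ x, |w n x| ^ r ∂μ ≤ C₀)
    (hlim : ∀ᵐ x ∂μ, Tendsto (fun n => w n x) atTop (𝓝 0)) :
    Tendsto (fun n => ∫ x, K x * (|w n x + u x| ^ r - |w n x| ^ r - |u x| ^ r) ∂μ)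
      atTop (𝓝 0) := by
  have hr0 : 0 < r := by linarith
  have hC₀' : 0 ≤ C₀ := (integral_nonneg fun x => by positivity).trans (hC₀ 0)
  rcases eq_or_ne μ 0 with rfl | hμ
  · simp
  have hk₁ : 0 ≤ k₁ := by
    have : (ae μ).NeBot := ae_neBot.2 hμ
    obtain ⟨x, hx⟩ := hK.exists
    exact (abs_nonneg _).trans hx
  rw [Metric.tendsto_atTop]
  intro δ hδ
  set ε := δ / (2 * (k₁ + 1) * (C₀ + 1)) with hε
  have hε0 : 0 < ε := by positivity
  obtain ⟨C, hC0, hC⟩ := abs_rpow_add_sub_rpow_le hr hε0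
  set g : ℕ → α → ℝ := fun n x => |w n x + u x| ^ r - |w n x| ^ r - |u x| ^ r with hg
  -- The part of `|g n|` not absorbed by `ε |w n|^r` is dominated by a multiple of `|u|^r`.
  set f : ℕ → α → ℝ := fun n x => max 0 (|g n x| - ε * |w n x| ^ r) with hf
  have hgm : ∀ n, Measurable (g n) := fun n => by
    have := hwm n
    rw [hg]
    fun_prop
  have hfm : ∀ n, Measurable (f n) := fun n => by
    have := hwm n
    have := hgm n
    rw [hf]
    fun_prop
  have hfb : ∀ n x, f n x ≤ (C + 1) * |u x| ^ r := by
    intro n x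
    have h1 := hC (w n x) (u x)
    have h2 : 0 ≤ |u x| ^ r := by positivity
    have h3 : |g n x| ≤ |(|w n x + u x| ^ r - |w n x| ^ r)| + |u x| ^ r := by
      rw [hg]
      simp only
      refine (abs_sub _ _).trans ?_
      rw [abs_of_nonneg h2]
    refine max_le (by positivity) ?_
    linarith
  have hf0 : ∀ n x, 0 ≤ f n x := fun n x => le_max_left _ _
  have hfint : ∀ n, Integrable (f n) μ := fun n =>
    (hu.const_mul (C + 1)).mono' (hfm n).aestronglyMeasurable
      (Eventually.of_forall fun x => by rw [Real.norm_of_nonneg (hf0 n x)]; exact hfb n x)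
  have hflim : Tendsto (fun n => ∫ x, f n x ∂μ) atTop (𝓝 0) := by
    have := tendsto_integral_of_dominated_convergence (F := f) (f := fun _ => (0 : ℝ))
      (fun x => (C + 1) * |u x| ^ r) (fun n => (hfm n).aestronglyMeasurable)
      (hu.const_mul (C + 1))
      (fun n => Eventually.of_forall fun x => by
        rw [Real.norm_of_nonneg (hf0 n x)]; exact hfb n x) ?_
    · simpa using this
    · filter_upwards [hlim] with x hx
      have h1 : Tendsto (fun n => |w n x| ^ r) atTop (𝓝 0) := by
        have := hx.abs.rpow_const (p := r) (Or.inr hr0.le)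
        simpa [Real.zero_rpow hr0.ne'] using this
      have h2 : Tendsto (fun n => |w n x + u x| ^ r) atTop (𝓝 (|u x| ^ r)) := by
        have := (hx.add_const (u x)).abs.rpow_const (p := r) (Or.inr hr0.le)
        simpa using this
      have h3 : Tendsto (fun n => g n x) atTop (𝓝 0) := by
        have := (h2.sub h1).sub_const (|u x| ^ r)
        simpa using this
      have h4 := (h3.abs.sub (h1.const_mul ε))
      simpa using (tendsto_const_nhds (x := (0 : ℝ))).max h4
  have hbound : ∀ n, |∫ x, K x * g n x ∂μ| ≤ k₁ * ((∫ x, f n x ∂μ) + ε * C₀) := by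
    intro n
    calc |∫ x, K x * g n x ∂μ| ≤ ∫ x, k₁ * (f n x + ε * |w n x| ^ r) ∂μ := by
          rw [← Real.norm_eq_abs]
          refine norm_integral_le_of_norm_le (((hfint n).add ((hw n).const_mul ε)).const_mul _) ?_
          filter_upwards [hK] with x hx
          rw [norm_mul, Real.norm_eq_abs, Real.norm_eq_abs]
          gcongr
          have := le_max_right 0 (|g n x| - ε * |w n x| ^ r)
          linarith
      _ = k₁ * ((∫ x, f n x ∂μ) + ε * ∫ x, |w n x| ^ r ∂μ) := by
          rw [integral_const_mul, integral_add (hfint n) ((hw n).const_mul ε), integral_const_mul]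
      _ ≤ _ := by
          gcongr
          exact hC₀ n
  have hsmall : k₁ * (ε * C₀) ≤ δ / 2 := by
    have : δ / 2 = (k₁ + 1) * (ε * (C₀ + 1)) := by rw [hε]; field_simp
    rw [this]
    gcongr <;> linarith
  have h5 := hflim.const_mul k₁
  rw [mul_zero] at h5
  obtain ⟨n0, hn0⟩ := eventually_atTop.1 (h5.eventually (gt_mem_nhds (half_pos hδ)))
  refine ⟨n0, fun n hn => ?_⟩
  rw [Real.dist_eq, sub_zero]
  have := hbound n
  have := hn0 n hn
  rw [mul_add] at *
  linarith

variable {N : ℕ}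

theorem VanishesAtInfinity.exists_ball {f : RN N → ℝ} (hf : VanishesAtInfinity f) {δ : ℝ}
    (hδ : 0 < δ) : ∃ R : ℝ, ∀ᵐ x, x ∉ Metric.ball (0 : RN N) R → |f x| ≤ δ := by
  have h1 := hf.eventually (Metric.closedBall_mem_nhds (0 : ℝ) hδ)
  rw [eventually_inf] at h1
  obtain ⟨s, hs, t, ht, h⟩ := h1
  obtain ⟨K, hK, hKs⟩ := mem_cocompact.1 hs
  obtain ⟨R, hR⟩ := hK.isBounded.subset_ball (0 : RN N)
  refine ⟨R, ?_⟩
  filter_upwards [ht] with x hx hxR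
  have := h x ⟨hKs fun hxK => hxR (hR hxK), hx⟩
  simpa using this

/-- A weight vanishing at infinity does not see a sequence that is bounded in `H¹` and tends to
zero in `L²` on balls. -/
theorem tendsto_integral_vanishing_weight {r q : ℝ} (hr : 2 < r) (hrq : r < q)
    (hbr : SobolevBound N r) (hbq : SobolevBound N q) {b : RN N → ℝ}
    {B : ℝ} (hbB : ∀ᵐ x, |b x| ≤ B) (hb : VanishesAtInfinity b)
    {w : ℕ → SobolevH1 N} {M : ℝ} (hM : ∀ n, ‖w n‖ ≤ M)
    (hw : ∀ R : ℝ, Tendsto (fun n => ∫ x in Metric.ball (0 : RN N) R, sobVal (w n) x ^ 2)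
      atTop (𝓝 0)) :
    Tendsto (fun n => ∫ x, b x * |sobVal (w n) x| ^ r) atTop (𝓝 0) := by
  have hr0 : 0 < r := by linarith
  have hq0 : 0 < q := by linarith
  have hM0 : 0 ≤ M := (norm_nonneg _).trans (hM 0)
  have hB0 : 0 ≤ B := by
    obtain ⟨x, hx⟩ := hbB.exists
    exact (abs_nonneg _).trans hx
  obtain ⟨Cr, hCr0, hCr⟩ := hbr.integral_le hr0
  obtain ⟨Cq, hCq0, hCq⟩ := hbq.integral_le hq0
  set Dr := Cr * M ^ r with hDr
  set Dq := Cq * M ^ q with hDq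
  have hDr0 : 0 ≤ Dr := by positivity
  have hDq0 : 0 ≤ Dq := by positivity
  have hir := fun n => hbr.integrable_rpow hr0 (w n)
  have hiq := fun n => hbq.integrable_rpow hq0 (w n)
  have hr' : ∀ n, ∫ x, |sobVal (w n) x| ^ r ≤ Dr := fun n => (hCr (w n)).trans (by
    rw [hDr]; gcongr; exact hM n)
  have hq' : ∀ n, ∫ x, |sobVal (w n) x| ^ q ≤ Dq := fun n => (hCq (w n)).trans (by
    rw [hDq]; gcongr; exact hM n)
  rw [Metric.tendsto_atTop]
  intro ε hε
  obtain ⟨R, hR⟩ := hb.exists_ball (δ := ε / (4 * (Dr + 1))) (by positivity)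
  -- On the ball, `|w|^r` is split at the level `T`.
  obtain ⟨T, hT0, hT⟩ : ∃ T : ℝ, 0 < T ∧ B * (T ^ (r - q) * Dq) < ε / 4 := by
    have h1 : Tendsto (fun T : ℝ => T ^ (r - q)) atTop (𝓝 0) := by
      simpa using tendsto_rpow_neg_atTop (by linarith : 0 < q - r)
    have h2 := (h1.mul_const Dq).const_mul B
    rw [zero_mul, mul_zero] at h2
    obtain ⟨T, h3, h4⟩ := ((eventually_gt_atTop (0 : ℝ)).and
      (h2.eventually (gt_mem_nhds (div_pos hε four_pos)))).exists
    exact ⟨T, h3, h4⟩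
  have hpt : ∀ y : ℝ, |y| ^ r ≤ T ^ (r - 2) * y ^ 2 + T ^ (r - q) * |y| ^ q := by
    intro y
    rcases (abs_nonneg y).eq_or_lt with hy | hy
    · rw [← hy, Real.zero_rpow hr0.ne', Real.zero_rpow hq0.ne']
      positivity
    rcases le_total |y| T with h | h
    · have e : |y| ^ r = |y| ^ (r - 2) * y ^ 2 := by
        rw [← sq_abs, ← Real.rpow_two, ← Real.rpow_add hy]; congr 1; ring
      have h1 : |y| ^ (r - 2) ≤ T ^ (r - 2) := Real.rpow_le_rpow hy.le h (by linarith)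
      have h2 : 0 ≤ T ^ (r - q) * |y| ^ q := by positivity
      rw [e]
      nlinarith [sq_nonneg y]
    · have e : |y| ^ r = |y| ^ (r - q) * |y| ^ q := by
        rw [← Real.rpow_add hy]; congr 1; ring
      have h1 : |y| ^ (r - q) ≤ T ^ (r - q) :=
        Real.rpow_le_rpow_of_nonpos hT0 h (by linarith)
      have h2 : 0 ≤ T ^ (r - 2) * y ^ 2 := by positivity
      rw [e]
      nlinarith [Real.rpow_nonneg hy.le q]
  have h1 := (hw R).const_mul (B * T ^ (r - 2))
  rw [mul_zero] at h1
  obtain ⟨n0, hn0⟩ := eventually_atTop.1 (h1.eventually (gt_mem_nhds (div_pos hε four_pos)))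
  refine ⟨n0, fun n hn => ?_⟩
  rw [Real.dist_eq, sub_zero]
  set I := (Metric.ball (0 : RN N) R).indicator (fun x => sobVal (w n) x ^ 2) with hI
  have hIint : Integrable I := (integrable_sobVal_sq _).indicator measurableSet_ball
  have hδ0 : 0 ≤ ε / (4 * (Dr + 1)) := by positivity
  calc |∫ x, b x * |sobVal (w n) x| ^ r|
      ≤ ∫ x, (ε / (4 * (Dr + 1)) * |sobVal (w n) x| ^ r
        + (B * T ^ (r - 2) * I x + B * T ^ (r - q) * |sobVal (w n) x| ^ q)) := by
        rw [← Real.norm_eq_abs]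
        refine norm_integral_le_of_norm_le (((hir n).const_mul _).add
          ((hIint.const_mul _).add ((hiq n).const_mul _))) ?_
        filter_upwards [hbB, hR] with x hx hxR
        rw [norm_mul, Real.norm_eq_abs, Real.norm_eq_abs,
          abs_of_nonneg (by positivity : 0 ≤ |sobVal (w n) x| ^ r)]
        have h0r : 0 ≤ |sobVal (w n) x| ^ r := by positivity
        have h0q : 0 ≤ B * T ^ (r - q) * |sobVal (w n) x| ^ q := by positivity
        by_cases hxb : x ∈ Metric.ball (0 : RN N) R
        · rw [hI, indicator_of_mem hxb]
          have h2 := hpt (sobVal (w n) x)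
          calc |b x| * |sobVal (w n) x| ^ r ≤ B * (T ^ (r - 2) * sobVal (w n) x ^ 2
                + T ^ (r - q) * |sobVal (w n) x| ^ q) := by gcongr
            _ ≤ _ := by nlinarith [mul_nonneg hδ0 h0r]
        · rw [hI, indicator_of_notMem hxb]
          have := mul_le_mul_of_nonneg_right (hxR hxb) h0r
          linarith
    _ = ε / (4 * (Dr + 1)) * (∫ x, |sobVal (w n) x| ^ r)
        + (B * T ^ (r - 2) * (∫ x in Metric.ball (0 : RN N) R, sobVal (w n) x ^ 2)
          + B * T ^ (r - q) * ∫ x, |sobVal (w n) x| ^ q) := by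
        have i1 : Integrable (fun x => B * T ^ (r - 2) * I x
            + B * T ^ (r - q) * |sobVal (w n) x| ^ q) :=
          (hIint.const_mul _).add ((hiq n).const_mul _)
        rw [integral_add ((hir n).const_mul _) i1,
          integral_add (hIint.const_mul _) ((hiq n).const_mul _), integral_const_mul,
          integral_const_mul, integral_const_mul, hI, integral_indicator measurableSet_ball]
    _ < ε := by
        have h2 : ε / (4 * (Dr + 1)) * (∫ x, |sobVal (w n) x| ^ r) ≤ ε / 4 := by
          calc _ ≤ ε / (4 * (Dr + 1)) * (Dr + 1) := by
                gcongr
                linarith [hr' n]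
            _ = ε / 4 := by field_simp
        have h3 : B * T ^ (r - q) * ∫ x, |sobVal (w n) x| ^ q ≤ B * (T ^ (r - q) * Dq) := by
          rw [mul_assoc]
          gcongr
          exact hq' n
        linarith [hn0 n hn]

end BrezisLieb

/-! ### The Nehari manifold -/

section Nehari

variable {N : ℕ}

/-- The quadratic part `∫ (|∇u|² + V u²)` of the functional. -/
def quadForm (V : RN N → ℝ) (u : SobolevH1 N) : ℝ :=
  ∫ x, (‖sobGrad u x‖ ^ 2 + V x * sobVal u x ^ 2)

/-- The superquadratic part `∫ K |u|^(p+1)` of the functional. -/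
def powForm (K : RN N → ℝ) (p : ℝ) (u : SobolevH1 N) : ℝ :=
  ∫ x, K x * |sobVal u x| ^ (p + 1)

/-- The ratio `1/2 - 1/(p+1)` of the energy to the quadratic form on the Nehari manifold. -/
def nehariConst (p : ℝ) : ℝ := 1 / 2 - 1 / (p + 1)

/-- Standing assumptions on the coefficients: `V` is bounded below by `v₀ > 0`, `K` lies between
two positive constants, and the power is superlinear and subcritical. -/
structure Admissible (V K : RN N → ℝ) (p v₀ k₀ k₁ : ℝ) : Prop where
  one_lt : 1 < p
  v₀_pos : 0 < v₀
  V_ge : ∀ᵐ x, v₀ ≤ V x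
  k₀_pos : 0 < k₀
  K_ge : ∀ᵐ x, k₀ ≤ K x
  K_le : ∀ᵐ x, K x ≤ k₁
  K_meas : AEStronglyMeasurable K volume
  sobolev : SobolevBound N (p + 1)

theorem nehariConst_pos {p : ℝ} (hp : 1 < p) : 0 < nehariConst p := by
  unfold nehariConst
  rw [sub_pos]
  exact one_div_lt_one_div_of_lt (by norm_num) (by linarith)

theorem energy_eq (V K : RN N → ℝ) (p : ℝ) (u : SobolevH1 N) :
    energy V K p u = 1 / 2 * quadForm V u - 1 / (p + 1) * powForm K p u := rfl

theorem abs_rpow_sub_one_mul_mul {p : ℝ} (hp : 1 < p) (t : ℝ) :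
    |t| ^ (p - 1) * t * t = |t| ^ (p + 1) := by
  rcases (abs_nonneg t).eq_or_lt with h | h
  · have : t = 0 := abs_eq_zero.1 h.symm
    simp [this, Real.zero_rpow (by linarith : p + 1 ≠ 0)]
  · rw [mul_assoc, ← sq, ← sq_abs t, ← Real.rpow_two, ← Real.rpow_add h]
    congr 1; ring

theorem energyDeriv_self (V K : RN N → ℝ) {p : ℝ} (hp : 1 < p) (u : SobolevH1 N) :
    energyDeriv V K p u u = quadForm V u - powForm K p u := by
  unfold energyDeriv quadForm powForm
  congr 1
  · refine integral_congr_ae (Eventually.of_forall fun x => ?_)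
    simp only [real_inner_self_eq_norm_sq]
    ring
  · refine integral_congr_ae (Eventually.of_forall fun x => ?_)
    simp only
    rw [← abs_rpow_sub_one_mul_mul hp]
    ring

theorem FinitePotential.smul {V : RN N → ℝ} {u : SobolevH1 N} (hu : FinitePotential V u) (t : ℝ) :
    FinitePotential V (t • u) := by
  refine (Integrable.const_mul hu (t ^ 2)).congr ?_
  filter_upwards [sobVal_smul t u] with x hx
  rw [hx]
  ring

theorem quadForm_smul (V : RN N → ℝ) (u : SobolevH1 N) (t : ℝ) :
    quadForm V (t • u) = t ^ 2 * quadForm V u := by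
  unfold quadForm
  rw [← integral_const_mul]
  refine integral_congr_ae ?_
  filter_upwards [sobVal_smul t u, sobGrad_smul t u] with x hx hx'
  rw [hx, hx', norm_smul, mul_pow, Real.norm_eq_abs, sq_abs]
  ring

theorem powForm_smul (K : RN N → ℝ) (p : ℝ) (u : SobolevH1 N) {t : ℝ} (ht : 0 ≤ t) :
    powForm K p (t • u) = t ^ (p + 1) * powForm K p u := by
  unfold powForm
  rw [← integral_const_mul]
  refine integral_congr_ae ?_
  filter_upwards [sobVal_smul t u] with x hx
  rw [hx, abs_mul, abs_of_nonneg ht, Real.mul_rpow ht (abs_nonneg _)]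
  ring

theorem quadForm_eq_add {V : RN N → ℝ} {u : SobolevH1 N} (hu : FinitePotential V u) :
    quadForm V u = (∫ x, ‖sobGrad u x‖ ^ 2) + ∫ x, V x * sobVal u x ^ 2 :=
  integral_add (integrable_norm_sobGrad_sq u) hu

namespace Admissible

variable {V K : RN N → ℝ} {p v₀ k₀ k₁ : ℝ} (h : Admissible V K p v₀ k₀ k₁)

include h

theorem integrable_rpow (u : SobolevH1 N) : Integrable (fun x => |sobVal u x| ^ (p + 1)) :=
  h.sobolev.integrable_rpow (by linarith [h.one_lt]) u

theorem abs_K_le : ∀ᵐ x, |K x| ≤ k₁ := by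
  filter_upwards [h.K_ge, h.K_le] with x h1 h2
  rwa [abs_of_nonneg (h.k₀_pos.le.trans h1)]

theorem integrable_mul_rpow (u : SobolevH1 N) :
    Integrable (fun x => K x * |sobVal u x| ^ (p + 1)) :=
  (h.integrable_rpow u).bdd_mul h.K_meas h.abs_K_le

theorem powForm_ge (u : SobolevH1 N) : k₀ * ∫ x, |sobVal u x| ^ (p + 1) ≤ powForm K p u := by
  rw [← integral_const_mul]
  refine integral_mono_ae ((h.integrable_rpow u).const_mul _) (h.integrable_mul_rpow u) ?_
  filter_upwards [h.K_ge] with x hx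
  gcongr

theorem powForm_le (u : SobolevH1 N) : powForm K p u ≤ k₁ * ∫ x, |sobVal u x| ^ (p + 1) := by
  rw [← integral_const_mul]
  refine integral_mono_ae (h.integrable_mul_rpow u) ((h.integrable_rpow u).const_mul _) ?_
  filter_upwards [h.K_le] with x hx
  gcongr

theorem powForm_nonneg (u : SobolevH1 N) : 0 ≤ powForm K p u :=
  le_trans (mul_nonneg h.k₀_pos.le (integral_nonneg fun x => by positivity)) (h.powForm_ge u)

theorem powForm_pos {u : SobolevH1 N} (hu : u ≠ 0) : 0 < powForm K p u := by
  refine lt_of_lt_of_le (mul_pos h.k₀_pos ?_) (h.powForm_ge u)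
  have hp := h.one_lt
  rw [integral_pos_iff_support_of_nonneg (fun x => by positivity) (h.integrable_rpow u),
    pos_iff_ne_zero]
  intro h0
  apply hu
  rw [← sobVal_ae_zero_iff]
  filter_upwards [measure_eq_zero_iff_ae_notMem.1 h0] with x hx
  simpa [Real.rpow_eq_zero (abs_nonneg _) (by linarith : p + 1 ≠ 0)] using hx

theorem min_mul_norm_sq_le {u : SobolevH1 N} (hu : FinitePotential V u) :
    min 1 v₀ * ‖u‖ ^ 2 ≤ quadForm V u := by
  have hv := h.v₀_pos
  rw [sobolev_norm_sq, quadForm_eq_add hu, mul_add, add_comm]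
  have h1 : 0 ≤ ∫ x, ‖sobGrad u x‖ ^ 2 := integral_nonneg fun x => by positivity
  refine add_le_add (mul_le_of_le_one_left h1 (min_le_left _ _)) ?_
  rw [← integral_const_mul]
  refine integral_mono_ae ((integrable_sobVal_sq u).const_mul _) hu ?_
  filter_upwards [h.V_ge] with x hx
  have : min 1 v₀ ≤ V x := (min_le_right _ _).trans hx
  gcongr

theorem quadForm_nonneg (u : SobolevH1 N) : 0 ≤ quadForm V u := by
  refine integral_nonneg_of_ae ?_
  filter_upwards [h.V_ge] with x hx
  have := h.v₀_pos.le.trans hx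
  simp only [Pi.zero_apply]
  positivity

theorem quadForm_pos {u : SobolevH1 N} (hu : u ≠ 0) (hf : FinitePotential V u) :
    0 < quadForm V u := by
  refine lt_of_lt_of_le ?_ (h.min_mul_norm_sq_le hf)
  have := norm_pos_iff.2 hu
  have := lt_min one_pos h.v₀_pos
  positivity

theorem mem_nehari_iff {u : SobolevH1 N} :
    u ∈ nehari V K p ↔ u ≠ 0 ∧ FinitePotential V u ∧ quadForm V u = powForm K p u := by
  unfold nehari
  rw [mem_ofPred_eq, energyDeriv_self V K h.one_lt, sub_eq_zero]

theorem energy_of_mem {u : SobolevH1 N} (hu : u ∈ nehari V K p) :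
    energy V K p u = nehariConst p * quadForm V u := by
  rw [energy_eq, ← (h.mem_nehari_iff.1 hu).2.2, nehariConst]
  ring

/-- The ray through `u` meets the Nehari manifold at `t u` with `t^(p-1) = Q/P`, where `Q` and `P` are
the quadratic and superquadratic parts at `u`. -/
theorem exists_smul_mem_nehari {u : SobolevH1 N} (hu : u ≠ 0) (hf : FinitePotential V u) :
    ∃ t : ℝ, 0 < t ∧ t • u ∈ nehari V K p ∧
      (t ^ 2 * quadForm V u) ^ (p - 1) * powForm K p u ^ 2 = quadForm V u ^ (p + 1) := by
  have hp := h.one_lt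
  have hp' : p - 1 ≠ 0 := by linarith
  have hQ := h.quadForm_pos hu hf
  have hP := h.powForm_pos hu
  set Q := quadForm V u
  set P := powForm K p u
  set t := (Q / P) ^ (1 / (p - 1)) with ht
  have ht0 : 0 < t := by positivity
  have htp : t ^ (p - 1) = Q / P := by
    rw [ht, ← Real.rpow_mul (by positivity), one_div_mul_cancel hp', Real.rpow_one]
  refine ⟨t, ht0, h.mem_nehari_iff.2 ⟨smul_ne_zero ht0.ne' hu, hf.smul t, ?_⟩, ?_⟩
  · rw [quadForm_smul, powForm_smul _ _ _ ht0.le]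
    have : p + 1 = (p - 1) + 2 := by ring
    rw [this, Real.rpow_add ht0, htp, Real.rpow_two]
    change t ^ 2 * Q = Q / P * t ^ 2 * P
    field_simp
  · have h2 : (t ^ 2) ^ (p - 1) = (Q / P) ^ 2 := by
      rw [← htp, ← Real.rpow_natCast, ← Real.rpow_mul ht0.le, ← Real.rpow_natCast,
        ← Real.rpow_mul ht0.le, mul_comm]
    have : p + 1 = (p - 1) + 2 := by ring
    rw [Real.mul_rpow (by positivity) hQ.le, h2, this, Real.rpow_add hQ, Real.rpow_two]
    field_simp

theorem nehari_nonempty {u : SobolevH1 N} (hu : u ≠ 0) (hf : FinitePotential V u) :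
    (nehari V K p).Nonempty := by
  obtain ⟨t, _, ht, _⟩ := h.exists_smul_mem_nehari hu hf
  exact ⟨_, ht⟩

theorem energy_nonneg_of_mem {u : SobolevH1 N} (hu : u ∈ nehari V K p) :
    0 ≤ energy V K p u := by
  rw [h.energy_of_mem hu]
  exact mul_nonneg (nehariConst_pos h.one_lt).le (h.quadForm_nonneg u)

theorem bddBelow_energy : BddBelow (energy V K p '' nehari V K p) :=
  ⟨0, by rintro _ ⟨u, hu, rfl⟩; exact h.energy_nonneg_of_mem hu⟩

theorem nehariLevel_nonneg : 0 ≤ nehariLevel V K p :=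
  Real.sInf_nonneg (by rintro _ ⟨u, hu, rfl⟩; exact h.energy_nonneg_of_mem hu)

theorem nehariLevel_le {u : SobolevH1 N} (hu : u ∈ nehari V K p) :
    nehariLevel V K p ≤ nehariConst p * quadForm V u := by
  rw [← h.energy_of_mem hu]
  exact csInf_le h.bddBelow_energy ⟨u, hu, rfl⟩

/-- The level of the Nehari manifold, as a homogeneous inequality on the whole domain. -/
theorem level_rpow_mul_le {u : SobolevH1 N} (hf : FinitePotential V u) :
    (nehariLevel V K p / nehariConst p) ^ (p - 1) * powForm K p u ^ 2
      ≤ quadForm V u ^ (p + 1) := by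
  have hp := h.one_lt
  have hc := nehariConst_pos hp
  by_cases hu : u = 0
  · have : powForm K p u = 0 := by
      refine integral_eq_zero_of_ae ?_
      filter_upwards [sobVal_ae_zero_iff.2 hu] with x hx
      simp [hx, Real.zero_rpow (by linarith : p + 1 ≠ 0)]
    rw [this]
    simpa using Real.rpow_nonneg (h.quadForm_nonneg u) _
  obtain ⟨t, ht0, ht, hte⟩ := h.exists_smul_mem_nehari hu hf
  rw [← hte]
  refine mul_le_mul_of_nonneg_right (Real.rpow_le_rpow
    (div_nonneg h.nehariLevel_nonneg hc.le) ?_ (by linarith)) (sq_nonneg _)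
  rw [div_le_iff₀ hc, ← quadForm_smul, mul_comm]
  exact h.nehariLevel_le ht

theorem le_nehariLevel (hne : (nehari V K p).Nonempty) {m : ℝ}
    (hm : ∀ u ∈ nehari V K p, m ≤ nehariConst p * quadForm V u) : m ≤ nehariLevel V K p := by
  refine le_csInf (hne.image _) ?_
  rintro _ ⟨u, hu, rfl⟩
  rw [h.energy_of_mem hu]
  exact hm u hu

/-- On the Nehari manifold `Q = P ≤ D Q^((p+1)/2)` by the Sobolev bound, so `Q` stays away from
zero. -/
theorem exists_pos_le_quadForm :
    ∃ c : ℝ, 0 < c ∧ ∀ u ∈ nehari V K p, c ≤ quadForm V u := by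
  have hp := h.one_lt
  obtain ⟨C, hC0, hC⟩ := h.sobolev.integral_le (by linarith)
  set v := min 1 v₀ with hv
  have hv0 : 0 < v := lt_min one_pos h.v₀_pos
  have hk₁ : 0 < k₁ := by
    obtain ⟨x, hx1, hx2⟩ := (h.K_ge.and h.K_le).exists
    exact h.k₀_pos.trans_le (hx1.trans hx2)
  set D := k₁ * (C * (v⁻¹) ^ ((p + 1) / 2)) with hD
  have hD0 : 0 < D := by positivity
  refine ⟨(D⁻¹) ^ (2 / (p - 1)), by positivity, fun u hu => ?_⟩
  obtain ⟨hu0, hf, hQP⟩ := h.mem_nehari_iff.1 hu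
  have hQ := h.quadForm_pos hu0 hf
  have h1 : ‖u‖ ^ (p + 1) ≤ (v⁻¹) ^ ((p + 1) / 2) * quadForm V u ^ ((p + 1) / 2) := by
    rw [← Real.mul_rpow (by positivity) hQ.le]
    have h2 : ‖u‖ ^ 2 ≤ v⁻¹ * quadForm V u := by
      rw [inv_mul_eq_div, le_div_iff₀ hv0, mul_comm]
      exact h.min_mul_norm_sq_le hf
    calc ‖u‖ ^ (p + 1) = (‖u‖ ^ 2) ^ ((p + 1) / 2) := by
          rw [← Real.rpow_natCast, ← Real.rpow_mul (norm_nonneg _)]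
          congr 1; push_cast; ring
      _ ≤ _ := Real.rpow_le_rpow (by positivity) h2 (by linarith)
  have h3 : quadForm V u ≤ D * quadForm V u ^ ((p + 1) / 2) := by
    calc quadForm V u = powForm K p u := hQP
      _ ≤ k₁ * ∫ x, |sobVal u x| ^ (p + 1) := h.powForm_le u
      _ ≤ k₁ * (C * ((v⁻¹) ^ ((p + 1) / 2) * quadForm V u ^ ((p + 1) / 2))) := by
          gcongr
          exact (hC u).trans (by gcongr)
      _ = _ := by rw [hD]; ring
  have h4 : D⁻¹ ≤ quadForm V u ^ ((p - 1) / 2) := by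
    have e : (p + 1) / 2 = 1 + (p - 1) / 2 := by ring
    rw [e, Real.rpow_add hQ, Real.rpow_one] at h3
    rw [inv_le_iff_one_le_mul₀ hD0]
    have : quadForm V u * 1 ≤ quadForm V u * (quadForm V u ^ ((p - 1) / 2) * D) := by linarith
    exact le_of_mul_le_mul_left this hQ
  calc (D⁻¹) ^ (2 / (p - 1)) ≤ (quadForm V u ^ ((p - 1) / 2)) ^ (2 / (p - 1)) :=
        Real.rpow_le_rpow (by positivity) h4 (div_nonneg two_pos.le (by linarith))
    _ = quadForm V u := by
        rw [← Real.rpow_mul hQ.le]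
        have : (p - 1) / 2 * (2 / (p - 1)) = 1 := by
          have : p - 1 ≠ 0 := by linarith
          field_simp
        rw [this, Real.rpow_one]

theorem nehariLevel_pos (hne : (nehari V K p).Nonempty) : 0 < nehariLevel V K p := by
  obtain ⟨c, hc0, hc⟩ := h.exists_pos_le_quadForm
  refine lt_of_lt_of_le (mul_pos (nehariConst_pos h.one_lt) hc0)
    (h.le_nehariLevel hne fun u hu => ?_)
  have := (nehariConst_pos h.one_lt).le
  gcongr
  exact hc u hu

end Admissible

end Nehari

/-! ### Minimizers are solutions -/

section EulerLagrange

variable {N : ℕ}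

theorem FinitePotential.integrable_mul {V : RN N → ℝ} {u v : SobolevH1 N}
    (hu : FinitePotential V u) (hv : FinitePotential V v) :
    Integrable (fun x => V x * sobVal u x * sobVal v x) := by
  -- `V` itself need not be measurable where `u` vanishes, hence the quotient.
  have e : ∀ x, V x * sobVal u x * sobVal v x
      = V x * sobVal u x ^ 2 * (sobVal v x / sobVal u x) := by
    intro x
    by_cases h0 : sobVal u x = 0
    · simp [h0]
    · field_simp
  refine ((hu.norm.add hv.norm)).mono' ?_ (Eventually.of_forall fun x => ?_)
  · simp_rw [e]
    exact hu.1.mul ((measurable_sobVal v).div (measurable_sobVal u)).aestronglyMeasurable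
  · simp only [Pi.add_apply, norm_mul, norm_pow, Real.norm_eq_abs, mul_assoc, ← mul_add]
    gcongr
    nlinarith [sq_nonneg (|sobVal u x| - |sobVal v x|), abs_nonneg (sobVal u x),
      abs_nonneg (sobVal v x)]

theorem FinitePotential.congr_ae {V : RN N → ℝ} {u : SobolevH1 N} {f : RN N → ℝ}
    (h : sobVal u =ᵐ[volume] f) : FinitePotential V u ↔ Integrable (fun x => V x * f x ^ 2) := by
  unfold FinitePotential
  refine integrable_congr ?_
  filter_upwards [h] with x hx
  rw [hx]

theorem sobVal_add_smul (u v : SobolevH1 N) (t : ℝ) :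
    sobVal (u + t • v) =ᵐ[volume] fun x => sobVal u x + t * sobVal v x := by
  filter_upwards [sobVal_add u (t • v), sobVal_smul t v] with x h1 h2
  rw [h1, h2]

theorem sobGrad_add_smul (u v : SobolevH1 N) (t : ℝ) :
    sobGrad (u + t • v) =ᵐ[volume] fun x => sobGrad u x + t • sobGrad v x := by
  filter_upwards [sobGrad_add u (t • v), sobGrad_smul t v] with x h1 h2
  rw [h1, h2]

theorem FinitePotential.add_smul {V : RN N → ℝ} {u v : SobolevH1 N}
    (hu : FinitePotential V u) (hv : FinitePotential V v) (t : ℝ) :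
    FinitePotential V (u + t • v) := by
  have hu' : Integrable (fun x => V x * sobVal u x ^ 2) := hu
  have hv' : Integrable (fun x => V x * sobVal v x ^ 2) := hv
  have h1 : Integrable (fun x => V x * sobVal u x ^ 2
      + 2 * t * (V x * sobVal u x * sobVal v x) + t ^ 2 * (V x * sobVal v x ^ 2)) :=
    (hu'.add ((hu.integrable_mul hv).const_mul (2 * t))).add (hv'.const_mul (t ^ 2))
  refine (FinitePotential.congr_ae (sobVal_add_smul u v t)).2
    (h1.congr (Eventually.of_forall fun x => ?_))
  simp only
  ring

theorem quadForm_add_smul {V : RN N → ℝ} {u v : SobolevH1 N}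
    (hu : FinitePotential V u) (hv : FinitePotential V v) (t : ℝ) :
    quadForm V (u + t • v) = quadForm V u
      + 2 * t * (∫ x, (inner ℝ (sobGrad u x) (sobGrad v x) + V x * sobVal u x * sobVal v x))
      + t ^ 2 * quadForm V v := by
  have i1 : Integrable (fun x => ‖sobGrad u x‖ ^ 2 + V x * sobVal u x ^ 2) :=
    (integrable_norm_sobGrad_sq u).add hu
  have i2 : Integrable (fun x => ‖sobGrad v x‖ ^ 2 + V x * sobVal v x ^ 2) :=
    (integrable_norm_sobGrad_sq v).add hv
  have i3 : Integrable (fun x => inner ℝ (sobGrad u x) (sobGrad v x)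
      + V x * sobVal u x * sobVal v x) := (integrable_inner_sobGrad u v).add (hu.integrable_mul hv)
  have i4 : Integrable (fun x => ‖sobGrad u x‖ ^ 2 + V x * sobVal u x ^ 2
      + 2 * t * (inner ℝ (sobGrad u x) (sobGrad v x) + V x * sobVal u x * sobVal v x)) :=
    i1.add (i3.const_mul _)
  have e : quadForm V (u + t • v) = ∫ x, (‖sobGrad u x‖ ^ 2 + V x * sobVal u x ^ 2
      + 2 * t * (inner ℝ (sobGrad u x) (sobGrad v x) + V x * sobVal u x * sobVal v x)
      + t ^ 2 * (‖sobGrad v x‖ ^ 2 + V x * sobVal v x ^ 2)) := by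
    refine integral_congr_ae ?_
    filter_upwards [sobVal_add_smul u v t, sobGrad_add_smul u v t] with x h1 h2
    rw [h1, h2, norm_add_sq_real, norm_smul, inner_smul_right, mul_pow, Real.norm_eq_abs, sq_abs]
    ring
  rw [e, integral_add i4 (i2.const_mul _), integral_add i1 (i3.const_mul _), integral_const_mul,
    integral_const_mul]
  rfl

theorem hasDerivAt_quadForm {V : RN N → ℝ} {u v : SobolevH1 N}
    (hu : FinitePotential V u) (hv : FinitePotential V v) :
    HasDerivAt (fun t : ℝ => quadForm V (u + t • v))
      (2 * ∫ x, (inner ℝ (sobGrad u x) (sobGrad v x) + V x * sobVal u x * sobVal v x)) 0 := by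
  set B := ∫ x, (inner ℝ (sobGrad u x) (sobGrad v x) + V x * sobVal u x * sobVal v x) with hB
  have e : (fun t : ℝ => quadForm V (u + t • v))
      = fun t => quadForm V u + t * (2 * B) + t ^ 2 * quadForm V v := by
    ext t
    rw [quadForm_add_smul hu hv t]
    ring
  have h1 := (((hasDerivAt_id (0 : ℝ)).mul_const (2 * B)).const_add (quadForm V u)).add
    ((hasDerivAt_pow 2 (0 : ℝ)).mul_const (quadForm V v))
  rw [e]
  refine h1.congr_deriv ?_
  simp

theorem add_rpow_le_two_rpow_mul {a b r : ℝ} (ha : 0 ≤ a) (hb : 0 ≤ b) (hr : 0 ≤ r) :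
    (a + b) ^ r ≤ 2 ^ r * (a ^ r + b ^ r) := by
  have h1 : a ^ r ≤ a ^ r + b ^ r := le_add_of_nonneg_right (by positivity)
  have h2 : b ^ r ≤ a ^ r + b ^ r := le_add_of_nonneg_left (by positivity)
  rcases le_total a b with h | h
  · calc (a + b) ^ r ≤ (2 * b) ^ r := Real.rpow_le_rpow (by positivity) (by linarith) hr
      _ = 2 ^ r * b ^ r := Real.mul_rpow (by norm_num) hb
      _ ≤ _ := by gcongr
  · calc (a + b) ^ r ≤ (2 * a) ^ r := Real.rpow_le_rpow (by positivity) (by linarith) hr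
      _ = 2 ^ r * a ^ r := Real.mul_rpow (by norm_num) ha
      _ ≤ _ := by gcongr

/-- If `f^(p+1) - μ^(p-1) g²` is minimal at `0`, with value zero since `f 0 = g 0 = μ`, then the
derivatives satisfy `f' 0 / 2 = g' 0 / (p + 1)`. -/
theorem eq_of_hasDerivAt_of_rpow_mul_le {p μ B L : ℝ} {f g : ℝ → ℝ} (hp : 1 < p) (hμ : 0 < μ)
    (hf0 : f 0 = μ) (hg0 : g 0 = μ) (hf : HasDerivAt f (2 * B) 0)
    (hg : HasDerivAt g ((p + 1) * L) 0) (hle : ∀ t, μ ^ (p - 1) * g t ^ 2 ≤ f t ^ (p + 1)) :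
    B = L := by
  have hd : HasDerivAt (fun t => f t ^ (p + 1) - μ ^ (p - 1) * g t ^ 2)
      (2 * B * (p + 1) * μ ^ (p + 1 - 1) - μ ^ (p - 1) * ((2 : ℕ) * μ ^ (2 - 1) * ((p + 1) * L)))
      0 := by
    have h1 := hf.rpow_const (p := p + 1) (Or.inr (by linarith))
    have h2 := (hg.pow 2).const_mul (μ ^ (p - 1))
    rw [hf0] at h1
    rw [hg0] at h2
    exact h1.sub h2
  have hmin : IsLocalMin (fun t => f t ^ (p + 1) - μ ^ (p - 1) * g t ^ 2) 0 := by
    refine Eventually.of_forall fun t => ?_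
    simp only
    rw [hf0, hg0, show p + 1 = (p - 1) + 2 by ring, Real.rpow_add hμ, Real.rpow_two, sub_self,
      sub_nonneg, show p - 1 + 2 = p + 1 by ring]
    exact hle t
  have h3 := hmin.hasDerivAt_eq_zero hd
  have h4 : μ ^ (p - 1) * μ = μ ^ (p + 1 - 1) := by
    rw [show p + 1 - 1 = (p - 1) + 1 by ring, Real.rpow_add hμ (p - 1) 1, Real.rpow_one]
  have h5 : 2 * (p + 1) * μ ^ (p + 1 - 1) * (B - L) = 0 := by
    rw [← h3, ← h4]
    push_cast
    ring
  have h6 : 2 * (p + 1) * μ ^ (p + 1 - 1) ≠ 0 := by positivity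
  exact sub_eq_zero.1 ((mul_eq_zero.1 h5).resolve_left h6)

namespace Admissible

variable {V K : RN N → ℝ} {p v₀ k₀ k₁ : ℝ} (h : Admissible V K p v₀ k₀ k₁)

include h

theorem hasDerivAt_powForm (u v : SobolevH1 N) :
    HasDerivAt (fun t : ℝ => powForm K p (u + t • v))
      ((p + 1) * ∫ x, K x * |sobVal u x| ^ (p - 1) * sobVal u x * sobVal v x) 0 := by
  have hp := h.one_lt
  have hk₁ : 0 ≤ k₁ := by
    obtain ⟨x, hx⟩ := h.abs_K_le.exists
    exact (abs_nonneg _).trans hx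
  have hmu := measurable_sobVal u
  have hmv := measurable_sobVal v
  have e1 : (fun t : ℝ => powForm K p (u + t • v))
      = fun t => ∫ x, K x * |sobVal u x + t * sobVal v x| ^ (p + 1) := by
    ext t
    refine integral_congr_ae ?_
    filter_upwards [sobVal_add_smul u v t] with x hx
    rw [hx]
  rw [e1]
  have main := hasDerivAt_integral_of_dominated_loc_of_deriv_le (μ := (volume : Measure (RN N)))
    (F := fun t x => K x * |sobVal u x + t * sobVal v x| ^ (p + 1))
    (F' := fun t x => K x * ((p + 1) * |sobVal u x + t * sobVal v x| ^ (p + 1 - 2)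
      * (sobVal u x + t * sobVal v x) * sobVal v x)) (x₀ := (0 : ℝ))
    (bound := fun x => k₁ * ((p + 1) * (2 ^ (p + 1) *
      (|sobVal u x| ^ (p + 1) + |sobVal v x| ^ (p + 1)))))
    (s := Metric.ball 0 1) (Metric.ball_mem_nhds _ one_pos) ?_ ?_ ?_ ?_ ?_ ?_
  · refine main.2.congr_deriv ?_
    rw [← integral_const_mul]
    refine integral_congr_ae (Eventually.of_forall fun x => ?_)
    simp only [zero_mul, add_zero]
    have : p + 1 - 2 = p - 1 := by ring
    rw [this]
    ring
  · exact Eventually.of_forall fun t => h.K_meas.mul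
      ((hmu.add (hmv.const_mul t)).abs.pow_const _).aestronglyMeasurable
  · simpa using h.integrable_mul_rpow u
  · refine h.K_meas.mul (Measurable.aestronglyMeasurable ?_)
    have hs : Measurable fun x => sobVal u x + 0 * sobVal v x := hmu.add (hmv.const_mul 0)
    exact (((hs.abs.pow_const _).const_mul _).mul hs).mul hmv
  · filter_upwards [h.abs_K_le] with x hx t ht
    have ht' : |t| ≤ 1 := by simpa [Real.dist_eq] using (Metric.mem_ball.1 ht).le
    rw [norm_mul, Real.norm_eq_abs, Real.norm_eq_abs]
    gcongr
    set s := sobVal u x + t * sobVal v x with hs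
    have hsab : |s| ≤ |sobVal u x| + |sobVal v x| := by
      refine (abs_add_le _ _).trans ?_
      rw [abs_mul]
      gcongr
      exact mul_le_of_le_one_left (abs_nonneg _) ht'
    have hvle : |sobVal v x| ≤ |sobVal u x| + |sobVal v x| :=
      le_add_of_nonneg_left (abs_nonneg _)
    rw [mul_assoc, mul_assoc, abs_mul, abs_of_pos (by linarith : 0 < p + 1)]
    gcongr
    refine le_trans ?_ (add_rpow_le_two_rpow_mul (abs_nonneg _) (abs_nonneg _) (by linarith))
    rw [abs_mul, abs_mul, abs_of_nonneg (by positivity : 0 ≤ |s| ^ (p + 1 - 2))]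
    set A := |sobVal u x| + |sobVal v x|
    have hA : 0 ≤ A := by positivity
    calc |s| ^ (p + 1 - 2) * (|s| * |sobVal v x|) ≤ A ^ (p + 1 - 2) * (A * A) := by
          have h1 : |s| ^ (p + 1 - 2) ≤ A ^ (p + 1 - 2) :=
            Real.rpow_le_rpow (abs_nonneg _) hsab (by linarith)
          gcongr
      _ = A ^ (p + 1) := by
          have := abs_rpow_sub_one_mul_mul hp A
          rw [abs_of_nonneg hA] at this
          rw [← this, show p + 1 - 2 = p - 1 by ring]
          ring
  · exact (((((h.integrable_rpow u).add (h.integrable_rpow v)).const_mul _).const_mul _).const_mul _)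
  · refine Eventually.of_forall fun x t _ => ?_
    have h1 : HasDerivAt (fun t : ℝ => sobVal u x + t * sobVal v x) (sobVal v x) t := by
      simpa using ((hasDerivAt_id t).mul_const (sobVal v x)).const_add (sobVal u x)
    exact ((hasDerivAt_abs_rpow _ (by linarith)).comp t h1).const_mul (K x)

/-- A minimizer on the Nehari manifold is a critical point: it minimizes the difference of the two
sides of the homogeneous inequality `level_rpow_mul_le`, on the whole domain. -/
theorem isSolution_of_energy_eq {u : SobolevH1 N} (hu : u ∈ nehari V K p)
    (hE : energy V K p u = nehariLevel V K p) : IsSolution V K p u := by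
  obtain ⟨hu0, hf, hQP⟩ := h.mem_nehari_iff.1 hu
  refine ⟨hf, fun v hv => ?_⟩
  have hz : u + (0 : ℝ) • v = u := by rw [zero_smul ℝ v, add_zero]
  have hlev : nehariLevel V K p / nehariConst p = quadForm V u := by
    rw [← hE, h.energy_of_mem hu, mul_div_cancel_left₀ _ (nehariConst_pos h.one_lt).ne']
  refine sub_eq_zero.2 (eq_of_hasDerivAt_of_rpow_mul_le h.one_lt (h.quadForm_pos hu0 hf)
    (congrArg _ hz) ((congrArg _ hz).trans hQP.symm) (hasDerivAt_quadForm hf hv)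
    (h.hasDerivAt_powForm u v) fun t => ?_)
  rw [← hlev]
  exact h.level_rpow_mul_le (hf.add_smul hv t)

end Admissible

end EulerLagrange

/-! ### Existence below the level at infinity -/

section Existence

variable {N : ℕ}

theorem finitePotential_const (c : ℝ) (u : SobolevH1 N) : FinitePotential (fun _ => c) u :=
  (integrable_sobVal_sq u).const_mul c

theorem tendsto_inner_sub_zero {w : ℕ → SobolevH1 N} {u : SobolevH1 N}
    (h : ∀ y : WithLp 2 (Lp ℝ 2 (volume : Measure (RN N)) × Lp (RN N) 2
      (volume : Measure (RN N))), Tendsto (fun n => inner ℝ (w n).1 y) atTop (𝓝 (inner ℝ u.1 y)))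
    (y : WithLp 2 (Lp ℝ 2 (volume : Measure (RN N)) × Lp (RN N) 2 (volume : Measure (RN N)))) :
    Tendsto (fun n => inner ℝ (w n - u).1 y) atTop (𝓝 0) := by
  have h1 := (h y).sub_const (inner ℝ u.1 y)
  rw [sub_self] at h1
  refine h1.congr fun n => ?_
  rw [← inner_sub_left]
  rfl

/-- The bilinear form of `-Δ + c` is weakly continuous in one argument. -/
theorem tendsto_bilin_zero {w : ℕ → SobolevH1 N}
    (h : ∀ y : WithLp 2 (Lp ℝ 2 (volume : Measure (RN N)) × Lp (RN N) 2
      (volume : Measure (RN N))), Tendsto (fun n => inner ℝ (w n).1 y) atTop (𝓝 0))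
    (c : ℝ) (u : SobolevH1 N) :
    Tendsto (fun n => ∫ x, (inner ℝ (sobGrad u x) (sobGrad (w n) x)
      + c * sobVal u x * sobVal (w n) x)) atTop (𝓝 0) := by
  refine (h (WithLp.toLp 2 (c • u.1.fst, u.1.snd))).congr fun n => ?_
  have i1 : Integrable (fun x => c * sobVal u x * sobVal (w n) x) := by
    simp_rw [mul_assoc]
    exact (integrable_sobVal_mul u (w n)).const_mul c
  rw [integral_add (integrable_inner_sobGrad u (w n)) i1, WithLp.prod_inner_apply, add_comm]
  congr 1
  · rw [L2.inner_def]
    refine integral_congr_ae (Eventually.of_forall fun x => ?_)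
    exact real_inner_comm _ _
  · simp only [inner_smul_right]
    rw [L2.inner_def, ← integral_const_mul]
    refine integral_congr_ae (Eventually.of_forall fun x => ?_)
    simp [sobVal, mul_assoc]

/-- Fatou's lemma for real integrals bounded by a convergent sequence. -/
theorem integrable_of_tendsto_of_integral_le {f : ℕ → RN N → ℝ} {g : RN N → ℝ}
    {c : ℕ → ℝ} {C : ℝ} (hf : ∀ n, Integrable (f n)) (hf0 : ∀ n, 0 ≤ᵐ[volume] f n)
    (hfg : ∀ᵐ x, Tendsto (fun n => f n x) atTop (𝓝 (g x)))
    (hc : ∀ n, ∫ x, f n x ≤ c n) (hcC : Tendsto c atTop (𝓝 C)) :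
    Integrable g ∧ ∫ x, g x ≤ C := by
  have hC0 : 0 ≤ C := ge_of_tendsto hcC (Eventually.of_forall fun n =>
    (integral_nonneg_of_ae (hf0 n)).trans (hc n))
  have hgm : AEStronglyMeasurable g volume :=
    aestronglyMeasurable_of_tendsto_ae atTop (fun n => (hf n).1) hfg
  have hg0 : 0 ≤ᵐ[volume] g := by
    filter_upwards [hfg, ae_all_iff.2 hf0] with x hx hx0
    exact ge_of_tendsto hx (Eventually.of_forall hx0)
  have key : ∫⁻ x, ENNReal.ofReal (g x) ≤ ENNReal.ofReal C := by
    calc ∫⁻ x, ENNReal.ofReal (g x)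
        = ∫⁻ x, liminf (fun n => ENNReal.ofReal (f n x)) atTop := by
          refine lintegral_congr_ae ?_
          filter_upwards [hfg] with x hx
          exact (ENNReal.tendsto_ofReal hx).liminf_eq.symm
      _ ≤ liminf (fun n => ∫⁻ x, ENNReal.ofReal (f n x)) atTop :=
          lintegral_liminf_le' fun n => (hf n).1.aemeasurable.ennreal_ofReal
      _ ≤ liminf (fun n => ENNReal.ofReal (c n)) atTop := by
          refine liminf_le_liminf (Eventually.of_forall fun n => ?_)
          rw [← ofReal_integral_eq_lintegral_ofReal (hf n) (hf0 n)]
          exact ENNReal.ofReal_le_ofReal (hc n)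
      _ = ENNReal.ofReal C := (ENNReal.tendsto_ofReal hcC).liminf_eq
  have hgi : Integrable g :=
    ⟨hgm, (hasFiniteIntegral_iff_ofReal hg0).2 (key.trans_lt ENNReal.ofReal_lt_top)⟩
  refine ⟨hgi, ?_⟩
  rw [← ofReal_integral_eq_lintegral_ofReal hgi hg0] at key
  exact (ENNReal.ofReal_le_ofReal_iff hC0).1 key

/-- The splitting of mass between the weak limit (`q`, `s`) and the remainder (`R`, `μ - s`): at a
level `μ` below the level `μ'` at infinity, nothing escapes. -/
theorem no_escape {p μ μ' q s R : ℝ} (hp : 1 < p) (hμμ' : μ < μ') (hq : 0 ≤ q)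
    (hs : 0 ≤ s) (hsμ : s ≤ μ) (hR : 0 ≤ R) (hle : q + R ≤ μ)
    (h1 : μ ^ (p - 1) * s ^ 2 ≤ q ^ (p + 1)) (h2 : μ' ^ (p - 1) * (μ - s) ^ 2 ≤ R ^ (p + 1)) :
    q = μ ∧ s = μ := by
  have hsplit : ∀ t : ℝ, 0 ≤ t → t ^ (p + 1) = t ^ (p - 1) * t ^ 2 := by
    intro t ht
    rw [show p + 1 = (p - 1) + 2 by ring, Real.rpow_add_of_nonneg ht (by linarith) (by norm_num),
      Real.rpow_two]
  have hqs : s ≤ q := by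
    rw [← Real.rpow_le_rpow_iff hs hq (by linarith : 0 < p + 1), hsplit s hs]
    refine le_trans ?_ h1
    have : s ^ (p - 1) ≤ μ ^ (p - 1) := Real.rpow_le_rpow hs hsμ (by linarith)
    gcongr
  have hseq : s = μ := by
    by_contra hne
    have hlt : 0 < μ - s := sub_pos.2 (lt_of_le_of_ne hsμ hne)
    have : μ - s < R := by
      rw [← Real.rpow_lt_rpow_iff hlt.le hR (by linarith : 0 < p + 1), hsplit _ hlt.le]
      refine lt_of_lt_of_le ?_ h2
      have : (μ - s) ^ (p - 1) < μ' ^ (p - 1) :=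
        Real.rpow_lt_rpow hlt.le (by linarith) (by linarith)
      gcongr
    linarith
  exact ⟨by linarith, hseq⟩

/-- A bounded sequence in `H¹` converges, along a subsequence, weakly, in `L²` on balls and almost
everywhere. -/
theorem exists_subseq_splitting (hN : 0 < N) {U : ℕ → SobolevH1 N} {M₀ : ℝ}
    (hU : ∀ n, ‖U n‖ ≤ M₀) :
    ∃ (u : SobolevH1 N) (w : ℕ → SobolevH1 N) (ρ : ℕ → ℕ) (M : ℝ), StrictMono ρ ∧
      (∀ n, U (ρ n) = u + w n) ∧ (∀ n, ‖w n‖ ≤ M) ∧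
      (∀ y : WithLp 2 (Lp ℝ 2 (volume : Measure (RN N)) × Lp (RN N) 2
        (volume : Measure (RN N))), Tendsto (fun n => inner ℝ (w n).1 y) atTop (𝓝 0)) ∧
      (∀ R : ℝ, Tendsto (fun n => ∫ x in Metric.ball (0 : RN N) R, sobVal (w n) x ^ 2)
        atTop (𝓝 0)) ∧
      ∀ᵐ x, Tendsto (fun n => sobVal (w n) x) atTop (𝓝 0) := by
  obtain ⟨u, σ, hσ, hweak⟩ := sobolev_exists_weak_subseq U _ hU
  have hweak0 := tendsto_inner_sub_zero hweak
  have hWb : ∀ n, ‖U (σ n) - u‖ ≤ M₀ + ‖u‖ := fun n =>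
    (norm_sub_le _ _).trans (add_le_add_left (hU _) _)
  have hloc0 := tendsto_setIntegral_ball_sobVal_sq hN hWb hweak0
  obtain ⟨τ, hτ, hae⟩ := exists_subseq_ae_tendsto_zero hWb hloc0
  exact ⟨u, fun n => U (σ (τ n)) - u, σ ∘ τ, M₀ + ‖u‖, hσ.comp hτ,
    fun n => (add_sub_cancel _ _).symm, fun n => hWb (τ n),
    fun y => (hweak0 y).comp hτ.tendsto_atTop, fun R => (hloc0 R).comp hτ.tendsto_atTop, hae⟩

/-- Splitting of the superquadratic part along a sequence `u + w n`, by the Brezis–Lieb lemma. -/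
theorem tendsto_powForm_remainder {V K : RN N → ℝ} {p v₀ k₀ k₁ μ M : ℝ}
    (h : Admissible V K p v₀ k₀ k₁) {u : SobolevH1 N} {un w : ℕ → SobolevH1 N}
    (hunw : ∀ n, un n = u + w n) (hwb : ∀ n, ‖w n‖ ≤ M)
    (hwae : ∀ᵐ x, Tendsto (fun n => sobVal (w n) x) atTop (𝓝 0))
    (hun : Tendsto (fun n => powForm K p (un n)) atTop (𝓝 μ)) :
    Tendsto (fun n => powForm K p (w n)) atTop (𝓝 (μ - powForm K p u)) := by
  have hp := h.one_lt
  obtain ⟨C, hC0, hC⟩ := h.sobolev.integral_le (by linarith)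
  have hBL := tendsto_integral_brezis_lieb (μ := (volume : Measure (RN N))) (r := p + 1)
    (by linarith) (K := K) (u := sobVal u) (w := fun n => sobVal (w n)) (C₀ := C * M ^ (p + 1))
    h.abs_K_le (measurable_sobVal u) (fun n => measurable_sobVal (w n)) (h.integrable_rpow u)
    (fun n => h.integrable_rpow (w n)) (fun n => (hC (w n)).trans (by gcongr; exact hwb n)) hwae
  have hsplit : ∀ n, ∫ x, K x * (|sobVal (w n) x + sobVal u x| ^ (p + 1)
      - |sobVal (w n) x| ^ (p + 1) - |sobVal u x| ^ (p + 1))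
      = powForm K p (un n) - powForm K p (w n) - powForm K p u := by
    intro n
    have i1 : Integrable (fun x => K x * |sobVal (un n) x| ^ (p + 1)
        - K x * |sobVal (w n) x| ^ (p + 1)) :=
      (h.integrable_mul_rpow _).sub (h.integrable_mul_rpow _)
    unfold powForm
    rw [← integral_sub (h.integrable_mul_rpow _) (h.integrable_mul_rpow _), ← integral_sub i1
      (h.integrable_mul_rpow _)]
    refine integral_congr_ae ?_
    rw [hunw n]
    filter_upwards [sobVal_add u (w n)] with x hx
    rw [hx, add_comm (sobVal u x)]
    ring
  simp_rw [hsplit] at hBL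
  have h1 := (hun.sub_const (powForm K p u)).sub hBL
  rw [sub_zero] at h1
  exact h1.congr fun n => by ring

/-- Fatou's lemma for the excess potential `V - V'`: the weak limit and the remainder share the
quadratic form. Here `V'` is the potential at infinity, and `R` bounds the remainder below. -/
theorem finitePotential_and_quadForm_le {V V' : RN N → ℝ} {μ R : ℝ} {u : SobolevH1 N}
    {un w : ℕ → SobolevH1 N} {ρ : ℕ → ℝ} (hunw : ∀ n, un n = u + w n)
    (hV' : ∀ v : SobolevH1 N, FinitePotential V' v) (hVV' : ∀ᵐ x, V' x ≤ V x)
    (hunf : ∀ n, FinitePotential V (un n))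
    (hwae : ∀ᵐ x, Tendsto (fun n => sobVal (w n) x) atTop (𝓝 0))
    (hunQ : Tendsto (fun n => quadForm V (un n)) atTop (𝓝 μ))
    (hcross : Tendsto (fun n => ∫ x, (inner ℝ (sobGrad u x) (sobGrad (w n) x)
      + V' x * sobVal u x * sobVal (w n) x)) atTop (𝓝 0))
    (hρ : Tendsto ρ atTop (𝓝 R)) (hρle : ∀ n, ρ n ≤ quadForm V' (w n)) :
    FinitePotential V u ∧ quadForm V u + R ≤ μ := by
  have hD : ∀ v : SobolevH1 N, FinitePotential V v →
      Integrable (fun x => (V x - V' x) * sobVal v x ^ 2) := by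
    intro v hv
    refine (Integrable.sub hv (hV' v)).congr (Eventually.of_forall fun x => ?_)
    simp only [Pi.sub_apply]
    ring
  have hDQ : ∀ v : SobolevH1 N, FinitePotential V v →
      ∫ x, (V x - V' x) * sobVal v x ^ 2 = quadForm V v - quadForm V' v := by
    intro v hv
    rw [quadForm_eq_add hv, quadForm_eq_add (hV' v), add_sub_add_left_eq_sub,
      ← integral_sub hv (hV' v)]
    refine integral_congr_ae (Eventually.of_forall fun x => ?_)
    simp only
    ring
  have hQinf : ∀ n, quadForm V' (un n) = quadForm V' u
      + 2 * (∫ x, (inner ℝ (sobGrad u x) (sobGrad (w n) x)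
      + V' x * sobVal u x * sobVal (w n) x)) + quadForm V' (w n) := by
    intro n
    have h1 := quadForm_add_smul (hV' u) (hV' (w n)) 1
    rw [one_smul ℝ (w n), ← hunw n] at h1
    rw [h1]
    ring
  obtain ⟨hDu, hDle⟩ := integrable_of_tendsto_of_integral_le
    (f := fun n x => (V x - V' x) * sobVal (un n) x ^ 2)
    (g := fun x => (V x - V' x) * sobVal u x ^ 2)
    (C := μ - quadForm V' u - 2 * 0 - R)
    (fun n => hD _ (hunf n))
    (fun n => by
      filter_upwards [hVV'] with x hx
      exact mul_nonneg (sub_nonneg.2 hx) (sq_nonneg _))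
    (by
      have hval : ∀ᵐ x, ∀ n, sobVal (un n) x = sobVal u x + sobVal (w n) x := by
        rw [ae_all_iff]
        intro n
        rw [hunw n]
        exact sobVal_add u (w n)
      filter_upwards [hval, hwae] with x hx hx'
      have h1 : Tendsto (fun n => sobVal (un n) x) atTop (𝓝 (sobVal u x)) := by
        have := hx'.const_add (sobVal u x)
        rw [add_zero] at this
        exact this.congr fun n => (hx n).symm
      exact (h1.pow 2).const_mul _)
    (fun n => by
      rw [hDQ _ (hunf n), hQinf n]
      linarith [hρle n] : ∀ n, _ ≤ quadForm V (un n) - quadForm V' u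
        - 2 * (∫ x, (inner ℝ (sobGrad u x) (sobGrad (w n) x)
          + V' x * sobVal u x * sobVal (w n) x)) - ρ n)
    (((hunQ.sub_const _).sub (hcross.const_mul 2)).sub hρ)
  have huf : FinitePotential V u := by
    refine (hDu.add (hV' u)).congr (Eventually.of_forall fun x => ?_)
    simp only [Pi.add_apply]
    ring
  rw [hDQ u huf] at hDle
  exact ⟨huf, by linarith⟩

theorem Admissible.mem_nehari_of_quadForm_eq {V K : RN N → ℝ} {p v₀ k₀ k₁ μ : ℝ}
    (h : Admissible V K p v₀ k₀ k₁) {u : SobolevH1 N} (hf : FinitePotential V u) (hμ : 0 < μ)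
    (hQ : quadForm V u = μ) (hP : powForm K p u = μ) : u ∈ nehari V K p := by
  have hp := h.one_lt
  refine h.mem_nehari_iff.2 ⟨fun h0 => ?_, hf, hQ.trans hP.symm⟩
  have : powForm K p u = 0 := by
    refine integral_eq_zero_of_ae ?_
    filter_upwards [sobVal_ae_zero_iff.2 h0] with x hx
    simp [hx, Real.zero_rpow (by linarith : p + 1 ≠ 0)]
  rw [this] at hP
  exact hμ.ne hP

/-- The Nehari level is achieved if it lies strictly below the level of the problem at infinity. -/
theorem exists_minimizer_of_lt {V K V' K' : RN N → ℝ} {p v₀ k₀ k₁ vinf k₀' k₁' q B : ℝ}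
    (hN : 0 < N) (h : Admissible V K p v₀ k₀ k₁) (hinf : Admissible V' K' p vinf k₀' k₁')
    (hV' : V' = fun _ => vinf) (hq : p + 1 < q) (hbq : SobolevBound N q)
    (hVV' : ∀ᵐ x, V' x ≤ V x) (hKB : ∀ᵐ x, |K x - K' x| ≤ B)
    (hK : VanishesAtInfinity fun x => K x - K' x)
    (hne : (nehari V K p).Nonempty) (hlt : nehariLevel V K p < nehariLevel V' K' p) :
    ∃ u ∈ nehari V K p, energy V K p u = nehariLevel V K p := by
  have hp := h.one_lt
  have hc := nehariConst_pos hp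
  have hV'f : ∀ v : SobolevH1 N, FinitePotential V' v := fun v => hV' ▸ finitePotential_const _ v
  obtain ⟨μ, hμ⟩ : ∃ μ, μ = nehariLevel V K p / nehariConst p := ⟨_, rfl⟩
  obtain ⟨μ', hμ'⟩ : ∃ μ', μ' = nehariLevel V' K' p / nehariConst p := ⟨_, rfl⟩
  have hμ0 : 0 < μ := hμ ▸ div_pos (h.nehariLevel_pos hne) hc
  have hμμ' : μ < μ' := by rw [hμ, hμ']; gcongr
  have hμ'0 : 0 < μ' := hμ0.trans hμμ'
  obtain ⟨e, -, he, hemem⟩ := exists_seq_tendsto_sInf (hne.image (energy V K p)) h.bddBelow_energy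
  choose U hU hUe using hemem
  have hUQ : Tendsto (fun n => quadForm V (U n)) atTop (𝓝 μ) := by
    rw [hμ]
    refine (he.div_const (nehariConst p)).congr fun n => ?_
    rw [← hUe, h.energy_of_mem (hU n), mul_div_cancel_left₀ _ hc.ne']
  -- `μ` and `μ'` are the infima of the quadratic form on the two Nehari manifolds. A minimizing
  -- sequence is bounded, hence splits into its weak limit `u` and remainders `w n`.
  obtain ⟨M₁, hM₁⟩ := hUQ.bddAbove_range
  have hv : 0 < min 1 v₀ := lt_min one_pos h.v₀_pos
  have hUb : ∀ n, ‖U n‖ ≤ √(M₁ / min 1 v₀) := fun n => by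
    refine Real.le_sqrt_of_sq_le ?_
    rw [le_div_iff₀ hv, mul_comm]
    exact (h.min_mul_norm_sq_le (h.mem_nehari_iff.1 (hU n)).2.1).trans (hM₁ ⟨n, rfl⟩)
  obtain ⟨u, w, ρ, M, hρ, hUw, hwb, hwweak, hwloc, hwae⟩ := exists_subseq_splitting hN hUb
  have hmem : ∀ n, quadForm V (U (ρ n)) = powForm K p (U (ρ n)) := fun n =>
    (h.mem_nehari_iff.1 (hU (ρ n))).2.2
  have hunQ : Tendsto (fun n => quadForm V (U (ρ n))) atTop (𝓝 μ) := hUQ.comp hρ.tendsto_atTop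
  have hPw := tendsto_powForm_remainder h hUw hwb hwae (hunQ.congr hmem)
  obtain ⟨s, hs⟩ : ∃ s, s = powForm K p u := ⟨_, rfl⟩
  rw [← hs] at hPw
  have hs0 : 0 ≤ s := hs ▸ h.powForm_nonneg u
  have hsμ : s ≤ μ := sub_nonneg.1
    (ge_of_tendsto hPw (Eventually.of_forall fun n => h.powForm_nonneg (w n)))
  -- On the remainders `K` may be replaced by `K'`, which coincides with it at infinity.
  have hPw' : Tendsto (fun n => powForm K' p (w n)) atTop (𝓝 (μ - s)) := by
    have h1 := tendsto_integral_vanishing_weight (by linarith : 2 < p + 1) hq h.sobolev hbq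
      hKB hK hwb hwloc
    have h2 := hPw.sub h1
    rw [sub_zero] at h2
    refine h2.congr fun n => ?_
    have i1 : Integrable (fun x => (K x - K' x) * |sobVal (w n) x| ^ (p + 1)) :=
      (h.integrable_rpow _).bdd_mul (h.K_meas.sub hinf.K_meas) hKB
    unfold powForm
    rw [← integral_sub (h.integrable_mul_rpow _) i1]
    exact integral_congr_ae (Eventually.of_forall fun x => by ring)
  -- `R` is the lower bound for the quadratic form of the remainders that follows from the
  -- homogeneous inequality at infinity.
  obtain ⟨R, hR⟩ : ∃ R, R = (μ' ^ (p - 1) * (μ - s) ^ 2) ^ (1 / (p + 1)) := ⟨_, rfl⟩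
  have hR0 : 0 ≤ R := by rw [hR]; positivity
  have hRlim : Tendsto (fun n => (μ' ^ (p - 1) * powForm K' p (w n) ^ 2) ^ (1 / (p + 1)))
      atTop (𝓝 R) := by
    rw [hR]
    exact ((hPw'.pow 2).const_mul _).rpow_const (Or.inr (by positivity))
  have hRle : ∀ n, (μ' ^ (p - 1) * powForm K' p (w n) ^ 2) ^ (1 / (p + 1))
      ≤ quadForm V' (w n) := by
    intro n
    have h1 := hinf.level_rpow_mul_le (hV'f (w n))
    rw [← hμ'] at h1
    calc _ ≤ (quadForm V' (w n) ^ (p + 1)) ^ (1 / (p + 1)) :=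
          Real.rpow_le_rpow (by positivity) h1 (by positivity)
      _ = quadForm V' (w n) := by
          rw [← Real.rpow_mul (hinf.quadForm_nonneg _), mul_one_div_cancel (by linarith),
            Real.rpow_one]
  have hcross : Tendsto (fun n => ∫ x, (inner ℝ (sobGrad u x) (sobGrad (w n) x)
      + V' x * sobVal u x * sobVal (w n) x)) atTop (𝓝 0) := by
    rw [hV']
    exact tendsto_bilin_zero hwweak vinf u
  obtain ⟨huf, hle⟩ := finitePotential_and_quadForm_le hUw hV'f hVV'
    (fun n => (h.mem_nehari_iff.1 (hU (ρ n))).2.1) hwae hunQ hcross hRlim hRle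
  have hlevu := h.level_rpow_mul_le huf
  rw [← hμ, ← hs] at hlevu
  obtain ⟨hqμ, hsμ'⟩ := no_escape hp hμμ' (h.quadForm_nonneg u) hs0 hsμ hR0 hle hlevu (by
    rw [hR, ← Real.rpow_mul (by positivity), one_div_mul_cancel (by linarith), Real.rpow_one])
  have humem := h.mem_nehari_of_quadForm_eq huf hμ0 hqμ (hs ▸ hsμ')
  refine ⟨u, humem, ?_⟩
  rw [h.energy_of_mem humem, hqμ, hμ, mul_div_cancel₀ _ hc.ne']

end Existence

/-! ### Comparison of levels -/

section Comparison

variable {N : ℕ}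

theorem le_of_rpow_mul_sq_le {p M Q : ℝ} (hp : 1 < p) (hM : 0 ≤ M) (hQ : 0 < Q)
    (h : M ^ (p - 1) * Q ^ 2 ≤ Q ^ (p + 1)) : M ≤ Q := by
  rw [show p + 1 = (p - 1) + 2 by ring, Real.rpow_add hQ, Real.rpow_two] at h
  exact (Real.rpow_le_rpow_iff hM hQ.le (by linarith : 0 < p - 1)).1
    (le_of_mul_le_mul_right h (by positivity))

/-- Some translate of `u` hardly sees a potential that vanishes at infinity. On a ball `B_R` the
function `y ↦ ∫_{B_R} d u(· + y)²` is integrable over the whole space, hence small somewhere. -/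
theorem exists_translate_integral_le (hN : 0 < N) {d : RN N → ℝ} (hd : LocallyIntegrable d volume)
    (hd0 : 0 ≤ᵐ[volume] d) (hdlim : VanishesAtInfinity d) (u : SobolevH1 N) {δ : ℝ} (hδ : 0 < δ) :
    ∃ y : RN N, Integrable (fun x => d x * sobVal u (x + y) ^ 2) ∧
      ∫ x, d x * sobVal u (x + y) ^ 2 ≤ δ := by
  have : Nonempty (Fin N) := ⟨⟨0, hN⟩⟩
  set A := ∫ x, sobVal u x ^ 2 with hA
  have hA0 : 0 ≤ A := integral_nonneg fun x => sq_nonneg _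
  set η := δ / (2 * (A + 1)) with hη
  have hη0 : 0 < η := by positivity
  obtain ⟨R, hR⟩ := hdlim.exists_ball hη0
  set B := Metric.ball (0 : RN N) R with hB
  have hu := measurable_sobVal u
  have hdm : AEMeasurable d volume := hd.aestronglyMeasurable.aemeasurable
  have hdB : IntegrableOn d B :=
    (hd.integrableOn_isCompact (isCompact_closedBall 0 R)).mono_set Metric.ball_subset_closedBall
  set F : RN N → ℝ≥0∞ := fun y => ∫⁻ x in B, ENNReal.ofReal (d x) *
    ENNReal.ofReal (sobVal u (x + y) ^ 2) with hF
  have hFint : ∫⁻ y, F y ≠ ⊤ := by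
    have hm : AEMeasurable (Function.uncurry fun (y x : RN N) => ENNReal.ofReal (d x) *
        ENNReal.ofReal (sobVal u (x + y) ^ 2)) (volume.prod (volume.restrict B)) := by
      refine AEMeasurable.mul (hdm.restrict.comp_snd).ennreal_ofReal (Measurable.aemeasurable ?_)
      fun_prop
    rw [hF, lintegral_lintegral_swap hm]
    have e : ∀ x, ∫⁻ y, ENNReal.ofReal (d x) * ENNReal.ofReal (sobVal u (x + y) ^ 2)
        = ENNReal.ofReal (d x) * ENNReal.ofReal A := by
      intro x
      rw [lintegral_const_mul' _ _ ENNReal.ofReal_ne_top,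
        lintegral_add_left_eq_self (fun y => ENNReal.ofReal (sobVal u y ^ 2)),
        ← ofReal_integral_eq_lintegral_ofReal (integrable_sobVal_sq u)
          (Eventually.of_forall fun x => sq_nonneg _)]
    simp_rw [e]
    rw [lintegral_mul_const' _ _ ENNReal.ofReal_ne_top]
    refine ENNReal.mul_ne_top ?_ ENNReal.ofReal_ne_top
    exact (hdB.lintegral_lt_top).ne
  obtain ⟨y, hy⟩ : ∃ y, F y ≤ ENNReal.ofReal (δ / 2) := by
    by_contra hcon
    push Not at hcon
    apply hFint
    rw [eq_top_iff]
    calc (⊤ : ℝ≥0∞) = ∫⁻ _ : RN N, ENNReal.ofReal (δ / 2) := by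
          have : NoncompactSpace (RN N) := NormedSpace.noncompactSpace ℝ (RN N)
          rw [lintegral_const, measure_univ_of_isAddLeftInvariant,
            ENNReal.mul_top (by simpa using hδ)]
      _ ≤ ∫⁻ y, F y := lintegral_mono fun y => (hcon y).le
  have hm : AEMeasurable (fun x => d x * sobVal u (x + y) ^ 2) volume :=
    hdm.mul (Measurable.aemeasurable (by fun_prop))
  have hnn : 0 ≤ᵐ[volume] fun x => d x * sobVal u (x + y) ^ 2 := by
    filter_upwards [hd0] with x hx
    exact mul_nonneg hx (sq_nonneg _)
  have key : ∫⁻ x, ENNReal.ofReal (d x * sobVal u (x + y) ^ 2) ≤ ENNReal.ofReal δ := by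
    rw [← lintegral_add_compl _ (measurableSet_ball (x := (0 : RN N)) (ε := R)), ← hB]
    have h1 : ∫⁻ x in B, ENNReal.ofReal (d x * sobVal u (x + y) ^ 2) ≤ ENNReal.ofReal (δ / 2) := by
      refine le_trans (le_of_eq (lintegral_congr_ae ?_)) hy
      filter_upwards [ae_restrict_of_ae hd0] with x hx
      exact ENNReal.ofReal_mul hx
    have h2 : ∫⁻ x in Bᶜ, ENNReal.ofReal (d x * sobVal u (x + y) ^ 2)
        ≤ ENNReal.ofReal (δ / 2) := by
      calc ∫⁻ x in Bᶜ, ENNReal.ofReal (d x * sobVal u (x + y) ^ 2)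
          ≤ ∫⁻ x in Bᶜ, ENNReal.ofReal η * ENNReal.ofReal (sobVal u (x + y) ^ 2) := by
            refine lintegral_mono_ae ?_
            filter_upwards [ae_restrict_mem measurableSet_ball.compl, ae_restrict_of_ae hR]
              with x hx hxR
            rw [← ENNReal.ofReal_mul hη0.le]
            refine ENNReal.ofReal_le_ofReal ?_
            have := (le_abs_self _).trans (hxR hx)
            gcongr
        _ ≤ ∫⁻ x, ENNReal.ofReal η * ENNReal.ofReal (sobVal u (x + y) ^ 2) :=
            setLIntegral_le_lintegral _ _
        _ = ENNReal.ofReal (η * A) := by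
            rw [lintegral_const_mul' _ _ ENNReal.ofReal_ne_top,
              lintegral_add_right_eq_self (fun y => ENNReal.ofReal (sobVal u y ^ 2)),
              ← ofReal_integral_eq_lintegral_ofReal (integrable_sobVal_sq u)
                (Eventually.of_forall fun x => sq_nonneg _), ← ENNReal.ofReal_mul hη0.le]
        _ ≤ ENNReal.ofReal (δ / 2) := by
            refine ENNReal.ofReal_le_ofReal ?_
            have : η * (A + 1) = δ / 2 := by rw [hη]; field_simp
            nlinarith
    calc _ ≤ ENNReal.ofReal (δ / 2) + ENNReal.ofReal (δ / 2) := add_le_add h1 h2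
      _ = ENNReal.ofReal δ := by
        rw [← ENNReal.ofReal_add (by positivity) (by positivity), add_halves]
  have hint : Integrable (fun x => d x * sobVal u (x + y) ^ 2) :=
    ⟨hm.aestronglyMeasurable, (hasFiniteIntegral_iff_ofReal hnn).2
      (key.trans_lt ENNReal.ofReal_lt_top)⟩
  refine ⟨y, hint, ?_⟩
  rw [← ofReal_integral_eq_lintegral_ofReal hint hnn] at key
  exact (ENNReal.ofReal_le_ofReal_iff hδ.le).1 key

theorem quadForm_const_translate (c : ℝ) (u : SobolevH1 N) (y : RN N) :
    quadForm (fun _ => c) (sobTranslate u y) = quadForm (fun _ => c) u := by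
  unfold quadForm
  rw [← integral_add_right_eq_self (fun x => ‖sobGrad u x‖ ^ 2 + c * sobVal u x ^ 2) y]
  refine integral_congr_ae ?_
  filter_upwards [sobVal_translate u y, sobGrad_translate u y] with x hx hx'
  rw [hx, hx']

theorem powForm_const_translate (c p : ℝ) (u : SobolevH1 N) (y : RN N) :
    powForm (fun _ => c) p (sobTranslate u y) = powForm (fun _ => c) p u := by
  unfold powForm
  rw [← integral_add_right_eq_self (fun x => c * |sobVal u x| ^ (p + 1)) y]
  refine integral_congr_ae ?_
  filter_upwards [sobVal_translate u y] with x hx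
  rw [hx]

theorem exists_sobolev_ne_zero (hN : 0 < N) : ∃ u : SobolevH1 N, u ≠ 0 := by
  have : Nonempty (Fin N) := ⟨⟨0, hN⟩⟩
  set f : ContDiffBump (0 : RN N) := default
  refine ⟨sobOfTest f f.contDiff f.hasCompactSupport, fun h0 => ?_⟩
  rw [← sobVal_ae_zero_iff] at h0
  have h1 : (f : RN N → ℝ) =ᵐ[volume] 0 := (sobVal_ofFun _ _ _).symm.trans h0
  have h2 := Continuous.ae_eq_iff_eq volume f.continuous continuous_zero |>.1 h1
  have h3 := congrFun h2 0
  rw [f.one_of_mem_closedBall (Metric.mem_closedBall_self f.rIn_pos.le)] at h3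
  exact one_ne_zero h3

/-- A potential `V = v_∞ + d` with `d` vanishing at infinity does not raise the level above that of
the problem at infinity. -/
theorem nehari_nonempty_and_level_le {V K : RN N → ℝ} {p v₀ k₀ k₁ vinf kinf k₀' k₁' : ℝ}
    (hN : 0 < N) (h : Admissible V K p v₀ k₀ k₁)
    (hinf : Admissible (N := N) (fun _ => vinf) (fun _ => kinf) p vinf k₀' k₁')
    (hd : LocallyIntegrable (fun x => V x - vinf) volume) (hV : ∀ᵐ x, vinf ≤ V x)
    (hdlim : VanishesAtInfinity fun x => V x - vinf) (hK : ∀ᵐ x, kinf ≤ K x) :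
    (nehari V K p).Nonempty ∧
      nehariLevel V K p ≤ nehariLevel (N := N) (fun _ => vinf) (fun _ => kinf) p := by
  have hp := h.one_lt
  have hc := nehariConst_pos hp
  have hd0 : 0 ≤ᵐ[volume] fun x => V x - vinf := by
    filter_upwards [hV] with x hx using sub_nonneg.2 hx
  have key : ∀ (u : SobolevH1 N) (δ : ℝ), 0 < δ → ∃ y : RN N,
      FinitePotential V (sobTranslate u y) ∧
      quadForm V (sobTranslate u y) ≤ quadForm (fun _ => vinf) u + δ := by
    intro u δ hδ
    obtain ⟨y, hy1, hy2⟩ := exists_translate_integral_le hN hd hd0 hdlim u hδ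
    have h1 : (fun x => (V x - vinf) * sobVal (sobTranslate u y) x ^ 2)
        =ᵐ[volume] fun x => (V x - vinf) * sobVal u (x + y) ^ 2 := by
      filter_upwards [sobVal_translate u y] with x hx
      rw [hx]
    have hy1' := (integrable_congr h1).2 hy1
    rw [← integral_congr_ae h1] at hy2
    have hv : Integrable (fun x => vinf * sobVal (sobTranslate u y) x ^ 2) :=
      finitePotential_const vinf _
    have hf : FinitePotential V (sobTranslate u y) := by
      refine (hy1'.add hv).congr (Eventually.of_forall fun x => ?_)
      simp only [Pi.add_apply]
      ring
    refine ⟨y, hf, ?_⟩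
    rw [← quadForm_const_translate vinf u y, quadForm_eq_add hf, quadForm_eq_add hv, add_assoc]
    refine add_le_add_right ?_ _
    rw [← sub_le_iff_le_add', ← integral_sub hf hv]
    refine le_trans (le_of_eq (integral_congr_ae (Eventually.of_forall fun x => ?_))) hy2
    simp only
    ring
  have hPle : ∀ (u : SobolevH1 N) (y : RN N),
      powForm (fun _ => kinf) p u ≤ powForm K p (sobTranslate u y) := by
    intro u y
    rw [← powForm_const_translate kinf p u y]
    refine integral_mono_ae (hinf.integrable_mul_rpow _) (h.integrable_mul_rpow _) ?_
    filter_upwards [hK] with x hx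
    gcongr
  obtain ⟨u₀, hu₀⟩ := exists_sobolev_ne_zero (N := N) hN
  have hne' := hinf.nehari_nonempty hu₀ (finitePotential_const vinf u₀)
  refine ⟨?_, hinf.le_nehariLevel hne' fun u hu => ?_⟩
  · obtain ⟨y, hy, -⟩ := key u₀ 1 one_pos
    refine h.nehari_nonempty (u := sobTranslate u₀ y) (fun h0 => ?_) hy
    have h1 := hPle u₀ y
    have h2 := hinf.powForm_pos hu₀
    have h3 : powForm K p (sobTranslate u₀ y) = 0 := by
      refine integral_eq_zero_of_ae ?_
      filter_upwards [sobVal_ae_zero_iff.2 h0] with x hx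
      simp [hx, Real.zero_rpow (by linarith : p + 1 ≠ 0)]
    linarith
  · obtain ⟨hu0, hf, hQP⟩ := hinf.mem_nehari_iff.1 hu
    obtain ⟨Q, hQ⟩ : ∃ Q, Q = quadForm (fun _ => vinf) u := ⟨_, rfl⟩
    have hQ0 : 0 < Q := hQ ▸ hinf.quadForm_pos hu0 hf
    have hlev0 := div_nonneg h.nehariLevel_nonneg hc.le
    rw [← hQ, mul_comm, ← div_le_iff₀ hc]
    refine le_of_rpow_mul_sq_le hp hlev0 hQ0 ?_
    have hlim : Tendsto (fun δ : ℝ => (Q + δ) ^ (p + 1)) (𝓝[>] 0) (𝓝 (Q ^ (p + 1))) := by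
      have : ContinuousAt (fun δ : ℝ => (Q + δ) ^ (p + 1)) 0 :=
        (continuousAt_const.add continuousAt_id).rpow_const (Or.inr (by linarith))
      simpa [ContinuousAt] using this.tendsto.mono_left nhdsWithin_le_nhds
    refine ge_of_tendsto hlim ?_
    filter_upwards [self_mem_nhdsWithin] with δ hδ
    obtain ⟨y, hy1, hy2⟩ := key u δ hδ
    calc _ ≤ (nehariLevel V K p / nehariConst p) ^ (p - 1)
          * powForm K p (sobTranslate u y) ^ 2 := by
          have h1 := hPle u y
          rw [← hQP, ← hQ] at h1
          gcongr
      _ ≤ quadForm V (sobTranslate u y) ^ (p + 1) := h.level_rpow_mul_le hy1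
      _ ≤ (Q + δ) ^ (p + 1) := by
          rw [hQ]
          exact Real.rpow_le_rpow (h.quadForm_nonneg _) hy2 (by linarith)

theorem quadForm_mono {V₁ V₂ : RN N → ℝ} (hV : ∀ᵐ x, V₁ x ≤ V₂ x) {u : SobolevH1 N}
    (h₁ : FinitePotential V₁ u) (h₂ : FinitePotential V₂ u) : quadForm V₁ u ≤ quadForm V₂ u := by
  rw [quadForm_eq_add h₁, quadForm_eq_add h₂]
  refine add_le_add_right (integral_mono_ae h₁ h₂ ?_) _
  filter_upwards [hV] with x hx
  gcongr

/-- The level is nondecreasing in the potential. -/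
theorem nehariLevel_mono {V₁ V₂ K : RN N → ℝ} {p v₀ w₀ k₀ k₁ : ℝ}
    (h₁ : Admissible V₁ K p v₀ k₀ k₁) (h₂ : Admissible V₂ K p w₀ k₀ k₁)
    (hV : ∀ᵐ x, V₁ x ≤ V₂ x) (hfin : ∀ u, FinitePotential V₂ u → FinitePotential V₁ u)
    (hne : (nehari V₂ K p).Nonempty) : nehariLevel V₁ K p ≤ nehariLevel V₂ K p := by
  have hp := h₁.one_lt
  have hc := nehariConst_pos hp
  refine h₂.le_nehariLevel hne fun u hu => ?_
  obtain ⟨hu0, hf, hQP⟩ := h₂.mem_nehari_iff.1 hu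
  rw [mul_comm, ← div_le_iff₀ hc]
  refine le_of_rpow_mul_sq_le hp (div_nonneg h₁.nehariLevel_nonneg hc.le)
    (h₂.quadForm_pos hu0 hf) ?_
  have h3 := h₁.level_rpow_mul_le (hfin u hf)
  rw [← hQP] at h3
  exact h3.trans (Real.rpow_le_rpow (h₁.quadForm_nonneg u) (quadForm_mono hV (hfin u hf) hf)
    (by linarith))

/-- If the levels of `V₁ ≤ V₂` coincide, a minimizer for `V₂` does not see `V₂ - V₁`. -/
theorem quadForm_eq_of_level_eq {V₁ V₂ K : RN N → ℝ} {p v₀ w₀ k₀ k₁ : ℝ}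
    (h₁ : Admissible V₁ K p v₀ k₀ k₁) (h₂ : Admissible V₂ K p w₀ k₀ k₁)
    (hV : ∀ᵐ x, V₁ x ≤ V₂ x) (hfin : ∀ u, FinitePotential V₂ u → FinitePotential V₁ u)
    (hlev : nehariLevel V₁ K p = nehariLevel V₂ K p) {u : SobolevH1 N} (hu : u ∈ nehari V₂ K p)
    (hE : energy V₂ K p u = nehariLevel V₂ K p) : quadForm V₁ u = quadForm V₂ u := by
  have hp := h₁.one_lt
  have hc := nehariConst_pos hp
  obtain ⟨hu0, hf, hQP⟩ := h₂.mem_nehari_iff.1 hu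
  have hQ := h₂.quadForm_pos hu0 hf
  refine le_antisymm (quadForm_mono hV (hfin u hf) hf) ?_
  have h3 := h₁.level_rpow_mul_le (hfin u hf)
  rw [hlev, ← hE, h₂.energy_of_mem hu, mul_div_cancel_left₀ _ hc.ne', ← hQP] at h3
  rw [← Real.rpow_le_rpow_iff hQ.le (h₁.quadForm_nonneg u) (by linarith : 0 < p + 1)]
  refine le_trans (le_of_eq ?_) h3
  rw [show p + 1 = (p - 1) + 2 by ring, Real.rpow_add hQ, Real.rpow_two]

end Comparison

/-! ### Strong maximum principle -/

section MaximumPrinciple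

variable {N : ℕ}

open Polynomial in
/-- A smooth profile `Θ₀`, vanishing on `(-∞, 0]`, that is dominated on `(-∞, 1]` by its
derivative `Θ₁`. -/
theorem exists_profile : ∃ Θ₀ Θ₁ Θ₂ : ℝ → ℝ, ContDiff ℝ ∞ Θ₀ ∧ ContDiff ℝ ∞ Θ₁ ∧
    Continuous Θ₂ ∧
    (∀ σ, HasDerivAt Θ₀ (Θ₁ σ) σ) ∧ (∀ σ, HasDerivAt Θ₁ (Θ₂ σ) σ) ∧
    (∀ σ ≤ 0, Θ₀ σ = 0 ∧ Θ₁ σ = 0 ∧ Θ₂ σ = 0) ∧ (∀ σ, 0 ≤ Θ₀ σ) ∧ (∀ σ, 0 < σ → 0 < Θ₁ σ) ∧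
    ∀ σ ≤ 1, Θ₀ σ ≤ Θ₁ σ := by
  have hsm : ∀ q : ℝ[X], ContDiff ℝ ∞ (fun x => q.eval x⁻¹ * expNegInvGlue x) := fun q =>
    expNegInvGlue.contDiff_polynomial_eval_inv_mul (n := ⊤) q
  set q₁ : ℝ[X] := X ^ 2 * (1 - derivative (R := ℝ) 1) with hq₁
  have hq₁e : ∀ σ : ℝ, q₁.eval σ⁻¹ = (σ ^ 2)⁻¹ := fun σ => by simp [hq₁]
  refine ⟨fun x => (1 : ℝ[X]).eval x⁻¹ * expNegInvGlue x, fun x => q₁.eval x⁻¹ * expNegInvGlue x,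
    fun x => (X ^ 2 * (q₁ - derivative (R := ℝ) q₁)).eval x⁻¹ * expNegInvGlue x,
    hsm _, hsm _, (hsm _).continuous,
    expNegInvGlue.hasDerivAt_polynomial_eval_inv_mul 1,
    expNegInvGlue.hasDerivAt_polynomial_eval_inv_mul q₁, fun σ hσ => ?_, fun σ => ?_,
    fun σ hσ => ?_, fun σ hσ => ?_⟩
  · simp [expNegInvGlue.zero_of_nonpos hσ]
  · simpa using expNegInvGlue.nonneg σ
  · simp only [hq₁e]
    have := expNegInvGlue.pos_of_pos hσ
    positivity
  · simp only [hq₁e, eval_one, one_mul]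
    rcases le_or_gt σ 0 with h0 | h0
    · simp [expNegInvGlue.zero_of_nonpos h0]
    · refine le_mul_of_one_le_left (expNegInvGlue.nonneg σ) ?_
      rw [one_le_inv₀ (by positivity)]
      exact pow_le_one₀ h0.le hσ

/-- The derivative of `y ↦ f (1 - ‖y - x₀‖² / s)`. -/
theorem hasFDerivAt_profile {f f' : ℝ → ℝ} (hf : ∀ σ, HasDerivAt f (f' σ) σ) (x₀ : RN N) (s : ℝ)
    (y : RN N) :
    HasFDerivAt (fun y : RN N => f (1 - ‖y - x₀‖ ^ 2 / s))
      ((f' (1 - ‖y - x₀‖ ^ 2 / s) * (-(2 / s))) • innerSL ℝ (y - x₀)) y := by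
  have h1 : HasFDerivAt (fun y : RN N => ‖y - x₀‖ ^ 2) (2 • innerSL ℝ (y - x₀)) y := by
    have := (HasStrictFDerivAt.hasFDerivAt (hasStrictFDerivAt_norm_sq (F := RN N) (y - x₀)))
    exact this.comp y ((hasFDerivAt_id y).sub_const x₀)
  have h2 : HasFDerivAt (fun y : RN N => 1 - ‖y - x₀‖ ^ 2 / s)
      ((-(2 / s)) • innerSL ℝ (y - x₀)) y := by
    have := (h1.const_mul s⁻¹).const_sub 1
    refine (this.congr_fderiv ?_).congr_of_eventuallyEq (Eventually.of_forall fun y => ?_)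
    · ext v
      simp
      ring
    · simp only
      ring
  refine ((hf _).comp_hasFDerivAt y h2).congr_fderiv ?_
  rw [smul_smul]

theorem hasCompactSupport_profile {f : ℝ → ℝ} (hf : ∀ σ ≤ 0, f σ = 0) (x₀ : RN N) {s : ℝ}
    (hs : 0 < s) : HasCompactSupport (fun y : RN N => f (1 - ‖y - x₀‖ ^ 2 / s)) := by
  refine HasCompactSupport.of_support_subset_isCompact (isCompact_closedBall x₀ (√s)) ?_
  intro y hy
  by_contra hlt
  apply hy
  refine hf _ ?_
  rw [mem_closedBall_iff_norm, not_le] at hlt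
  have h1 : s ≤ ‖y - x₀‖ ^ 2 := by
    rw [← Real.sq_sqrt hs.le]
    exact pow_le_pow_left₀ (Real.sqrt_nonneg _) hlt.le 2
  rw [sub_nonpos, one_le_div hs]
  exact h1

theorem contDiff_profile {f : ℝ → ℝ} (hf : ContDiff ℝ ∞ f) (x₀ : RN N) (s : ℝ) :
    ContDiff ℝ ∞ (fun y : RN N => f (1 - ‖y - x₀‖ ^ 2 / s)) :=
  hf.comp (contDiff_const.sub (((contDiff_id.sub contDiff_const).norm_sq ℝ).div_const s))

/-- `w` is a weak supersolution of `-Δw + c w = 0`. -/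
def IsSupersolution (c : ℝ) (w : SobolevH1 N) : Prop :=
  ∀ φ : RN N → ℝ, ContDiff ℝ ∞ φ → HasCompactSupport φ → (∀ x, 0 ≤ φ x) →
    0 ≤ (∫ x, fderiv ℝ φ x (sobGrad w x)) + c * ∫ x, sobVal w x * φ x

/-- Testing a supersolution with `Θ₀(1 - ‖y - x₀‖²/s)`, whose Laplacian appears on the left. -/
theorem IsSupersolution.integral_laplacian_profile_le {c : ℝ} {w : SobolevH1 N}
    (hw : IsSupersolution c w) {Θ₀ Θ₁ Θ₂ : ℝ → ℝ} (h0 : ContDiff ℝ ∞ Θ₀) (h1 : ContDiff ℝ ∞ Θ₁)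
    (hd0 : ∀ σ, HasDerivAt Θ₀ (Θ₁ σ) σ) (hd1 : ∀ σ, HasDerivAt Θ₁ (Θ₂ σ) σ)
    (hz : ∀ σ ≤ 0, Θ₀ σ = 0 ∧ Θ₁ σ = 0 ∧ Θ₂ σ = 0) (hnn : ∀ σ, 0 ≤ Θ₀ σ) (x₀ : RN N) {s : ℝ}
    (hs : 0 < s) :
    ∫ y, sobVal w y * (4 / s * (-((N : ℝ) / 2) * Θ₁ (1 - ‖y - x₀‖ ^ 2 / s)
        + Θ₂ (1 - ‖y - x₀‖ ^ 2 / s) * (‖y - x₀‖ ^ 2 / s)))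
      ≤ c * ∫ y, sobVal w y * Θ₀ (1 - ‖y - x₀‖ ^ 2 / s) := by
  set ψ : RN N → ℝ := fun y => Θ₀ (1 - ‖y - x₀‖ ^ 2 / s) with hψ
  set φ : Fin N → RN N → ℝ := fun i y =>
    Θ₁ (1 - ‖y - x₀‖ ^ 2 / s) * (-(2 / s) * (y - x₀) i) with hφ
  have hψs := contDiff_profile h0 x₀ s
  have hψc := hasCompactSupport_profile (fun σ hσ => (hz σ hσ).1) x₀ hs
  have hcoord : ∀ i, ContDiff ℝ ∞ (fun y : RN N => -(2 / s) * (y - x₀) i) := fun i =>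
    contDiff_const.mul ((EuclideanSpace.proj (𝕜 := ℝ) i : RN N →L[ℝ] ℝ).contDiff.comp
      (contDiff_id.sub contDiff_const))
  have hφs : ∀ i, ContDiff ℝ ∞ (φ i) := fun i => (contDiff_profile h1 x₀ s).mul (hcoord i)
  have hφc : ∀ i, HasCompactSupport (φ i) := fun i =>
    (hasCompactSupport_profile (fun σ hσ => (hz σ hσ).2.1) x₀ hs).mul_right
  -- `φ i` is the partial derivative `∂_i ψ`, whose own derivatives sum up to `Δψ`.
  have hgrad : ∀ y, fderiv ℝ ψ y (sobGrad w y) = ∑ i, sobGrad w y i * φ i y := by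
    intro y
    rw [(hasFDerivAt_profile hd0 x₀ s y).fderiv]
    simp only [smul_apply, innerSL_apply_apply, PiLp.inner_apply, smul_eq_mul,
      Finset.mul_sum, hφ]
    refine Finset.sum_congr rfl fun i _ => ?_
    simp
    ring
  have hφd : ∀ i y, fderiv ℝ (φ i) y (EuclideanSpace.single i 1)
      = Θ₂ (1 - ‖y - x₀‖ ^ 2 / s) * (4 / s ^ 2) * (y - x₀) i ^ 2
        - 2 / s * Θ₁ (1 - ‖y - x₀‖ ^ 2 / s) := by
    intro i y
    have hl : HasFDerivAt (fun y : RN N => -(2 / s) * (y - x₀) i)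
        (-(2 / s) • (EuclideanSpace.proj (𝕜 := ℝ) i : RN N →L[ℝ] ℝ)) y :=
      (((EuclideanSpace.proj (𝕜 := ℝ) i : RN N →L[ℝ] ℝ).hasFDerivAt).comp y
        ((hasFDerivAt_id y).sub_const x₀)).const_mul _
    have h3 : HasFDerivAt (φ i) _ y := (hasFDerivAt_profile hd1 x₀ s y).mul hl
    rw [h3.fderiv]
    simp [EuclideanSpace.inner_single_right]
    ring
  have hlap : ∀ y, sobVal w y * (4 / s * (-((N : ℝ) / 2) * Θ₁ (1 - ‖y - x₀‖ ^ 2 / s)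
        + Θ₂ (1 - ‖y - x₀‖ ^ 2 / s) * (‖y - x₀‖ ^ 2 / s)))
      = ∑ i, sobVal w y * fderiv ℝ (φ i) y (EuclideanSpace.single i 1) := by
    intro y
    simp_rw [hφd]
    rw [← Finset.mul_sum, Finset.sum_sub_distrib, ← Finset.mul_sum, ← EuclideanSpace.real_norm_sq_eq]
    simp
    ring_nf
    simp
  have hsum : ∫ y, fderiv ℝ ψ y (sobGrad w y)
      = - ∫ y, sobVal w y * (4 / s * (-((N : ℝ) / 2) * Θ₁ (1 - ‖y - x₀‖ ^ 2 / s)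
        + Θ₂ (1 - ‖y - x₀‖ ^ 2 / s) * (‖y - x₀‖ ^ 2 / s))) := by
    simp_rw [hgrad, hlap]
    rw [integral_finsetSum, integral_finsetSum, ← Finset.sum_neg_distrib]
    · refine Finset.sum_congr rfl fun i _ => ?_
      rw [isWeakGradient_sob w (φ i) (hφs i) (hφc i) i, neg_neg]
    · exact fun i _ => (sobVal_memLp w).integrable_mul
        (memLp_two_fderiv_of_test (hφs i) (hφc i) _)
    · exact fun i _ => (memLp_two_coord w.1.snd i).integrable_mul
        (memLp_two_of_test (hφs i).continuous (hφc i))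
  have h2 := hw ψ hψs hψc fun y => hnn _
  rw [hsum] at h2
  linarith

theorem abs_profile_le {f : ℝ → ℝ} (hf : Continuous f) (hz : ∀ σ ≤ 0, f σ = 0) :
    ∃ C, 0 ≤ C ∧ ∀ σ ≤ 1, |f σ| ≤ C := by
  obtain ⟨C, hC⟩ := (isCompact_Icc (a := (0 : ℝ)) (b := 1)).exists_bound_of_continuousOn
    hf.continuousOn
  have hC0 : 0 ≤ C := (norm_nonneg _).trans (hC 0 (by simp))
  refine ⟨C, hC0, fun σ hσ => ?_⟩
  rcases le_or_gt σ 0 with h | h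
  · simpa [hz σ h] using hC0
  · exact hC σ ⟨h.le, hσ⟩

theorem integrable_sobVal_mul_profile (w : SobolevH1 N) {f : ℝ → ℝ} (hf : Continuous f)
    (hz : ∀ σ ≤ 0, f σ = 0) (x₀ : RN N) {s : ℝ} (hs : 0 < s) :
    Integrable (fun y => sobVal w y * f (1 - ‖y - x₀‖ ^ 2 / s)) :=
  (sobVal_memLp w).integrable_mul
    (memLp_two_of_test (by fun_prop) (hasCompactSupport_profile hz x₀ hs))

/-- Differentiation of `s ↦ ∫ w(y) f(1 - ‖y - x₀‖²/s) dy`. -/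
theorem hasDerivAt_integral_profile (w : SobolevH1 N) {f f' : ℝ → ℝ}
    (hf : ∀ σ, HasDerivAt f (f' σ) σ) (hf' : Continuous f')
    (hz : ∀ σ ≤ 0, f σ = 0) (hz' : ∀ σ ≤ 0, f' σ = 0) (x₀ : RN N) {s : ℝ} (hs : 0 < s) :
    HasDerivAt (fun s => ∫ y, sobVal w y * f (1 - ‖y - x₀‖ ^ 2 / s))
      (∫ y, sobVal w y * (f' (1 - ‖y - x₀‖ ^ 2 / s) * (‖y - x₀‖ ^ 2 / s ^ 2))) s := by
  have hfc : Continuous f := continuous_iff_continuousAt.2 fun σ => (hf σ).continuousAt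
  obtain ⟨C, hC0, hC⟩ := abs_profile_le hf' hz'
  have hmem : Ioo (s / 2) (2 * s) ∈ 𝓝 s := Ioo_mem_nhds (by linarith) (by linarith)
  have hwl : LocallyIntegrable (sobVal w) volume :=
    (sobVal_memLp w).locallyIntegrable (by norm_num)
  have hmeas : Measurable fun y : RN N => f' (1 - ‖y - x₀‖ ^ 2 / s) * (‖y - x₀‖ ^ 2 / s ^ 2) :=
    (Continuous.measurable (by fun_prop))
  refine (hasDerivAt_integral_of_dominated_loc_of_deriv_le (x₀ := s)
    (F := fun s y => sobVal w y * f (1 - ‖y - x₀‖ ^ 2 / s))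
    (F' := fun s y => sobVal w y * (f' (1 - ‖y - x₀‖ ^ 2 / s) * (‖y - x₀‖ ^ 2 / s ^ 2)))
    (bound := (Metric.closedBall x₀ (√(2 * s))).indicator
      fun y => C * (2 / s) * |sobVal w y|) hmem
    (Eventually.of_forall fun t =>
      ((measurable_sobVal w).mul (Continuous.measurable (by fun_prop))).aestronglyMeasurable)
    (integrable_sobVal_mul_profile w hfc hz x₀ hs)
    ((measurable_sobVal w).mul hmeas).aestronglyMeasurable
    (Eventually.of_forall fun y t ht => ?_) ?_ (Eventually.of_forall fun y t ht => ?_)).2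
  · have ht0 : 0 < t := by linarith [ht.1]
    rcases le_or_gt (1 - ‖y - x₀‖ ^ 2 / t) 0 with h | h
    · rw [hz' _ h]
      simp only [zero_mul, mul_zero, norm_zero]
      exact indicator_nonneg (fun _ _ => by positivity) _
    · have h1 : ‖y - x₀‖ ^ 2 / t < 1 := by linarith
      have h1' : ‖y - x₀‖ ^ 2 < t := by rwa [div_lt_one ht0] at h1
      rw [indicator_of_mem]
      · rw [Real.norm_eq_abs, abs_mul, abs_mul, mul_comm]
        refine mul_le_mul_of_nonneg_right (mul_le_mul (hC _ ?_) ?_ (abs_nonneg _) hC0)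
          (abs_nonneg _)
        · have : 0 ≤ ‖y - x₀‖ ^ 2 / t := by positivity
          linarith
        · rw [abs_of_nonneg (by positivity), div_le_div_iff₀ (by positivity) hs]
          nlinarith [ht.1]
      · rw [mem_closedBall_iff_norm]
        exact Real.le_sqrt_of_sq_le (by linarith [ht.2])
  · rw [integrable_indicator_iff Metric.isClosed_closedBall.measurableSet]
    exact (hwl.integrableOn_isCompact (isCompact_closedBall _ _)).abs.const_mul _
  · have ht0 : 0 < t := by linarith [ht.1]
    have h1 : HasDerivAt (fun t : ℝ => 1 - ‖y - x₀‖ ^ 2 / t) (‖y - x₀‖ ^ 2 / t ^ 2) t := by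
      have := ((hasDerivAt_inv ht0.ne').const_mul (‖y - x₀‖ ^ 2)).const_sub 1
      refine (this.congr_deriv ?_)
      ring
    exact ((hf _).comp t h1).const_mul _

/-- For a nonnegative supersolution `w`, the average of `w` against a fixed profile over
balls of radius `√s`, corrected by an exponential factor, is nonincreasing in `s`. -/
theorem IsSupersolution.antitoneOn_average {c : ℝ} (hc : 0 ≤ c) {w : SobolevH1 N}
    (hw : IsSupersolution c w) (hw0 : ∀ᵐ x, 0 ≤ sobVal w x) {Θ₀ Θ₁ Θ₂ : ℝ → ℝ}
    (h0 : ContDiff ℝ ∞ Θ₀) (h1 : ContDiff ℝ ∞ Θ₁) (h2 : Continuous Θ₂)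
    (hd0 : ∀ σ, HasDerivAt Θ₀ (Θ₁ σ) σ) (hd1 : ∀ σ, HasDerivAt Θ₁ (Θ₂ σ) σ)
    (hz : ∀ σ ≤ 0, Θ₀ σ = 0 ∧ Θ₁ σ = 0 ∧ Θ₂ σ = 0) (hnn : ∀ σ, 0 ≤ Θ₀ σ)
    (hle : ∀ σ ≤ 1, Θ₀ σ ≤ Θ₁ σ) (x₀ : RN N) :
    AntitoneOn (fun s : ℝ => Real.exp (-(c / 4) * s) * s ^ (-((N : ℝ) / 2)) *
      ∫ y, sobVal w y * Θ₁ (1 - ‖y - x₀‖ ^ 2 / s)) (Ioi 0) := by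
  set G : ℝ → ℝ := fun s => ∫ y, sobVal w y * Θ₁ (1 - ‖y - x₀‖ ^ 2 / s) with hG
  have hder : ∀ s ∈ Ioi (0 : ℝ), HasDerivAt
      (fun s : ℝ => Real.exp (-(c / 4) * s) * s ^ (-((N : ℝ) / 2)) * G s)
      (Real.exp (-(c / 4) * s) * s ^ (-((N : ℝ) / 2)) *
        (-(c / 4) * G s - (N : ℝ) / 2 / s * G s
          + ∫ y, sobVal w y * (Θ₂ (1 - ‖y - x₀‖ ^ 2 / s) * (‖y - x₀‖ ^ 2 / s ^ 2)))) s := by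
    intro s hs
    have hs' : (0 : ℝ) < s := hs
    have e1 : HasDerivAt (fun s : ℝ => Real.exp (-(c / 4) * s))
        (Real.exp (-(c / 4) * s) * -(c / 4)) s := by
      simpa using ((hasDerivAt_id s).const_mul (-(c / 4))).exp
    have e2 : HasDerivAt (fun s : ℝ => s ^ (-((N : ℝ) / 2)))
        (-((N : ℝ) / 2) * s ^ (-((N : ℝ) / 2) - 1)) s :=
      Real.hasDerivAt_rpow_const (Or.inl hs'.ne')
    have e3 := hasDerivAt_integral_profile w hd1 h2 (fun σ hσ => (hz σ hσ).2.1)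
      (fun σ hσ => (hz σ hσ).2.2) x₀ hs'
    refine ((e1.mul e2).mul e3).congr_deriv ?_
    rw [Real.rpow_sub_one hs'.ne']
    simp only [hG, Pi.mul_apply]
    ring
  refine antitoneOn_of_hasDerivWithinAt_nonpos (convex_Ioi 0)
    (fun s hs => (hder s hs).continuousAt.continuousWithinAt)
    (fun s hs => (hder s (interior_subset hs)).hasDerivWithinAt) fun s hs => ?_
  have hs' : (0 : ℝ) < s := interior_subset hs
  refine mul_nonpos_of_nonneg_of_nonpos (by positivity) ?_
  have i1 := integrable_sobVal_mul_profile w h1.continuous (fun σ hσ => (hz σ hσ).2.1) x₀ hs'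
  have i0 := integrable_sobVal_mul_profile w h0.continuous (fun σ hσ => (hz σ hσ).1) x₀ hs'
  have i2 : Integrable fun y =>
      sobVal w y * (Θ₂ (1 - ‖y - x₀‖ ^ 2 / s) * (‖y - x₀‖ ^ 2 / s ^ 2)) := by
    refine (sobVal_memLp w).integrable_mul (memLp_two_of_test (by fun_prop) ?_)
    exact (hasCompactSupport_profile (fun σ hσ => (hz σ hσ).2.2) x₀ hs').mul_right
  have hL := hw.integral_laplacian_profile_le h0 h1 hd0 hd1 hz hnn x₀ hs'
  have hsplit : ∫ y, sobVal w y * (4 / s * (-((N : ℝ) / 2) * Θ₁ (1 - ‖y - x₀‖ ^ 2 / s)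
        + Θ₂ (1 - ‖y - x₀‖ ^ 2 / s) * (‖y - x₀‖ ^ 2 / s)))
      = 4 * (-((N : ℝ) / 2 / s) * G s
        + ∫ y, sobVal w y * (Θ₂ (1 - ‖y - x₀‖ ^ 2 / s) * (‖y - x₀‖ ^ 2 / s ^ 2))) := by
    rw [hG, ← integral_const_mul, ← integral_add (i1.const_mul _) i2, ← integral_const_mul]
    refine integral_congr_ae (Eventually.of_forall fun y => ?_)
    simp only
    field_simp
  have hcmp : ∫ y, sobVal w y * Θ₀ (1 - ‖y - x₀‖ ^ 2 / s) ≤ G s := by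
    refine integral_mono_ae i0 i1 ?_
    filter_upwards [hw0] with y hy
    refine mul_le_mul_of_nonneg_left (hle _ ?_) hy
    have : 0 ≤ ‖y - x₀‖ ^ 2 / s := by positivity
    linarith
  have := mul_le_mul_of_nonneg_left hcmp hc
  rw [hsplit] at hL
  linarith

/-- At a Lebesgue point where `w` vanishes, the averages of `w` against a profile over shrinking
balls tend to zero. -/
theorem tendsto_average_profile {w : SobolevH1 N} {f : ℝ → ℝ} (hf : Continuous f)
    (hz : ∀ σ ≤ 0, f σ = 0) {x₀ : RN N}
    (hx : Tendsto (fun s : ℝ => ⨍ y in Metric.closedBall x₀ (√s), ‖sobVal w y‖) (𝓝[>] 0) (𝓝 0)) :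
    Tendsto (fun s : ℝ => s ^ (-((N : ℝ) / 2)) *
      ∫ y, sobVal w y * f (1 - ‖y - x₀‖ ^ 2 / s)) (𝓝[>] 0) (𝓝 0) := by
  obtain ⟨C, hC0, hC⟩ := abs_profile_le hf hz
  have hwl : LocallyIntegrable (sobVal w) volume :=
    (sobVal_memLp w).locallyIntegrable (by norm_num)
  set β := volume.real (Metric.ball (0 : RN N) 1) with hβ
  have hlim : Tendsto (fun s : ℝ => C * β * ⨍ y in Metric.closedBall x₀ (√s), ‖sobVal w y‖)
      (𝓝[>] 0) (𝓝 0) := by simpa using hx.const_mul (C * β)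
  refine squeeze_zero_norm' ?_ hlim
  filter_upwards [self_mem_nhdsWithin] with s hs
  have hs' : (0 : ℝ) < s := hs
  have hi : IntegrableOn (fun y => ‖sobVal w y‖) (Metric.closedBall x₀ (√s)) :=
    (hwl.integrableOn_isCompact (isCompact_closedBall _ _)).norm
  have hint : ‖∫ y, sobVal w y * f (1 - ‖y - x₀‖ ^ 2 / s)‖
      ≤ C * ∫ y in Metric.closedBall x₀ (√s), ‖sobVal w y‖ := by
    rw [← integral_const_mul, ← integral_indicator Metric.isClosed_closedBall.measurableSet]
    refine norm_integral_le_of_norm_le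
      ((integrable_indicator_iff Metric.isClosed_closedBall.measurableSet).2 (hi.const_mul C))
      (Eventually.of_forall fun y => ?_)
    by_cases hy : y ∈ Metric.closedBall x₀ (√s)
    · rw [indicator_of_mem hy, norm_mul, mul_comm]
      refine mul_le_mul_of_nonneg_right (hC _ ?_) (norm_nonneg _)
      have : 0 ≤ ‖y - x₀‖ ^ 2 / s := by positivity
      linarith
    · rw [indicator_of_notMem hy, hz, mul_zero, norm_zero]
      rw [mem_closedBall_iff_norm, not_le, Real.sqrt_lt' (norm_pos_iff.2 ?_)] at hy
      · rw [sub_nonpos, one_le_div hs']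
        exact hy.le
      · rintro h
        rw [h, norm_zero] at hy
        exact hy.not_ge (Real.sqrt_nonneg _)
  have hvol : volume.real (Metric.closedBall x₀ (√s)) = s ^ ((N : ℝ) / 2) * β := by
    rw [Measure.addHaar_real_closedBall _ _ (Real.sqrt_nonneg _), finrank_euclideanSpace_fin,
      Real.sqrt_eq_rpow, ← Real.rpow_natCast, ← Real.rpow_mul hs'.le]
    congr 2
    ring
  have hβ0 : 0 < β := ENNReal.toReal_pos
    (Metric.measure_ball_pos volume _ one_pos).ne' measure_ball_lt_top.ne
  have hav : ∫ y in Metric.closedBall x₀ (√s), ‖sobVal w y‖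
      = s ^ ((N : ℝ) / 2) * β * ⨍ y in Metric.closedBall x₀ (√s), ‖sobVal w y‖ := by
    rw [setAverage_eq, hvol, smul_eq_mul, mul_inv_cancel_left₀ (by positivity)]
  have hpow : s ^ (-((N : ℝ) / 2)) * s ^ ((N : ℝ) / 2) = 1 := by
    rw [← Real.rpow_add hs']
    simp
  rw [norm_mul, Real.norm_of_nonneg (by positivity)]
  refine (mul_le_mul_of_nonneg_left hint (by positivity)).trans (le_of_eq ?_)
  rw [hav]
  linear_combination (C * β * ⨍ y in Metric.closedBall x₀ (√s), ‖sobVal w y‖) * hpow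

/-- **Strong maximum principle**: a nonzero nonnegative supersolution of `-Δw + c w = 0` is
positive almost everywhere. If it vanished at a Lebesgue point `x₀`, then the corrected averages
around `x₀`, nonincreasing in the radius and tending to zero at radius zero, would vanish. -/
theorem IsSupersolution.pos {c : ℝ} (hc : 0 ≤ c) {w : SobolevH1 N}
    (hw : IsSupersolution c w) (hw0 : ∀ᵐ x, 0 ≤ sobVal w x) (hne : w ≠ 0) :
    ∀ᵐ x, 0 < sobVal w x := by
  obtain ⟨Θ₀, Θ₁, Θ₂, h0, h1, h2, hd0, hd1, hz, hnn, hpos, hle⟩ := exists_profile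
  have hwl : LocallyIntegrable (sobVal w) volume :=
    (sobVal_memLp w).locallyIntegrable (by norm_num)
  filter_upwards [hw0, IsUnifLocDoublingMeasure.ae_tendsto_average_norm_sub volume hwl 1]
    with x₀ hx0 hx
  refine lt_of_le_of_ne hx0 fun h => hne ?_
  have hsqrt : Tendsto (fun s : ℝ => √s) (𝓝[>] 0) (𝓝[>] 0) := by
    refine tendsto_nhdsWithin_iff.2 ⟨?_, ?_⟩
    · simpa using (Real.continuous_sqrt.tendsto 0).mono_left nhdsWithin_le_nhds
    · filter_upwards [self_mem_nhdsWithin] with s hs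
      exact Real.sqrt_pos.2 hs
  have hav := hx (fun _ : ℝ => x₀) _ hsqrt
    (Eventually.of_forall fun s => Metric.mem_closedBall_self (by positivity))
  simp only [← h, sub_zero] at hav
  have hlim := tendsto_average_profile h1.continuous (fun σ hσ => (hz σ hσ).2.1) hav
  have hexp : Tendsto (fun s : ℝ => Real.exp (-(c / 4) * s)) (𝓝[>] 0) (𝓝 1) := by
    have : Continuous fun s : ℝ => Real.exp (-(c / 4) * s) := by fun_prop
    simpa using (this.tendsto 0).mono_left nhdsWithin_le_nhds
  have hlim' := hexp.mul hlim
  simp only [← mul_assoc, mul_zero] at hlim'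
  have hanti := hw.antitoneOn_average hc hw0 h0 h1 h2 hd0 hd1 hz hnn hle x₀
  have hball : ∀ n : ℕ, ∀ᵐ y, y ∈ Metric.ball x₀ (n + 1) → sobVal w y = 0 := by
    intro n
    have ht : (0 : ℝ) < ((n : ℝ) + 1) ^ 2 := by positivity
    obtain ⟨t, htn⟩ : ∃ t : ℝ, t = ((n : ℝ) + 1) ^ 2 := ⟨_, rfl⟩
    rw [← htn] at ht
    have hnn1 : ∀ᵐ y, 0 ≤ sobVal w y * Θ₁ (1 - ‖y - x₀‖ ^ 2 / t) := by
      filter_upwards [hw0] with y hy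
      refine mul_nonneg hy ?_
      rcases le_or_gt (1 - ‖y - x₀‖ ^ 2 / t) 0 with h | h
      · exact (hz _ h).2.1.ge
      · exact (hpos _ h).le
    have hGle : Real.exp (-(c / 4) * t) * t ^ (-((N : ℝ) / 2)) *
        ∫ y, sobVal w y * Θ₁ (1 - ‖y - x₀‖ ^ 2 / t) ≤ 0 := by
      refine ge_of_tendsto hlim' ?_
      filter_upwards [Ioo_mem_nhdsGT ht] with s hs
      exact hanti (mem_Ioi.2 hs.1) (mem_Ioi.2 ht) hs.2.le
    have hG0 : ∫ y, sobVal w y * Θ₁ (1 - ‖y - x₀‖ ^ 2 / t) = 0 :=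
      le_antisymm (nonpos_of_mul_nonpos_right hGle (by positivity)) (integral_nonneg_of_ae hnn1)
    rw [integral_eq_zero_iff_of_nonneg_ae hnn1
      (integrable_sobVal_mul_profile w h1.continuous (fun σ hσ => (hz σ hσ).2.1) x₀ ht)] at hG0
    filter_upwards [hG0] with y hy hyb
    rw [mem_ball_iff_norm] at hyb
    refine (mul_eq_zero.1 hy).resolve_right (hpos _ ?_).ne'
    rw [sub_pos, div_lt_one ht, htn]
    exact pow_lt_pow_left₀ hyb (norm_nonneg _) two_ne_zero
  rw [← sobVal_ae_zero_iff]
  filter_upwards [ae_all_iff.2 hball] with y hy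
  obtain ⟨n, hn⟩ := exists_nat_gt ‖y - x₀‖
  exact hy n (mem_ball_iff_norm.2 (by linarith))

end MaximumPrinciple

/-! ### Ground states are positive -/

section Positivity

variable {N : ℕ}

/-- A nonnegative solution on whose support `V = c` is a supersolution of `-Δw + c w = 0`. -/
theorem IsSolution.isSupersolution {V K : RN N → ℝ} {p c : ℝ} {w : SobolevH1 N}
    (hw : IsSolution V K p w) (hV : LocallyIntegrable V volume) (hw0 : ∀ᵐ x, 0 ≤ sobVal w x)
    (hK : ∀ᵐ x, 0 ≤ K x) (hVw : ∀ᵐ x, V x * sobVal w x = c * sobVal w x) :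
    IsSupersolution c w := by
  intro φ hφ hφc hφ0
  obtain ⟨v, hv⟩ : ∃ v, v = sobOfTest φ hφ hφc := ⟨_, rfl⟩
  have hv1 : sobVal v =ᵐ[volume] φ := hv ▸ sobVal_ofFun _ _ _
  have hv2 : sobGrad v =ᵐ[volume]
      fun x => (InnerProductSpace.toDual ℝ (RN N)).symm (fderiv ℝ φ x) := hv ▸ sobGrad_ofFun _ _ _
  have hfin : FinitePotential V v := by
    refine (FinitePotential.congr_ae hv1).2 ?_
    have h2 := hV.integrable_smul_right_of_hasCompactSupport (g := fun x => φ x ^ 2)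
      (hφ.continuous.pow 2) (hφc.comp_left (g := fun t : ℝ => t ^ 2) (by simp))
    exact h2
  have h0 := hw.2 v hfin
  unfold energyDeriv at h0
  have hR : 0 ≤ ∫ x, K x * |sobVal w x| ^ (p - 1) * sobVal w x * sobVal v x := by
    refine integral_nonneg_of_ae ?_
    filter_upwards [hw0, hK, hv1] with x h1 h2 h3
    rw [h3]
    exact mul_nonneg (mul_nonneg (mul_nonneg h2 (by positivity)) h1) (hφ0 x)
  have i1 : Integrable fun x => fderiv ℝ φ x (sobGrad w x) := by
    refine (integrable_inner_sobGrad w v).congr ?_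
    filter_upwards [hv2] with x hx
    rw [hx, real_inner_comm, InnerProductSpace.toDual_symm_apply]
  have i2 : Integrable fun x => sobVal w x * φ x :=
    (sobVal_memLp w).integrable_mul (memLp_two_of_test hφ.continuous hφc)
  have hL : ∫ x, (inner ℝ (sobGrad w x) (sobGrad v x) + V x * sobVal w x * sobVal v x)
      = (∫ x, fderiv ℝ φ x (sobGrad w x)) + c * ∫ x, sobVal w x * φ x := by
    rw [← integral_const_mul, ← integral_add i1 (i2.const_mul c)]
    refine integral_congr_ae ?_
    filter_upwards [hv1, hv2, hVw] with x h1 h2 h3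
    rw [h1, h2, h3, real_inner_comm, InnerProductSpace.toDual_symm_apply, mul_assoc]
  rw [← hL]
  linarith

/-- The absolute value of a minimizer on the Nehari manifold is a minimizer. -/
theorem Admissible.exists_abs_minimizer {V K : RN N → ℝ} {p v₀ k₀ k₁ : ℝ}
    (h : Admissible V K p v₀ k₀ k₁) {u : SobolevH1 N} (hu : u ∈ nehari V K p)
    (hE : energy V K p u = nehariLevel V K p) :
    ∃ w ∈ nehari V K p, energy V K p w = nehariLevel V K p ∧
      sobVal w =ᵐ[volume] fun x => |sobVal u x| := by
  have hp := h.one_lt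
  have hc := nehariConst_pos hp
  obtain ⟨hu0, hf, hQP⟩ := h.mem_nehari_iff.1 hu
  have hQ := h.quadForm_pos hu0 hf
  obtain ⟨w, hw, hgw⟩ := exists_sobAbs u
  have hfw : FinitePotential V w := by
    refine (FinitePotential.congr_ae hw).2 ?_
    simp only [sq_abs]
    exact hf
  have hPw : powForm K p w = quadForm V u := by
    rw [hQP]
    refine integral_congr_ae ?_
    filter_upwards [hw] with x hx
    rw [hx, abs_abs]
  have hle : quadForm V w ≤ quadForm V u := by
    rw [quadForm_eq_add hfw, quadForm_eq_add hf]
    refine add_le_add hgw (le_of_eq (integral_congr_ae ?_))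
    filter_upwards [hw] with x hx
    rw [hx, sq_abs]
  have hlev : nehariLevel V K p / nehariConst p = quadForm V u := by
    rw [← hE, h.energy_of_mem hu, mul_div_cancel_left₀ _ hc.ne']
  have hge : quadForm V u ≤ quadForm V w := by
    have h1 := h.level_rpow_mul_le hfw
    rw [hlev, hPw, ← Real.rpow_two, ← Real.rpow_add hQ] at h1
    have e : p - 1 + 2 = p + 1 := by ring
    rw [e] at h1
    exact (Real.rpow_le_rpow_iff hQ.le (h.quadForm_nonneg w) (by linarith)).1 h1
  have hmem := h.mem_nehari_of_quadForm_eq hfw hQ (le_antisymm hle hge) hPw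
  exact ⟨w, hmem, by rw [h.energy_of_mem hmem, le_antisymm hle hge, ← h.energy_of_mem hu, hE], hw⟩

/-- If the potential is increased by `d ≥ 0` and the level does not change, then the larger level
is not achieved, unless `d = 0`: a minimizer `u` satisfies `∫ d u² = 0` and minimizes the smaller
problem too, where `|u|` is positive by the strong maximum principle. -/
theorem ae_eq_of_level_eq_of_achieved {V₁ V₂ K : RN N → ℝ} {p c k₀ k₁ v₂ : ℝ}
    (h₁ : Admissible V₁ K p c k₀ k₁) (h₂ : Admissible V₂ K p v₂ k₀ k₁)
    (hV : ∀ᵐ x, V₁ x ≤ V₂ x) (hfin : ∀ u, FinitePotential V₂ u → FinitePotential V₁ u)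
    (hloc : LocallyIntegrable V₁ volume) (hc : ∀ᵐ x, V₁ x = V₂ x → V₁ x = c)
    (hlev : nehariLevel V₁ K p = nehariLevel V₂ K p) (hach : LevelAchieved V₂ K p) :
    V₁ =ᵐ[volume] V₂ := by
  obtain ⟨u, hu, hE⟩ := hach
  obtain ⟨hu0, hf₂, hQP⟩ := h₂.mem_nehari_iff.1 hu
  have hf₁ := hfin u hf₂
  have hQ := quadForm_eq_of_level_eq h₁ h₂ hV hfin hlev hu hE
  have hu₁ : u ∈ nehari V₁ K p := h₁.mem_nehari_iff.2 ⟨hu0, hf₁, hQ.trans hQP⟩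
  have hE₁ : energy V₁ K p u = nehariLevel V₁ K p := by
    rw [h₁.energy_of_mem hu₁, hQ, ← h₂.energy_of_mem hu, hE, hlev]
  have hdiff : ∀ᵐ x, (V₂ x - V₁ x) * sobVal u x ^ 2 = 0 := by
    have i : Integrable fun x => (V₂ x - V₁ x) * sobVal u x ^ 2 := by
      refine (hf₂.sub hf₁).congr (Eventually.of_forall fun x => ?_)
      simp only [Pi.sub_apply]
      ring
    have hnn : ∀ᵐ x, 0 ≤ (V₂ x - V₁ x) * sobVal u x ^ 2 := by
      filter_upwards [hV] with x hx
      exact mul_nonneg (by linarith) (sq_nonneg _)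
    refine (integral_eq_zero_iff_of_nonneg_ae hnn i).1 ?_
    rw [quadForm_eq_add hf₁, quadForm_eq_add hf₂] at hQ
    have e : ∫ x, (V₂ x - V₁ x) * sobVal u x ^ 2
        = (∫ x, V₂ x * sobVal u x ^ 2) - ∫ x, V₁ x * sobVal u x ^ 2 := by
      rw [← integral_sub hf₂ hf₁]
      refine integral_congr_ae (Eventually.of_forall fun x => ?_)
      simp only
      ring
    rw [e]
    linarith
  obtain ⟨w, hw, hEw, hwu⟩ := h₁.exists_abs_minimizer hu₁ hE₁
  have hsol := h₁.isSolution_of_energy_eq hw hEw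
  have hw0 : ∀ᵐ x, 0 ≤ sobVal w x := by
    filter_upwards [hwu] with x hx
    rw [hx]
    exact abs_nonneg _
  have hsup : IsSupersolution c w := by
    refine hsol.isSupersolution hloc hw0 ?_ ?_
    · filter_upwards [h₁.K_ge] with x hx
      exact h₁.k₀_pos.le.trans hx
    · filter_upwards [hdiff, hwu, hc] with x h1 h2 h3
      rcases mul_eq_zero.1 h1 with h4 | h4
      · rw [h3 (by linarith)]
      · rw [h2, pow_eq_zero_iff two_ne_zero |>.1 h4]
        simp
  filter_upwards [hsup.pos h₁.v₀_pos.le hw0 hw.1, hdiff, hwu] with x h1 h2 h3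
  have h4 : sobVal u x ^ 2 ≠ 0 := by
    rw [h3] at h1
    exact pow_ne_zero 2 (abs_pos.1 h1)
  linarith [(mul_eq_zero.1 h2).resolve_right h4]

end Positivity

/-! ### Subcritical exponents -/

section Subcritical

variable {N : ℕ}

/-- In the subcritical range the embeddings into `L^(p+1)` and into some `L^q`, `q > p + 1`,
hold. -/
theorem sobolevBound_of_subcritical (hN : 2 ≤ N) {p : ℝ} (hp : 1 < p)
    (hp' : 3 ≤ N → p < ((N : ℝ) + 2) / ((N : ℝ) - 2)) :
    SobolevBound N (p + 1) ∧ ∃ q, p + 1 < q ∧ SobolevBound N q := by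
  have hNR : (2 : ℝ) ≤ N := by exact_mod_cast hN
  have key : ∀ q : ℝ, q * (N - 2) < 2 * N → q < 2 + 2 * q / N := by
    intro q hq
    rw [← sub_pos]
    have : 2 + 2 * q / N - q = (2 * N - q * (N - 2)) / N := by
      field_simp
      ring
    rw [this]
    exact div_pos (by linarith) (by linarith)
  have hsub : 0 < 2 * N - (p + 1) * ((N : ℝ) - 2) := by
    rcases hN.eq_or_lt with h | h
    · subst h
      norm_num
    · have h3 : (3 : ℝ) ≤ N := by exact_mod_cast h
      have := hp' h
      rw [lt_div_iff₀ (by linarith)] at this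
      linarith
  obtain ⟨D, hD⟩ : ∃ D, D = 2 * N - (p + 1) * ((N : ℝ) - 2) := ⟨_, rfl⟩
  rw [← hD] at hsub
  have hη : 0 < D / N := div_pos hsub (by linarith)
  refine ⟨sobolevBound_of_lt hN (by linarith) (key _ (by linarith)), p + 1 + D / N, by linarith,
    sobolevBound_of_lt hN (by linarith) (key _ ?_)⟩
  have : D / N * (N - 2) = D - 2 * (D / N) := by
    field_simp
  linarith [add_mul (p + 1) (D / N) ((N : ℝ) - 2)]

end Subcritical

/-! ### The problem with parameter -/

section Parameter

variable {N : ℕ}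

theorem admissible_potential_weight {p ainf binf l : ℝ} (hp : 1 < p)
    (hS : SobolevBound N (p + 1)) (hainf : 0 < ainf) (hbinf : 0 < binf) (hl : 0 ≤ l)
    {a b : RN N → ℝ} (ha_nonneg : 0 ≤ᵐ[volume] a) (hb : MemLp b ⊤ volume)
    (hb_nonneg : 0 ≤ᵐ[volume] b) {B : ℝ} (hB : ∀ᵐ x, |b x| ≤ B) :
    Admissible (potential ainf a l) (weight binf b) p ainf binf (binf + B) where
  one_lt := hp
  v₀_pos := hainf
  V_ge := by
    filter_upwards [ha_nonneg] with x hx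
    exact le_add_of_nonneg_right (mul_nonneg hl hx)
  k₀_pos := hbinf
  K_ge := by
    filter_upwards [hb_nonneg] with x hx
    exact le_add_of_nonneg_right hx
  K_le := by
    filter_upwards [hB] with x hx
    exact add_le_add_right ((le_abs_self _).trans hx) _
  K_meas := aestronglyMeasurable_const.add hb.aestronglyMeasurable
  sobolev := hS

theorem admissible_const {p ainf binf : ℝ} (hp : 1 < p)
    (hS : SobolevBound N (p + 1)) (hainf : 0 < ainf) (hbinf : 0 < binf) :
    Admissible (N := N) (fun _ => ainf) (fun _ => binf) p ainf binf binf where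
  one_lt := hp
  v₀_pos := hainf
  V_ge := Eventually.of_forall fun _ => le_rfl
  k₀_pos := hbinf
  K_ge := Eventually.of_forall fun _ => le_rfl
  K_le := Eventually.of_forall fun _ => le_rfl
  K_meas := aestronglyMeasurable_const
  sobolev := hS

/-- At a positive parameter `l'`, finite potential energy gives `∫ a u² < ∞`, hence finite
potential energy at the smaller parameters. -/
theorem FinitePotential.of_lt {ainf l l' : ℝ} {a : RN N → ℝ} (hl : 0 ≤ l) (hll' : l < l')
    {u : SobolevH1 N} (hu : FinitePotential (potential ainf a l') u) :
    FinitePotential (potential ainf a l) u := by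
  have hl' : l' ≠ 0 := (hl.trans_lt hll').ne'
  refine (((hu.sub (finitePotential_const ainf u)).const_mul (l / l')).add
    (finitePotential_const ainf u)).congr (Eventually.of_forall fun x => ?_)
  simp only [Pi.add_apply, Pi.sub_apply, potential]
  field_simp
  ring

/-- A subset of `[0, ∞)` that contains every point above each of its points is empty or a
half-line. -/
theorem eq_empty_or_half_line_of_upward_closed {S : Set ℝ} (hS0 : ∀ x ∈ S, 0 ≤ x)
    (hS : ∀ x ∈ S, ∀ y, x < y → y ∈ S) :
    S = ∅ ∨ ∃ t : ℝ, 0 ≤ t ∧ (S = Ici t ∨ S = Ioi t) := by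
  rcases S.eq_empty_or_nonempty with h | hne
  · exact Or.inl h
  have hbdd : BddBelow S := ⟨0, hS0⟩
  have hIoi : Ioi (sInf S) ⊆ S := fun y hy => by
    obtain ⟨x, hx, hxy⟩ := exists_lt_of_csInf_lt hne hy
    exact hS x hx y hxy
  have hIci : S ⊆ Ici (sInf S) := fun x hx => csInf_le hbdd hx
  refine Or.inr ⟨sInf S, le_csInf hne hS0, ?_⟩
  by_cases hm : sInf S ∈ S
  · refine Or.inl (hIci.antisymm fun y hy => ?_)
    rcases (mem_Ici.1 hy).eq_or_lt with h | h
    · exact h ▸ hm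
    · exact hIoi h
  · refine Or.inr (Subset.antisymm (fun x hx => ?_) hIoi)
    exact lt_of_le_of_ne (mem_Ici.1 (hIci hx)) fun h => hm (h.symm ▸ hx)

end Parameter

theorem mainTheorem4 (N : ℕ) (hN : 2 ≤ N) (p : ℝ) (hp : 1 < p)
    (hp' : 3 ≤ N → p < ((N : ℝ) + 2) / ((N : ℝ) - 2))
    (ainf binf : ℝ) (hainf : 0 < ainf) (hbinf : 0 < binf)
    (a b : RN N → ℝ)
    (ha : MemLp a ((N : ℝ≥0∞) / 2) volume) (ha_nonneg : 0 ≤ᵐ[volume] a)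
    (ha_ne : ¬ a =ᵐ[volume] 0) (ha_lim : VanishesAtInfinity a)
    (hb : MemLp b ⊤ volume) (hb_nonneg : 0 ≤ᵐ[volume] b)
    (hb_ne : ¬ b =ᵐ[volume] 0) (hb_lim : VanishesAtInfinity b) :
    (∀ lbar : ℝ, 0 ≤ lbar → mLevel ainf binf p a b lbar = mInfty N ainf binf p →
      ∀ l : ℝ, lbar < l →
        mLevel ainf binf p a b l = mInfty N ainf binf p ∧
        ¬ LevelAchieved (potential ainf a l) (weight binf b) p) ∧
    (noGroundStateSet ainf binf p a b = ∅ ∨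
      ∃ lstar : ℝ, 0 ≤ lstar ∧
        (noGroundStateSet ainf binf p a b = Set.Ici lstar ∨
          noGroundStateSet ainf binf p a b = Set.Ioi lstar)) := by
  have hN0 : 0 < N := by omega
  obtain ⟨hS, q, hq, hSq⟩ := sobolevBound_of_subcritical hN hp hp'
  obtain ⟨B, hB⟩ : ∃ B : ℝ, ∀ᵐ x, |b x| ≤ B := by
    refine ⟨(eLpNorm b ⊤ volume).toReal, ?_⟩
    have h1 := ae_le_eLpNormEssSup (f := b) (μ := (volume : Measure (RN N)))
    filter_upwards [h1] with x hx
    rw [← eLpNorm_exponent_top] at hx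
    have := ENNReal.toReal_mono hb.eLpNorm_ne_top hx
    simpa using this
  have hadm : ∀ l : ℝ, 0 ≤ l →
      Admissible (potential ainf a l) (weight binf b) p ainf binf (binf + B) := fun l hl =>
    admissible_potential_weight hp hS hainf hbinf hl ha_nonneg hb hb_nonneg hB
  have hinf := admissible_const hp hS hainf hbinf
  have haloc : LocallyIntegrable a volume := by
    refine ha.locallyIntegrable ?_
    rw [ENNReal.le_div_iff_mul_le (by simp) (by simp), one_mul]
    exact_mod_cast hN
  have hsub : ∀ l : ℝ, (fun x => potential ainf a l x - ainf) = fun x => l * a x := fun l => by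
    funext x
    simp [potential]
  have hlevel : ∀ l : ℝ, 0 ≤ l → (nehari (potential ainf a l) (weight binf b) p).Nonempty ∧
      mLevel ainf binf p a b l ≤ mInfty N ainf binf p := by
    intro l hl
    refine nehari_nonempty_and_level_le hN0 (hadm l hl) hinf ?_ (hadm l hl).V_ge ?_
      (hadm l hl).K_ge
    · rw [hsub]
      exact haloc.smul l
    · rw [hsub]
      simpa [VanishesAtInfinity] using Tendsto.const_mul l ha_lim
  have part1 : ∀ lbar : ℝ, 0 ≤ lbar → mLevel ainf binf p a b lbar = mInfty N ainf binf p →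
      ∀ l : ℝ, lbar < l → mLevel ainf binf p a b l = mInfty N ainf binf p ∧
        ¬ LevelAchieved (potential ainf a l) (weight binf b) p := by
    intro lbar hlbar heq l hl
    have hl0 : 0 ≤ l := hlbar.trans hl.le
    have hV : ∀ᵐ x, potential ainf a lbar x ≤ potential ainf a l x := by
      filter_upwards [ha_nonneg] with x hx
      exact add_le_add_right (mul_le_mul_of_nonneg_right hl.le hx) _
    have hfin : ∀ u : SobolevH1 N, FinitePotential (potential ainf a l) u →
        FinitePotential (potential ainf a lbar) u := fun u => FinitePotential.of_lt hlbar hl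
    have hle : mLevel ainf binf p a b lbar ≤ mLevel ainf binf p a b l :=
      nehariLevel_mono (hadm lbar hlbar) (hadm l hl0) hV hfin (hlevel l hl0).1
    have hlev : mLevel ainf binf p a b l = mInfty N ainf binf p :=
      le_antisymm (hlevel l hl0).2 (heq ▸ hle)
    refine ⟨hlev, fun hach => ha_ne ?_⟩
    have hzero : ∀ x, potential ainf a lbar x = potential ainf a l x → a x = 0 := by
      intro x hx
      have h1 : (l - lbar) * a x = 0 := by
        unfold potential at hx
        linarith
      exact (mul_eq_zero.1 h1).resolve_left (sub_pos.2 hl).ne'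
    have hVV := ae_eq_of_level_eq_of_achieved (hadm lbar hlbar) (hadm l hl0) hV hfin
      ((locallyIntegrable_const ainf).add (haloc.smul lbar))
      (Eventually.of_forall fun x hx => by simp [potential, hzero x hx])
      (heq.trans hlev.symm) hach
    filter_upwards [hVV] with x hx
    exact hzero x hx
  refine ⟨part1, eq_empty_or_half_line_of_upward_closed (fun l hl => hl.1) ?_⟩
  rintro lbar ⟨hlbar, hno⟩ l hl
  have heq : mLevel ainf binf p a b lbar = mInfty N ainf binf p := by
    by_contra hne
    obtain ⟨hnonempty, hle⟩ := hlevel lbar hlbar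
    have hKsub : (fun x => weight binf b x - (fun _ : RN N => binf) x) = b := by
      funext x
      simp [weight]
    obtain ⟨u, hu, hE⟩ := exists_minimizer_of_lt hN0 (hadm lbar hlbar) hinf rfl hq hSq
      (hadm lbar hlbar).V_ge (by simpa [weight] using hB) (by rwa [hKsub]) hnonempty
      (lt_of_le_of_ne hle hne)
    exact hno ⟨u, hu.1, (hadm lbar hlbar).isSolution_of_energy_eq hu hE, hE⟩
  refine ⟨hlbar.trans hl.le, ?_⟩
  rintro ⟨u, hu0, hsol, hE⟩
  -- A critical point lies on the Nehari manifold, since it may be tested against itself.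
  exact (part1 lbar hlbar heq l hl).2 ⟨u, ⟨hu0, hsol.1, hsol.2 u hsol.1⟩, hE⟩

end
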